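/- Let $T>0$, let $y,z,f^-,f^+\in C^1([0,T])$ be real functions with $y(\tau)<z(\tau)$ for all $\tau\in[0,T]$, and put $l(\tau)=z(\tau)-y(\tau)$. Let $U$ be a bounded classical solution of the heat equation with moving boundaries $$U_\tau=U_{xx}\quad (0<\tau<T,\ y(\tau)<x<z(\tau)),\qquad U(0,x)=U_0(x)\ (y(0)<x<z(0)),\qquad U(\tau,y(\tau))=f^-(\tau),\ U(\tau,z(\tau))=f^+(\tau)\ (0<\tau\le T).$$ That is: $U$ is bounded, and $U$ and the gradient $U_x$ (one-sided in $x$ at the two boundaries) exist and are continuous on $\{0<\tau\le T,\ y(\tau)\le x\le z(\tau)\}$; in the interior $U_\tau$ and $U_{xx}$ exist and $U_{xx}$ is continuous; and $U(\tau,x)\to U_0(x)$ as $\tau\to0+$ for every $x\in(y(0),z(0))$ (no compatibility at the corners is required). Define the boundary gradients, for $0<\tau\le T$, $$\Psi(\tau)=-U_x(\tau,y(\tau)),\qquad \Phi(\tau)=U_x(\tau,z(\tau)).$$ For $0\le s<\tau\le T$, $\xi\in\mathbb R$ and real $\nu$ put $X_\nu=y(\tau)-\xi+2\nu l(\tau)$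 and $$\upsilon_\nu(\tau|\xi,s)=-\frac{X_\nu\,e^{-X_\nu^2/4(\tau-s)}}{2\sqrt{\pi(\tau-s)^3}},\qquad \lambda_\nu(\tau|\xi,s)=\frac{e^{-X_\nu^2/4(\tau-s)}}{2\sqrt{\pi(\tau-s)^3}}\Big[1-\frac{X_\nu^2}{2(\tau-s)}\Big],$$ $$\upsilon^-=\sum_{n\in\mathbb Z}\upsilon_n,\quad \upsilon^+=\sum_{n\in\mathbb Z}\upsilon_{n+1/2},\quad \lambda^-=\sum_{n\in\mathbb Z}\lambda_n,\quad \lambda^+=\sum_{n\in\mathbb Z}\lambda_{n+1/2},$$ $$\upsilon_0^-(\tau|s)=\sum_{n\ne0}\upsilon_n(\tau|y(s),s),\quad \upsilon_0^+(\tau|s)=\sum_{n\ne0}\upsilon_{n+1/2}(\tau|z(s),s),\quad \lambda_0^-(\tau|s)=\sum_{n\ne0}\lambda_n(\tau|y(s),s),\quad \lambda_0^+(\tau|s)=\sum_{n\ne0}\lambda_{n+1/2}(\tau|z(s),s),$$ $$\eta^-(\tau|\xi,s)=-\frac{\delta_{\xi,y(s)}}{\sqrt{\pi(\tau-s)}}+\frac1{\sqrt{\pi(\tau-s)}}\sum_{n\in\mathbb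 Z}e^{-X_n^2/4(\tau-s)},\qquad \eta^+(\tau|\xi,s)=-\frac{\delta_{\xi,z(s)}}{\sqrt{\pi(\tau-s)}}+\frac1{\sqrt{\pi(\tau-s)}}\sum_{n\in\mathbb Z}e^{-X_{n+1/2}^2/4(\tau-s)},$$ with $\delta$ the Kronecker symbol. For a boundary $b\in\{y,z\}$ and $f\in\{f^-,f^+\}$ put $$K_b(\tau,s)=\frac{b(\tau)-b(s)}{2\sqrt{\pi(\tau-s)^3}}e^{-\frac{(b(\tau)-b(s))^2}{4(\tau-s)}},\qquad R_{f,b}(\tau,s)=\frac{f(s)e^{-\frac{(b(\tau)-b(s))^2}{4(\tau-s)}}\Big[1+b'(s)(b(\tau)-b(s))-\frac{(b(\tau)-b(s))^2}{2(\tau-s)}\Big]-f(\tau)}{2\sqrt{\pi(\tau-s)^3}}.$$ Then the following hold. (1) (Volterra system.) For every $\tau\in(0,T]$, all integrals below converge absolutely and $$\begin{aligned}-\Psi(\tau)=&-\frac{f^-(\tau)}{\sqrt{\pi\tau}}+\int_0^\tau R_{f^-,y}(\tau,s)\,ds-\int_0^\tau\Psi(s)K_y(\tau,s)\,ds+\int_{y(0)}^{z(0)}U(0,\xi)\upsilon^-(\tau|\xi,0)\,d\xi\\&+\int_0^\tau\big([\Phi(s)+f^+(s)z'(s)]\upsilon^-(\tau|z(s),s)+[\Psi(s)-f^-(s)y'(s)]\upsilon_0^-(\tau|s)\big)ds\\&+\int_0^\tau\big(f^-(s)\lambda_0^-(\tau|s)-f^+(s)\lambda^-(\tau|z(s),s)\big)ds,\end{aligned}$$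 $$\begin{aligned}\Phi(\tau)=&\ \frac{f^+(\tau)}{\sqrt{\pi\tau}}-\int_0^\tau R_{f^+,z}(\tau,s)\,ds-\int_0^\tau\Phi(s)K_z(\tau,s)\,ds+\int_{y(0)}^{z(0)}U(0,\xi)\upsilon^+(\tau|\xi,0)\,d\xi\\&+\int_0^\tau\big([\Phi(s)+f^+(s)z'(s)]\upsilon_0^+(\tau|s)+[\Psi(s)-f^-(s)y'(s)]\upsilon^+(\tau|y(s),s)\big)ds\\&+\int_0^\tau\big(f^-(s)\lambda^+(\tau|y(s),s)-f^+(s)\lambda_0^+(\tau|s)\big)ds.\end{aligned}$$ (2) (Lebesgue–Stieltjes form.) For every $\tau\in(0,T]$, the functions $s\mapsto\eta^\pm(\tau|y(s),s)$ and $s\mapsto\eta^\pm(\tau|z(s),s)$ have bounded variation on $(0,\tau)$, all integrals below converge absolutely, and $$\begin{aligned}-\Psi(\tau)=&\int_{y(0)}^{z(0)}U(0,\xi)\upsilon^-(\tau|\xi,0)\,d\xi-\frac{f^-(\tau)}{\sqrt{\pi\tau}}+\int_0^\tau\frac{f^-(s)-f^-(\tau)}{2\sqrt{\pi(\tau-s)^3}}ds+\int_0^\tau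 f^-(s)\,d\eta^-(\tau|y(s),s)-\int_0^\tau f^+(s)\,d\eta^-(\tau|z(s),s)\\&-\int_0^\tau\Psi(s)K_y(\tau,s)\,ds+\int_0^\tau\big[\Phi(s)\upsilon^-(\tau|z(s),s)+\Psi(s)\upsilon_0^-(\tau|s)\big]ds,\end{aligned}$$ $$\begin{aligned}\Phi(\tau)=&\int_{y(0)}^{z(0)}U(0,\xi)\upsilon^+(\tau|\xi,0)\,d\xi+\frac{f^+(\tau)}{\sqrt{\pi\tau}}-\int_0^\tau\frac{f^+(s)-f^+(\tau)}{2\sqrt{\pi(\tau-s)^3}}ds+\int_0^\tau f^-(s)\,d\eta^+(\tau|y(s),s)-\int_0^\tau f^+(s)\,d\eta^+(\tau|z(s),s)\\&-\int_0^\tau\Phi(s)K_z(\tau,s)\,ds+\int_0^\tau\big[\Phi(s)\upsilon_0^+(\tau|s)+\Psi(s)\upsilon^+(\tau|y(s),s)\big]ds.\end{aligned}$$ (3) (Singularities.) There is a constant $C$ such that for all $0<s<\tau\le T$ each of $|R_{f^-,y}|,|R_{f^+,z}|,|K_y|,|K_z|$ at $(\tau,s)$ is at most $C/\sqrt{\tau-s}$,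 and each of $\upsilon^-(\tau|z(s),s)$, $\upsilon_0^-(\tau|s)$, $\upsilon^+(\tau|y(s),s)$, $\upsilon_0^+(\tau|s)$, $\lambda^-(\tau|z(s),s)$, $\lambda_0^-(\tau|s)$, $\lambda^+(\tau|y(s),s)$, $\lambda_0^+(\tau|s)$ is at most $C$ in absolute value. (4) (Limits.) For every $\tau\in(0,T]$, each of $\upsilon_0^-(\tau|s)$, $\upsilon^-(\tau|z(s),s)$, $\upsilon^+(\tau|y(s),s)$, $\upsilon_0^+(\tau|s)$, $\eta^-(\tau|y(s),s)$, $\eta^-(\tau|z(s),s)$, $\eta^+(\tau|y(s),s)$, $\eta^+(\tau|z(s),s)$ tends to $0$ as $s\to\tau-$. (5) (Fourier and theta representations.) For all $\tau\in(0,T]$, $s\in[0,\tau)$, $\xi\in\mathbb R$, the image sums defining $\upsilon^\pm,\lambda^\pm,\eta^\pm$ and the series below converge absolutely, and with $q_n=e^{-\pi^2n^2(\tau-s)/l(\tau)^2}$, $\alpha_n=\pi n(\xi-y(\tau))/l(\tau)$, $$\eta^-=-\frac{\delta_{\xi,y(s)}}{\sqrt{\pi(\tau-s)}}+\frac1{l(\tau)}\Big[1+2\sum_{n\ge1}q_n\cos\alpha_n\Big],\qquad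 \eta^+=-\frac{\delta_{\xi,z(s)}}{\sqrt{\pi(\tau-s)}}+\frac1{l(\tau)}\Big[1+2\sum_{n\ge1}(-1)^nq_n\cos\alpha_n\Big],$$ $$\upsilon^-=\frac{2\pi}{l(\tau)^2}\sum_{n\ge1}n\,q_n\sin\alpha_n,\qquad \upsilon^+=\frac{2\pi}{l(\tau)^2}\sum_{n\ge1}(-1)^n n\,q_n\sin\alpha_n.$$ Moreover, with $\theta_3(v,\omega)=1+2\sum_{n\ge1}\omega^{n^2}\cos(2nv)$, which is differentiable in $v$ with derivative $\theta_3'$ at $\omega=\omega_2$, where $\omega_2=e^{-\pi^2(\tau-s)/l(\tau)^2}$, and with $\phi^-=\frac{\pi(\xi-y(\tau))}{2l(\tau)}$, $\phi^+=\frac{\pi(\xi+l(\tau)-y(\tau))}{2l(\tau)}$, $$\eta^-=-\frac{\delta_{\xi,y(s)}}{\sqrt{\pi(\tau-s)}}+\frac{\theta_3(\phi^-,\omega_2)}{l(\tau)},\quad \eta^+=-\frac{\delta_{\xi,z(s)}}{\sqrt{\pi(\tau-s)}}+\frac{\theta_3(\phi^+,\omega_2)}{l(\tau)},\quad \upsilon^\mp=-\frac{\pi}{2l(\tau)^2}\theta_3'(\phi^\mp,\omega_2).$$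 -/

import Mathlib

open Set Filter Topology MeasureTheory Real

noncomputable section

namespace DoubleBarrier

/-! ### The boundary value problem -/

/-- The moving strip `{(τ, x) : 0 < τ ≤ T, y τ ≤ x ≤ z τ}`, lateral boundaries included. -/
def strip (T : ℝ) (y z : ℝ → ℝ) : Set (ℝ × ℝ) :=
  {p | p.1 ∈ Ioc 0 T ∧ p.2 ∈ Icc (y p.1) (z p.1)}

/-- The open strip `{(τ, x) : 0 < τ < T, y τ < x < z τ}`. -/
def openStrip (T : ℝ) (y z : ℝ → ℝ) : Set (ℝ × ℝ) :=
  {p | p.1 ∈ Ioo 0 T ∧ p.2 ∈ Ioo (y p.1) (z p.1)}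

/-- The spatial gradient `∂U/∂x (τ, x)` on `[y τ, z τ]`, one-sided at the two end points. -/
def grad (y z : ℝ → ℝ) (U : ℝ → ℝ → ℝ) (τ x : ℝ) : ℝ :=
  derivWithin (U τ) (Icc (y τ) (z τ)) x

/-- `U` is a bounded classical solution of `U_τ = U_xx` between the moving boundaries `y < z`, with
initial value `U₀` and with boundary values `fm` on `x = y τ` and `fp` on `x = z τ`, whose spatial
gradient exists and is continuous up to the moving boundaries for `τ > 0`. No compatibility of `U₀`
with `fm 0`, `fp 0` is required at the two corners. -/
structure IsSolution (T : ℝ) (y z fm fp U₀ : ℝ → ℝ) (U : ℝ → ℝ → ℝ) : Prop where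
  bounded : ∃ M : ℝ, ∀ p ∈ strip T y z, |U p.1 p.2| ≤ M
  continuousOn : ContinuousOn (fun p : ℝ × ℝ => U p.1 p.2) (strip T y z)
  differentiableOn : ∀ τ ∈ Ioc 0 T, DifferentiableOn ℝ (U τ) (Icc (y τ) (z τ))
  continuousOn_grad : ContinuousOn (fun p : ℝ × ℝ => grad y z U p.1 p.2) (strip T y z)
  differentiableAt_deriv : ∀ p ∈ openStrip T y z, DifferentiableAt ℝ (deriv (U p.1)) p.2
  continuousOn_deriv_deriv :
    ContinuousOn (fun p : ℝ × ℝ => deriv (deriv (U p.1)) p.2) (openStrip T y z)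
  heat : ∀ p ∈ openStrip T y z,
    HasDerivAt (fun s => U s p.2) (deriv (deriv (U p.1)) p.2) p.1
  initial : ∀ x ∈ Ioo (y 0) (z 0),
    U 0 x = U₀ x ∧ ContinuousWithinAt (fun s => U s x) (Ici 0) 0
  boundary_lower : ∀ τ ∈ Ioc 0 T, U τ (y τ) = fm τ
  boundary_upper : ∀ τ ∈ Ioc 0 T, U τ (z τ) = fp τ

/-! ### Image sums -/

/-- `y τ - ξ + 2 ν l(τ)` with `l = z - y`. -/
def shift (y z : ℝ → ℝ) (ν τ ξ : ℝ) : ℝ :=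
  y τ - ξ + 2 * ν * (z τ - y τ)

/-- `υ_ν(τ | ξ, s)`. -/
def upsilonTerm (y z : ℝ → ℝ) (ν τ ξ s : ℝ) : ℝ :=
  -(shift y z ν τ ξ / (2 * √(π * (τ - s) ^ 3)) * exp (-(shift y z ν τ ξ) ^ 2 / (4 * (τ - s))))

/-- `λ_ν(τ | ξ, s)`. -/
def lambdaTerm (y z : ℝ → ℝ) (ν τ ξ s : ℝ) : ℝ :=
  exp (-(shift y z ν τ ξ) ^ 2 / (4 * (τ - s))) / (2 * √(π * (τ - s) ^ 3)) *
    (1 - (shift y z ν τ ξ) ^ 2 / (2 * (τ - s)))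

/-- The summand of the image sum in `η`. -/
def gaussTerm (y z : ℝ → ℝ) (ν τ ξ s : ℝ) : ℝ :=
  exp (-(shift y z ν τ ξ) ^ 2 / (4 * (τ - s)))

def upsilonMinus (y z : ℝ → ℝ) (τ ξ s : ℝ) : ℝ :=
  ∑' n : ℤ, upsilonTerm y z n τ ξ s

def upsilonPlus (y z : ℝ → ℝ) (τ ξ s : ℝ) : ℝ :=
  ∑' n : ℤ, upsilonTerm y z (n + 1 / 2) τ ξ s

/-- `υ₀⁻(τ | s)`: the sum over `n ≠ 0` at `ξ = y s`. -/
def upsilonMinus₀ (y z : ℝ → ℝ) (τ s : ℝ) : ℝ :=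
  ∑' n : {n : ℤ // n ≠ 0}, upsilonTerm y z (n : ℤ) τ (y s) s

/-- `υ₀⁺(τ | s)`: the sum over `n ≠ 0` at `ξ = z s`; the omitted term has `shift = z τ - z s`. -/
def upsilonPlus₀ (y z : ℝ → ℝ) (τ s : ℝ) : ℝ :=
  ∑' n : {n : ℤ // n ≠ 0}, upsilonTerm y z ((n : ℤ) + 1 / 2) τ (z s) s

def lambdaMinus (y z : ℝ → ℝ) (τ ξ s : ℝ) : ℝ :=
  ∑' n : ℤ, lambdaTerm y z n τ ξ s

def lambdaPlus (y z : ℝ → ℝ) (τ ξ s : ℝ) : ℝ :=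
  ∑' n : ℤ, lambdaTerm y z (n + 1 / 2) τ ξ s

def lambdaMinus₀ (y z : ℝ → ℝ) (τ s : ℝ) : ℝ :=
  ∑' n : {n : ℤ // n ≠ 0}, lambdaTerm y z (n : ℤ) τ (y s) s

def lambdaPlus₀ (y z : ℝ → ℝ) (τ s : ℝ) : ℝ :=
  ∑' n : {n : ℤ // n ≠ 0}, lambdaTerm y z ((n : ℤ) + 1 / 2) τ (z s) s

/-- The Kronecker symbol `δ_{a, b}` on real numbers. -/
def kronecker (a b : ℝ) : ℝ :=
  open Classical in if a = b then 1 else 0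

def etaMinus (y z : ℝ → ℝ) (τ ξ s : ℝ) : ℝ :=
  -kronecker ξ (y s) / √(π * (τ - s)) + 1 / √(π * (τ - s)) * ∑' n : ℤ, gaussTerm y z n τ ξ s

def etaPlus (y z : ℝ → ℝ) (τ ξ s : ℝ) : ℝ :=
  -kronecker ξ (z s) / √(π * (τ - s)) +
    1 / √(π * (τ - s)) * ∑' n : ℤ, gaussTerm y z (n + 1 / 2) τ ξ s

/-! ### The weakly singular kernels -/

/-- `(b τ - b s) / (2 √(π (τ - s)³)) · exp (-(b τ - b s)² / (4 (τ - s)))` for a boundary `b`. -/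
def gradKernel (b : ℝ → ℝ) (τ s : ℝ) : ℝ :=
  (b τ - b s) / (2 * √(π * (τ - s) ^ 3)) * exp (-(b τ - b s) ^ 2 / (4 * (τ - s)))

/-- The integrand carrying the boundary value `f` on a boundary `b`. -/
def rebateKernel (f b : ℝ → ℝ) (τ s : ℝ) : ℝ :=
  (f s * exp (-(b τ - b s) ^ 2 / (4 * (τ - s))) *
      (1 + deriv b s * (b τ - b s) - (b τ - b s) ^ 2 / (2 * (τ - s))) - f τ) /
    (2 * √(π * (τ - s) ^ 3))

/-- `(f s - f τ) / (2 √(π (τ - s)³))`. -/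
def incrementKernel (f : ℝ → ℝ) (τ s : ℝ) : ℝ :=
  (f s - f τ) / (2 * √(π * (τ - s) ^ 3))

/-! ### Lebesgue–Stieltjes integrals -/

/-- `g` has bounded variation on `(a, b)` and `f` is integrable for the total variation of `dg`. -/
def LSIntegrable (f g : ℝ → ℝ) (a b : ℝ) : Prop :=
  ∃ h : BoundedVariationOn ((Ioo a b).indicator g) univ,
    h.vectorMeasure.IntegrableOn f (Ioo a b)

/-- The Lebesgue–Stieltjes integral `∫ f dg` over the open interval `(a, b)`; only the values of `g`
inside `(a, b)` matter. When `g` has limits at `a` and `b` and is extended by them, `dg` has no atom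
at the end points, and this is the integral over `[a, b]`. -/
def lsIntegral (f g : ℝ → ℝ) (a b : ℝ) : ℝ :=
  open Classical in
  if h : BoundedVariationOn ((Ioo a b).indicator g) univ then
    (h.vectorMeasure.restrict (Ioo a b)).integral f (ContinuousLinearMap.lsmul ℝ ℝ)
  else 0

/-! ### The Jacobi theta function -/

/-- `θ₃(v, ω) = 1 + 2 ∑_{n ≥ 1} ω^{n²} cos (2 n v)`. -/
def theta₃ (v ω : ℝ) : ℝ :=
  1 + 2 * ∑' n : ℕ, ω ^ ((n + 1) ^ 2) * cos (2 * (n + 1) * v)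

/-- `φ₋(x, ξ) = π (x - ξ) / (2 l(τ))`. -/
def phiMinus (y z : ℝ → ℝ) (τ x ξ : ℝ) : ℝ :=
  π * (x - ξ) / (2 * (z τ - y τ))

/-- `ω₂ = exp (-π² (τ - s) / l(τ)²)`. -/
def omega₂ (y z : ℝ → ℝ) (τ s : ℝ) : ℝ :=
  exp (-π ^ 2 * (τ - s) / (z τ - y τ) ^ 2)

end DoubleBarrier

end

open DoubleBarrier

namespace DoubleBarrier

/-! As a function of (s, x), the image kernel υ_n(τ|x, s) is a dipole potential (twice the spatial
derivative of the heat kernel) and solves the backward heat equation. Green's identity on the moving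
strip (`IsSolution.green`) therefore turns the increment of ∫ U(s, x) υ_n dx into a time integral of
fluxes through the two boundaries, which contain only Ψ, Φ, the boundary data and the boundary
velocities. The equation at the lower boundary comes from letting the time interval exhaust (0, τ).

As s → 0 dominated convergence gives the initial integral. As s → τ the integral against an image n
≠ 0 vanishes, since its pole stays away from the strip, so each such image yields an identity with
right side 0 (`IsSolution.integral_flux_of_ne`). The pole of the image n = 0 tends to the lower
boundary. Integration by parts exhibits the divergent term f⁻(τ)/√(π(τ - s)), and what remains tends
to U_x(τ, y(τ)) = -Ψ(τ), because half of the mass of twice the heat kernel lies in the strip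
(`IsSolution.tendsto_integral_dipole_zero`). The divergence is the one created by the only
nonintegrable part of the flux (`lowerFlux_zero`), and subtracting it on both sides leaves
`IsSolution.integral_flux_zero`. Adding all images gives the Volterra equation.

Two estimates make this legitimate. A kernel at displacement at least ck - Lt is O(√t/k²)
(`exists_kernel_bound`); this provides the bounds, the limits s → τ and the termwise integration
over images. Since the corners need not be compatible, the gradient at the boundary may blow up at
time 0; a barrier on a parabolic box of width r comparable to √s shows that it is O(1/√s)
(`IsSolution.exists_abs_grad_lower_le`).

The Stieltjes form is a rewriting of the first one: along a boundary b the s-derivative of an image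
term of η is λ - b'υ, the combination that multiplies the boundary data in the flux, and dη has this
derivative as its density (`lsIntegral_eq_of_hasDerivAt`). The equations at the upper boundary
follow by the reflection x ↦ -x. The Fourier and theta representations are Jacobi's transformation
of the image sums. -/

/-! ### Kernels in terms of displacement and elapsed time -/

/-- Twice the spatial derivative of the heat kernel at displacement `X` and time `t`. -/
noncomputable def dipole (X t : ℝ) : ℝ :=
  -(X / (2 * √(π * t ^ 3)) * exp (-X ^ 2 / (4 * t)))

/-- The derivative of `-dipole` in the displacement. -/
noncomputable def dipoleDeriv (X t : ℝ) : ℝ :=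
  exp (-X ^ 2 / (4 * t)) / (2 * √(π * t ^ 3)) * (1 - X ^ 2 / (2 * t))

/-- The second derivative of `dipole` in the displacement. -/
noncomputable def dipoleDeriv₂ (X t : ℝ) : ℝ :=
  exp (-X ^ 2 / (4 * t)) / (2 * √(π * t ^ 3)) * (3 * X / (2 * t) - X ^ 3 / (4 * t ^ 2))

/-- Twice the heat kernel. -/
noncomputable def monopole (X t : ℝ) : ℝ :=
  1 / √(π * t) * exp (-X ^ 2 / (4 * t))

lemma sqrt_pi_mul_cube {t : ℝ} (ht : 0 < t) : √(π * t ^ 3) = t * √(π * t) := by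
  rw [show π * t ^ 3 = t ^ 2 * (π * t) by ring, sqrt_mul (by positivity), sqrt_sq ht.le]

lemma mul_sqrt_le_sqrt_pi_mul_cube {t : ℝ} (ht : 0 < t) : t * √t ≤ √(π * t ^ 3) := by
  rw [sqrt_pi_mul_cube ht]
  have : √t ≤ √(π * t) := sqrt_le_sqrt (by nlinarith [pi_gt_three])
  gcongr

lemma hasDerivAt_dipole {X t : ℝ} (ht : 0 < t) :
    HasDerivAt (fun x => dipole x t) (-dipoleDeriv X t) X := by
  have h : √(π * t ^ 3) ≠ 0 := (sqrt_pos.2 (by positivity)).ne'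
  have h1 : HasDerivAt (fun x : ℝ => -x ^ 2 / (4 * t)) (-(2 * X) / (4 * t)) X := by
    simpa using ((hasDerivAt_pow 2 X).neg).div_const (4 * t)
  have h2 := (((hasDerivAt_id X).div_const (2 * √(π * t ^ 3))).mul h1.exp).neg
  refine h2.congr_deriv ?_
  simp only [dipoleDeriv, id]
  field_simp
  ring

lemma hasDerivAt_dipoleDeriv {X t : ℝ} (ht : 0 < t) :
    HasDerivAt (fun x => dipoleDeriv x t) (-dipoleDeriv₂ X t) X := by
  have h : √(π * t ^ 3) ≠ 0 := (sqrt_pos.2 (by positivity)).ne'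
  have h1 : HasDerivAt (fun x : ℝ => -x ^ 2 / (4 * t)) (-(2 * X) / (4 * t)) X := by
    simpa using ((hasDerivAt_pow 2 X).neg).div_const (4 * t)
  have h3 : HasDerivAt (fun x : ℝ => 1 - x ^ 2 / (2 * t)) (-(2 * X / (2 * t))) X := by
    simpa using ((hasDerivAt_pow 2 X).div_const (2 * t)).const_sub 1
  have h2 := (h1.exp.div_const (2 * √(π * t ^ 3))).mul h3
  refine h2.congr_deriv ?_
  simp only [dipoleDeriv₂]
  field_simp
  ring

lemma hasDerivAt_monopole {X t : ℝ} (ht : 0 < t) :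
    HasDerivAt (fun x => monopole x t) (dipole X t) X := by
  have h : √(π * t) ≠ 0 := (sqrt_pos.2 (by positivity)).ne'
  have h1 : HasDerivAt (fun x : ℝ => -x ^ 2 / (4 * t)) (-(2 * X) / (4 * t)) X := by
    simpa using ((hasDerivAt_pow 2 X).neg).div_const (4 * t)
  refine (h1.exp.const_mul (1 / √(π * t))).congr_deriv ?_
  rw [dipole, sqrt_pi_mul_cube ht]
  field_simp
  ring

lemma hasDerivAt_inv_sqrt_pi_mul {t : ℝ} (ht : 0 < t) :
    HasDerivAt (fun t => 1 / √(π * t)) (-(1 / (2 * √(π * t ^ 3)))) t := by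
  have h : √(π * t) ≠ 0 := (sqrt_pos.2 (by positivity)).ne'
  have h1 : HasDerivAt (fun t => √(π * t)) (π / (2 * √(π * t))) t := by
    simpa using ((hasDerivAt_id t).const_mul π).sqrt (by simpa using by positivity)
  have h2 := h1.inv h
  simp only [one_div]
  refine h2.congr_deriv ?_
  rw [sqrt_pi_mul_cube ht]
  have h3 : √(π * t) ^ 2 = π * t := sq_sqrt (by positivity)
  field_simp
  rw [h3]

/-- The value is also the second derivative in X, so the dipole solves the heat equation. With t = τ
- s it solves the backward equation, as Green's identity requires. -/
lemma hasDerivAt_dipole_time {X t : ℝ} (ht : 0 < t) :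
    HasDerivAt (fun t => dipole X t) (dipoleDeriv₂ X t) t := by
  have h1 : HasDerivAt (fun t : ℝ => -X ^ 2 / (4 * t)) (X ^ 2 / (4 * t ^ 2)) t := by
    have := (((hasDerivAt_id t).const_mul 4).inv (by simpa using ht.ne')).const_mul (-X ^ 2)
    refine (this.congr_deriv ?_)
    simp only [id]
    field_simp
  have h2 : HasDerivAt (fun t : ℝ => 1 / (t * √(π * t))) (-(3 / (2 * t ^ 2 * √(π * t)))) t := by
    have := (hasDerivAt_inv_sqrt_pi_mul ht).mul (hasDerivAt_inv ht.ne')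
    refine (this.congr_of_eventuallyEq ?_).congr_deriv ?_
    · exact Eventually.of_forall fun x => by simp [mul_comm]
    · have h : √(π * t) ≠ 0 := (sqrt_pos.2 (by positivity)).ne'
      rw [sqrt_pi_mul_cube ht]
      field_simp
      ring
  have h3 := ((h2.mul h1.exp).const_mul (-(X / 2)))
  refine (h3.congr_of_eventuallyEq ?_).congr_deriv ?_
  · filter_upwards [lt_mem_nhds ht] with x hx
    have h : √(π * x) ≠ 0 := (sqrt_pos.2 (by positivity)).ne'
    simp only [dipole, sqrt_pi_mul_cube hx, Pi.mul_apply]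
    field_simp
  · have h : √(π * t) ≠ 0 := (sqrt_pos.2 (by positivity)).ne'
    rw [dipoleDeriv₂, sqrt_pi_mul_cube ht]
    field_simp
    ring

lemma continuousOn_dipole : ContinuousOn (fun p : ℝ × ℝ => dipole p.1 p.2) {p | 0 < p.2} := by
  unfold dipole
  refine ContinuousOn.neg (ContinuousOn.mul (ContinuousOn.div (by fun_prop) (by fun_prop) ?_)
    (ContinuousOn.rexp (ContinuousOn.div (by fun_prop) (by fun_prop) ?_)))
  · intro p hp
    have : 0 < p.2 := hp
    positivity
  · intro p hp
    have : 0 < p.2 := hp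
    positivity

lemma continuousOn_dipoleDeriv :
    ContinuousOn (fun p : ℝ × ℝ => dipoleDeriv p.1 p.2) {p | 0 < p.2} := by
  unfold dipoleDeriv
  refine ContinuousOn.mul (ContinuousOn.div
    (ContinuousOn.rexp (ContinuousOn.div (by fun_prop) (by fun_prop) ?_)) (by fun_prop) ?_)
    (ContinuousOn.sub (by fun_prop) (ContinuousOn.div (by fun_prop) (by fun_prop) ?_))
  all_goals
    intro p hp
    have : 0 < p.2 := hp
    positivity

lemma continuousOn_dipoleDeriv₂ :
    ContinuousOn (fun p : ℝ × ℝ => dipoleDeriv₂ p.1 p.2) {p | 0 < p.2} := by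
  unfold dipoleDeriv₂
  refine ContinuousOn.mul (ContinuousOn.div
    (ContinuousOn.rexp (ContinuousOn.div (by fun_prop) (by fun_prop) ?_)) (by fun_prop) ?_)
    (ContinuousOn.sub (ContinuousOn.div (by fun_prop) (by fun_prop) ?_)
      (ContinuousOn.div (by fun_prop) (by fun_prop) ?_))
  all_goals
    intro p hp
    have : 0 < p.2 := hp
    positivity

/-! ### Gaussian tails -/

lemma exp_neg_le_two_div_sq {x : ℝ} (hx : 0 < x) : exp (-x) ≤ 2 / x ^ 2 := by
  have := quadratic_le_exp_of_nonneg hx.le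
  rw [exp_neg, inv_eq_one_div, div_le_div_iff₀ (exp_pos x) (by positivity)]
  nlinarith

/-- Squaring ck ≤ |X| + Lt bounds X² below by c²k²/2 up to a term in L²t², which costs only the
factor exp(L²T). Only half of the heat kernel's exponent is used (8t in place of 4t); the other half
is kept to absorb polynomial factors. The gain t² survives division by t^{3/2}, and k⁻² is summable.
-/
lemma gaussian_tail {c L T : ℝ} (hc : 0 < c) {t X k : ℝ} (ht : t ∈ Ioc 0 T)
    (hk : 1 ≤ k) (hX : c * k - L * t ≤ |X|) :
    exp (-X ^ 2 / (8 * t)) ≤ (512 * exp (L ^ 2 * T) / c ^ 4) * (t ^ 2 / k ^ 2) := by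
  have ht0 := ht.1
  have hk0 : 0 < k := by linarith
  have h1 : c ^ 2 * k ^ 2 ≤ 2 * X ^ 2 + 2 * L ^ 2 * t ^ 2 := by
    have h2 : c * k ≤ |X| + L * t := by linarith
    have h3 : (c * k) ^ 2 ≤ (|X| + L * t) ^ 2 := by gcongr
    nlinarith [sq_nonneg (|X| - L * t), sq_abs X]
  have h2 : -X ^ 2 / (8 * t) ≤ L ^ 2 * T + -(c ^ 2 * k ^ 2 / (16 * t)) := by
    have h3 : L ^ 2 * t ≤ L ^ 2 * T := by gcongr; exact ht.2
    have h4 : -X ^ 2 / (8 * t) ≤ L ^ 2 * t + -(c ^ 2 * k ^ 2 / (16 * t)) := by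
      rw [← sub_nonneg]
      have : L ^ 2 * t + -(c ^ 2 * k ^ 2 / (16 * t)) - -X ^ 2 / (8 * t)
        = (16 * L ^ 2 * t ^ 2 - c ^ 2 * k ^ 2 + 2 * X ^ 2) / (16 * t) := by
        field_simp
        ring
      rw [this]
      apply div_nonneg _ (by positivity)
      nlinarith [sq_nonneg (L * t)]
    linarith
  calc exp (-X ^ 2 / (8 * t)) ≤ exp (L ^ 2 * T) * exp (-(c ^ 2 * k ^ 2 / (16 * t))) := by
        rw [← exp_add]; exact exp_le_exp.2 h2
    _ ≤ exp (L ^ 2 * T) * (2 / (c ^ 2 * k ^ 2 / (16 * t)) ^ 2) := by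
        gcongr; exact exp_neg_le_two_div_sq (by positivity)
    _ = (512 * exp (L ^ 2 * T) / c ^ 4) * (t ^ 2 / k ^ 4) := by field_simp; norm_num
    _ ≤ _ := by
        gcongr
        norm_num

lemma exp_neg_mul_one_add_le {w a : ℝ} (ha : 1 ≤ a) :
    exp (-w) * (1 + a * w) ≤ a := by
  have h1 : 1 + a * w ≤ a * exp w := by nlinarith [add_one_le_exp w]
  calc exp (-w) * (1 + a * w) ≤ exp (-w) * (a * exp w) := by gcongr
    _ = a := by rw [mul_comm, mul_assoc, ← exp_add]; simp

/-- Each kernel is a polynomial factor m times exp(-X²/4t)/(2√(πt³)). One half of the exponent gives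
t²/k² by `gaussian_tail`; the other half, exp(-w) with w = X²/8t, bounds m because m grows at most
linearly in w. -/
lemma exists_kernel_bound {c L T : ℝ} (hc : 0 < c) :
    ∃ C, 0 ≤ C ∧ ∀ t ∈ Ioc 0 T, ∀ X k, 1 ≤ k → c * k - L * t ≤ |X| →
      |dipole X t| ≤ C * √t / k ^ 2 ∧ |dipoleDeriv X t| ≤ C * √t / k ^ 2 ∧
      |monopole X t| ≤ C * √t / k ^ 2 := by
  rcases le_or_gt T 0 with hT | hT
  · exact ⟨0, le_rfl, fun t ht => absurd (ht.1.trans_le ht.2) (not_lt.2 hT)⟩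
  set K := 512 * exp (L ^ 2 * T) / c ^ 4 with hK
  have hK0 : 0 < K := by positivity
  -- The number 4 + 8T serves all three kernels: |X| ≤ 1 + 8Tw for the dipole, |1 - 4w| ≤ 1 + 4w for
  -- its derivative, and 2t ≤ 2T for the monopole.
  refine ⟨K * (4 + 8 * T), by positivity, fun t ht X k hk hX => ?_⟩
  have ht0 := ht.1
  have hst : 0 < √t := sqrt_pos.2 ht0
  have hk0 : 0 < k := by linarith
  have htail := gaussian_tail hc ht hk hX
  rw [← hK] at htail
  set w := X ^ 2 / (8 * t) with hw
  have hw0 : 0 ≤ w := by positivity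
  have hX2 : X ^ 2 = 8 * t * w := by rw [hw]; field_simp
  have hsplit : exp (-X ^ 2 / (4 * t)) = exp (-X ^ 2 / (8 * t)) * exp (-w) := by
    rw [← exp_add]; congr 1; rw [hw]; field_simp; ring
  have hden : t * √t ≤ 2 * √(π * t ^ 3) := by
    have := mul_sqrt_le_sqrt_pi_mul_cube ht0
    have h2 := sqrt_nonneg (π * t ^ 3)
    linarith
  have hden0 : 0 < 2 * √(π * t ^ 3) := lt_of_lt_of_le (by positivity) hden
  have hpow : t ^ 2 = t * √t * √t := by rw [mul_assoc, mul_self_sqrt ht0.le]; ring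
  have main : ∀ B m : ℝ, 0 ≤ m → exp (-w) * m ≤ B → 0 ≤ B →
      exp (-X ^ 2 / (4 * t)) * m / (2 * √(π * t ^ 3)) ≤ K * B * √t / k ^ 2 := by
    intro B m hm hB hB0
    rw [hsplit, mul_assoc, div_le_iff₀ hden0]
    calc exp (-X ^ 2 / (8 * t)) * (exp (-w) * m) ≤ K * (t ^ 2 / k ^ 2) * B := by gcongr
      _ = K * B * √t / k ^ 2 * (t * √t) := by rw [hpow]; ring
      _ ≤ _ := by gcongr
  refine ⟨?_, ?_, ?_⟩
  · have h1 := main (4 + 8 * T) |X| (abs_nonneg _) ?_ (by positivity)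
    · refine le_trans (le_of_eq ?_) h1
      rw [dipole, abs_neg, abs_mul, abs_div, abs_of_pos hden0, abs_of_pos (exp_pos _)]
      ring
    · have h2 : |X| ≤ 1 + 8 * T * w := by
        have : 8 * t * w ≤ 8 * T * w := by gcongr; exact ht.2
        nlinarith [sq_abs X, sq_nonneg (|X| - 1), abs_nonneg X]
      calc exp (-w) * |X| ≤ exp (-w) * (1 + (4 + 8 * T) * w) := by
            gcongr; nlinarith
        _ ≤ _ := exp_neg_mul_one_add_le (by linarith)
  · have h1 := main (4 + 8 * T) |1 - X ^ 2 / (2 * t)| (abs_nonneg _) ?_ (by positivity)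
    · refine le_trans (le_of_eq ?_) h1
      rw [dipoleDeriv, abs_mul, abs_div, abs_of_pos hden0, abs_of_pos (exp_pos _)]
      ring
    · have h2 : |1 - X ^ 2 / (2 * t)| ≤ 1 + 4 * w := by
        have : X ^ 2 / (2 * t) = 4 * w := by rw [hw]; field_simp; ring
        rw [this]
        exact abs_le.2 ⟨by linarith, by linarith⟩
      calc exp (-w) * |1 - X ^ 2 / (2 * t)| ≤ exp (-w) * (1 + (4 + 8 * T) * w) := by
            gcongr; nlinarith
        _ ≤ _ := exp_neg_mul_one_add_le (by linarith)
  -- The factor 2t converts the monopole prefactor: 1/√(πt) = 2t/(2√(πt³)).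
  · have h1 := main (4 + 8 * T) (2 * t) (by positivity) ?_ (by positivity)
    · refine le_trans (le_of_eq ?_) h1
      rw [monopole, abs_of_nonneg (by positivity), sqrt_pi_mul_cube ht0]
      field_simp
    · calc exp (-w) * (2 * t) ≤ 1 * (2 * t) := by
            gcongr; exact exp_le_one_iff.2 (by linarith)
        _ ≤ _ := by nlinarith [ht.2]

lemma summable_one_div_one_add_abs_sq : Summable fun n : ℤ => 1 / (1 + |(n : ℝ)|) ^ 2 := by
  have h : Summable fun n : ℕ => 1 / (1 + (n : ℝ)) ^ 2 := by
    have := (summable_nat_add_iff 1).2 (Real.summable_one_div_nat_pow.2 (one_lt_two))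
    refine this.congr fun n => ?_
    push_cast
    rw [add_comm]
  exact Summable.of_nat_of_neg (by simpa using h) (by simpa using h)

/-! ### Quantitative regularity of the data -/

/-- `b` is continuously differentiable on `[0, T]`, with `b` and its derivative bounded by `L`. -/
structure IsC1With (T L : ℝ) (b : ℝ → ℝ) : Prop where
  continuousOn : ContinuousOn b (Icc 0 T)
  abs_sub_le : ∀ s ∈ Icc 0 T, ∀ t ∈ Icc 0 T, |b t - b s| ≤ L * |t - s|
  hasDerivAt : ∀ s ∈ Ioo 0 T, HasDerivAt b (deriv b s) s
  continuousOn_deriv : ContinuousOn (deriv b) (Ioo 0 T)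
  abs_deriv_le : ∀ s ∈ Ioo 0 T, |deriv b s| ≤ L
  abs_le : ∀ s ∈ Icc 0 T, |b s| ≤ L
  nonneg : 0 ≤ L

/-- Every larger constant is allowed, so that a single L can serve both boundaries and both boundary
values. -/
lemma exists_isC1With {T : ℝ} {b : ℝ → ℝ} (hb : ContDiffOn ℝ 1 b (Icc 0 T)) :
    ∃ L₀, ∀ L, L₀ ≤ L → IsC1With T L b := by
  obtain ⟨K, hK⟩ := hb.exists_lipschitzOnWith one_ne_zero (convex_Icc 0 T) isCompact_Icc
  obtain ⟨M, hM⟩ := isCompact_Icc.exists_bound_of_continuousOn hb.continuousOn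
  have hIoo : ContDiffOn ℝ 1 b (Ioo 0 T) := hb.mono Ioo_subset_Icc_self
  refine ⟨max K M, fun L hL => ⟨hb.continuousOn, fun s hs t ht => ?_, fun s hs => ?_,
    hIoo.continuousOn_deriv_of_isOpen isOpen_Ioo le_rfl, fun s hs => ?_, fun s hs => ?_, ?_⟩⟩
  · have := hK.dist_le_mul t ht s hs
    rw [Real.dist_eq, Real.dist_eq] at this
    refine this.trans ?_
    gcongr
    exact (le_max_left _ _).trans hL
  · exact ((hIoo.differentiableOn one_ne_zero).differentiableAt (Ioo_mem_nhds hs.1 hs.2)).hasDerivAt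
  · have := norm_deriv_le_of_lipschitzOn (Icc_mem_nhds hs.1 hs.2) hK
    exact this.trans ((le_max_left _ _).trans hL)
  · exact (hM s hs).trans ((le_max_right _ _).trans hL)
  · exact K.coe_nonneg.trans ((le_max_left _ _).trans hL)

lemma IsC1With.neg {T L : ℝ} {b : ℝ → ℝ} (hb : IsC1With T L b) :
    IsC1With T L (fun s => -b s) := by
  have hd : ∀ s, deriv (fun s => -b s) s = -deriv b s := fun s => deriv.fun_neg
  refine ⟨hb.continuousOn.neg, fun s hs t ht => ?_, fun s hs => ?_, ?_, fun s hs => ?_,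
    fun s hs => ?_, hb.nonneg⟩
  · rw [show -b t - -b s = -(b t - b s) by ring, abs_neg]
    exact hb.abs_sub_le s hs t ht
  · rw [hd]
    exact (hb.hasDerivAt s hs).neg
  · exact hb.continuousOn_deriv.neg.congr fun s _ => hd s
  · rw [hd, abs_neg]
    exact hb.abs_deriv_le s hs
  · rw [abs_neg]
    exact hb.abs_le s hs

/-- Two continuously differentiable boundaries at distance at least `l₀`. -/
structure IsStrip (T L l₀ : ℝ) (y z : ℝ → ℝ) : Prop where
  lower : IsC1With T L y
  upper : IsC1With T L z
  pos : 0 < l₀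
  le_sub : ∀ s ∈ Icc 0 T, l₀ ≤ z s - y s

lemma IsStrip.lt {T L l₀ : ℝ} {y z : ℝ → ℝ} (h : IsStrip T L l₀ y z) {s : ℝ} (hs : s ∈ Icc 0 T) :
    y s < z s := by
  linarith [h.pos, h.le_sub s hs]

lemma IsStrip.neg {T L l₀ : ℝ} {y z : ℝ → ℝ} (h : IsStrip T L l₀ y z) :
    IsStrip T L l₀ (fun s => -z s) (fun s => -y s) :=
  ⟨h.upper.neg, h.lower.neg, h.pos, fun s hs => by linarith [h.le_sub s hs]⟩

lemma exists_isStrip {T : ℝ} {y z : ℝ → ℝ} (hy : ContDiffOn ℝ 1 y (Icc 0 T))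
    (hz : ContDiffOn ℝ 1 z (Icc 0 T)) (hyz : ∀ τ ∈ Icc 0 T, y τ < z τ) :
    ∃ L₀ l₀, ∀ L, L₀ ≤ L → IsStrip T L l₀ y z := by
  obtain ⟨Ly, hLy⟩ := exists_isC1With hy
  obtain ⟨Lz, hLz⟩ := exists_isC1With hz
  have hl : ∃ l₀ : ℝ, 0 < l₀ ∧ ∀ s ∈ Icc 0 T, l₀ ≤ z s - y s := by
    rcases (Icc (0 : ℝ) T).eq_empty_or_nonempty with h | h
    · exact ⟨1, one_pos, by simp [h]⟩
    · obtain ⟨m, hm, hmin⟩ := isCompact_Icc.exists_isMinOn h (hz.continuousOn.sub hy.continuousOn)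
      exact ⟨z m - y m, sub_pos.2 (hyz m hm), fun s hs => hmin hs⟩
  obtain ⟨l₀, h0, hl₀⟩ := hl
  exact ⟨max Ly Lz, l₀, fun L hL => ⟨hLy L ((le_max_left _ _).trans hL),
    hLz L ((le_max_right _ _).trans hL), h0, hl₀⟩⟩

/-! ### Size of the displacements -/

/-- A displacement between boundary points is an integer multiple ml of the current width plus the
distance d by which a boundary has moved. The condition on m makes |m|l at least l₀(1 + |n|)/2. -/
lemma le_abs_int_mul_add {l₀ l L t d : ℝ} {m n : ℤ} (hl₀ : 0 < l₀) (hl : l₀ ≤ l)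
    (hd : |d| ≤ L * t) (hm : 1 + |n| ≤ 2 * |m|) :
    l₀ / 2 * (1 + |(n : ℝ)|) - L * t ≤ |m * l + d| := by
  have h1 : (1 : ℝ) + |(n : ℝ)| ≤ 2 * |(m : ℝ)| := by exact_mod_cast hm
  have h2 : |(m : ℝ) * l| ≤ |m * l + d| + |d| := by
    calc |(m : ℝ) * l| = |(m * l + d) - d| := by ring_nf
      _ ≤ _ := abs_sub _ _
  rw [abs_mul, abs_of_pos (hl₀.trans_le hl)] at h2
  have h3 : |(m : ℝ)| * l₀ ≤ |(m : ℝ)| * l := by gcongr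
  nlinarith

section displacement

variable {T L l₀ : ℝ} {y z : ℝ → ℝ} {τ s : ℝ}

/-- Here the displacement is (2n - 1)l(τ) + z(τ) - z(s), and the odd multiple never vanishes. In the
three companions below between boundary points the multiples are 2n or 2n + 1; the even ones force n
≠ 0. -/
lemma le_abs_shift_upper (h : IsStrip T L l₀ y z) (hτ : τ ∈ Icc 0 T) (hs : s ∈ Icc 0 T)
    (hsτ : s ≤ τ) (n : ℤ) :
    l₀ / 2 * (1 + |(n : ℝ)|) - L * (τ - s) ≤ |shift y z n τ (z s)| := by
  have h1 := h.upper.abs_sub_le s hs τ hτ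
  rw [abs_of_nonneg (sub_nonneg.2 hsτ)] at h1
  have := le_abs_int_mul_add (m := 2 * n - 1) (n := n) h.pos (h.le_sub τ hτ) h1 (by grind)
  refine this.trans (le_of_eq ?_)
  rw [shift]
  push_cast
  ring_nf

lemma le_abs_shift_lower (h : IsStrip T L l₀ y z) (hτ : τ ∈ Icc 0 T) (hs : s ∈ Icc 0 T)
    (hsτ : s ≤ τ) {n : ℤ} (hn : n ≠ 0) :
    l₀ / 2 * (1 + |(n : ℝ)|) - L * (τ - s) ≤ |shift y z n τ (y s)| := by
  have h1 := h.lower.abs_sub_le s hs τ hτ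
  rw [abs_of_nonneg (sub_nonneg.2 hsτ)] at h1
  have := le_abs_int_mul_add (m := 2 * n) (n := n) h.pos (h.le_sub τ hτ) h1 (by grind)
  refine this.trans (le_of_eq ?_)
  rw [shift]
  push_cast
  ring_nf

/-- For n > 0 the displacement is (2n - 1)l(τ) + z(τ) - ξ, bounded below through ξ ≤ z(s); for n < 0
it is bounded above through ξ ≥ y(s). The image n = 0 is excluded because ξ can come arbitrarily
close to y(τ). -/
lemma le_abs_shift_of_mem (h : IsStrip T L l₀ y z) (hτ : τ ∈ Icc 0 T) (hs : s ∈ Icc 0 T)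
    (hsτ : s ≤ τ) {n : ℤ} (hn : n ≠ 0) {ξ : ℝ} (hξ : ξ ∈ Icc (y s) (z s)) :
    l₀ / 2 * (1 + |(n : ℝ)|) - L * (τ - s) ≤ |shift y z n τ ξ| := by
  have hl := h.le_sub τ hτ
  have hl0 := h.pos
  have h1 := h.lower.abs_sub_le s hs τ hτ
  have h2 := h.upper.abs_sub_le s hs τ hτ
  rw [abs_of_nonneg (sub_nonneg.2 hsτ)] at h1 h2
  rcases lt_or_gt_of_ne hn with h0 | h0
  · have h3 : (n : ℝ) ≤ -1 := by exact_mod_cast Int.le_sub_one_of_lt h0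
    refine le_trans ?_ (neg_le_abs _)
    rw [abs_of_neg (by linarith), shift]
    nlinarith [hξ.1, le_abs_self (y τ - y s),
      mul_le_mul_of_nonneg_left hl (by linarith : 0 ≤ -(n : ℝ))]
  · have h3 : (1 : ℝ) ≤ n := by exact_mod_cast h0
    refine le_trans ?_ (le_abs_self _)
    rw [abs_of_pos (by linarith), shift]
    nlinarith [hξ.2, neg_abs_le (z τ - z s),
      mul_le_mul_of_nonneg_left hl (by linarith : 0 ≤ 2 * (n : ℝ) - 1)]

lemma le_abs_shift_add_half_lower (h : IsStrip T L l₀ y z) (hτ : τ ∈ Icc 0 T) (hs : s ∈ Icc 0 T)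
    (hsτ : s ≤ τ) (n : ℤ) :
    l₀ / 2 * (1 + |(n : ℝ)|) - L * (τ - s) ≤ |shift y z (n + 1 / 2) τ (y s)| := by
  have h1 := h.lower.abs_sub_le s hs τ hτ
  rw [abs_of_nonneg (sub_nonneg.2 hsτ)] at h1
  have := le_abs_int_mul_add (m := 2 * n + 1) (n := n) h.pos (h.le_sub τ hτ) h1 (by grind)
  refine this.trans (le_of_eq ?_)
  rw [shift]
  push_cast
  ring_nf

lemma le_abs_shift_add_half_upper (h : IsStrip T L l₀ y z) (hτ : τ ∈ Icc 0 T) (hs : s ∈ Icc 0 T)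
    (hsτ : s ≤ τ) {n : ℤ} (hn : n ≠ 0) :
    l₀ / 2 * (1 + |(n : ℝ)|) - L * (τ - s) ≤ |shift y z (n + 1 / 2) τ (z s)| := by
  have h1 := h.upper.abs_sub_le s hs τ hτ
  rw [abs_of_nonneg (sub_nonneg.2 hsτ)] at h1
  have := le_abs_int_mul_add (m := 2 * n) (n := n) h.pos (h.le_sub τ hτ) h1 (by grind)
  refine this.trans (le_of_eq ?_)
  rw [shift]
  push_cast
  ring_nf

/-- A crude bound at fixed times, used only for summability at arbitrary ξ. The artificial speed is
divided by τ - s so that its product with τ - s is the constant to be subtracted. -/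
lemma le_abs_shift_of_ne (hyz : y τ < z τ) (hs : s < τ) (ν ξ : ℝ) :
    (2 * (z τ - y τ)) * (1 + |ν|)
      - ((2 * (z τ - y τ) + |y τ - ξ|) / (τ - s)) * (τ - s) ≤ |shift y z ν τ ξ| := by
  have hl : 0 < z τ - y τ := sub_pos.2 hyz
  rw [div_mul_cancel₀ _ (sub_pos.2 hs).ne']
  have h1 : |2 * ν * (z τ - y τ)| ≤ |shift y z ν τ ξ| + |y τ - ξ| := by
    calc |2 * ν * (z τ - y τ)| = |shift y z ν τ ξ - (y τ - ξ)| := by rw [shift]; ring_nf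
      _ ≤ _ := abs_sub _ _
  rw [abs_mul, abs_mul, abs_of_pos hl, abs_two] at h1
  nlinarith

end displacement

lemma upsilonTerm_eq (y z : ℝ → ℝ) (ν τ ξ s : ℝ) :
    upsilonTerm y z ν τ ξ s = dipole (shift y z ν τ ξ) (τ - s) := rfl

lemma lambdaTerm_eq (y z : ℝ → ℝ) (ν τ ξ s : ℝ) :
    lambdaTerm y z ν τ ξ s = dipoleDeriv (shift y z ν τ ξ) (τ - s) := rfl

lemma gaussTerm_eq (y z : ℝ → ℝ) (ν τ ξ s : ℝ) :
    1 / √(π * (τ - s)) * gaussTerm y z ν τ ξ s = monopole (shift y z ν τ ξ) (τ - s) := rfl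

/-! ### Bounds on image sums -/

/-- A summable weight on `ℤ`. -/
noncomputable def weight (n : ℤ) : ℝ := 1 / (1 + |(n : ℝ)|) ^ 2

lemma weight_nonneg (n : ℤ) : 0 ≤ weight n := by unfold weight; positivity

lemma summable_weight : Summable weight := summable_one_div_one_add_abs_sq

lemma abs_tsum_le_of_le_weight {f : ℤ → ℝ} {A : ℝ} (hf : ∀ n, |f n| ≤ A * weight n) :
    |∑' n, f n| ≤ A * ∑' n, weight n :=
  tsum_of_norm_bounded (f := f) (summable_weight.hasSum.mul_left A) hf

lemma abs_tsum_ne_le_of_le_weight {f : ℤ → ℝ} {A : ℝ} (hA : 0 ≤ A)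
    (hf : ∀ n, n ≠ 0 → |f n| ≤ A * weight n) :
    |∑' n : {n : ℤ // n ≠ 0}, f n| ≤ A * ∑' n, weight n := by
  rw [show (∑' n : {n : ℤ // n ≠ 0}, f n) = _ from tsum_subtype {n : ℤ | n ≠ 0} f]
  refine abs_tsum_le_of_le_weight fun n => ?_
  by_cases hn : n = 0
  · simpa [hn] using mul_nonneg hA (weight_nonneg 0)
  · simpa [hn] using hf n hn

lemma summable_of_le_weight {f : ℤ → ℝ} {A : ℝ} (hf : ∀ n, |f n| ≤ A * weight n) :
    Summable f :=
  Summable.of_norm_bounded (summable_weight.mul_left A) hf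

section imageBounds

variable {T L l₀ : ℝ} {y z : ℝ → ℝ}

/-- All image terms away from the singular one are small, uniformly in the elapsed time. -/
lemma exists_image_bound (h : IsStrip T L l₀ y z) :
    ∃ C, 0 ≤ C ∧ ∀ τ ∈ Ioc 0 T, ∀ s ∈ Ico 0 τ, ∀ n : ℤ, ∀ X,
      l₀ / 2 * (1 + |(n : ℝ)|) - L * (τ - s) ≤ |X| →
      |dipole X (τ - s)| ≤ C * √(τ - s) * weight n ∧
      |dipoleDeriv X (τ - s)| ≤ C * √(τ - s) * weight n ∧
      |monopole X (τ - s)| ≤ C * √(τ - s) * weight n := by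
  obtain ⟨C, hC, H⟩ := exists_kernel_bound (L := L) (T := T) (half_pos h.pos)
  refine ⟨C, hC, fun τ hτ s hs n X hX => ?_⟩
  have := H (τ - s) ⟨sub_pos.2 hs.2, by linarith [hs.1, hτ.2]⟩ X (1 + |(n : ℝ)|)
    (by linarith [abs_nonneg (n : ℝ)]) hX
  simpa only [weight, mul_one_div] using this

/-- The offset c covers both families: c = 0 for the integer images and c = 1/2 for the half-integer
ones. -/
lemma summable_image {τ s : ℝ} (hyz : y τ < z τ) (hs : s < τ) (ξ : ℝ) (c : ℝ) :
    Summable (fun n : ℤ => upsilonTerm y z (n + c) τ ξ s) ∧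
    Summable (fun n : ℤ => lambdaTerm y z (n + c) τ ξ s) ∧
    Summable (fun n : ℤ => gaussTerm y z (n + c) τ ξ s) := by
  have hl : 0 < z τ - y τ := sub_pos.2 hyz
  have ht := sub_pos.2 hs
  obtain ⟨C, hC, H⟩ := exists_kernel_bound (c := 2 * (z τ - y τ)) (T := τ - s)
    (L := (2 * (z τ - y τ) * (1 + |c|) + |y τ - ξ|) / (τ - s)) (by linarith)
  have H' : ∀ n : ℤ, _ := fun n => H (τ - s) ⟨ht, le_rfl⟩ (shift y z (n + c) τ ξ)
    (1 + |(n : ℝ)|) (by linarith [abs_nonneg (n : ℝ)]) (by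
      refine le_trans ?_ (le_abs_shift_of_ne hyz hs (n + c) ξ)
      rw [div_mul_cancel₀ _ ht.ne', div_mul_cancel₀ _ ht.ne']
      have : |(n : ℝ)| ≤ |n + c| + |c| := by
        calc |(n : ℝ)| = |n + c - c| := by ring_nf
          _ ≤ _ := abs_sub _ _
      nlinarith)
  refine ⟨summable_of_le_weight (A := C * √(τ - s)) fun n => ?_,
    summable_of_le_weight (A := C * √(τ - s)) fun n => ?_, ?_⟩
  · simpa only [weight, mul_one_div, upsilonTerm_eq] using (H' n).1
  · simpa only [weight, mul_one_div, lambdaTerm_eq] using (H' n).2.1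
  · have h1 : Summable fun n : ℤ => monopole (shift y z (n + c) τ ξ) (τ - s) :=
      summable_of_le_weight (A := C * √(τ - s)) fun n => by
        simpa only [weight, mul_one_div] using (H' n).2.2
    have h2 : 1 / √(π * (τ - s)) ≠ 0 := by positivity
    exact (summable_mul_left_iff h2).1 h1

end imageBounds

/-! ### Weakly singular kernels -/

section singular

variable {T L : ℝ} {b f : ℝ → ℝ} {τ s : ℝ}

lemma abs_increment_le (hb : IsC1With T L b) (hτ : τ ∈ Ioc 0 T) (hs : s ∈ Ico 0 τ) :
    |b τ - b s| ≤ L * (τ - s) := by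
  have := hb.abs_sub_le s ⟨hs.1, hs.2.le.trans hτ.2⟩ τ ⟨hτ.1.le, hτ.2⟩
  rwa [abs_of_nonneg (sub_nonneg.2 hs.2.le)] at this

/-- The source of every weak singularity: a numerator O(t) over t^{3/2} leaves t^{-1/2}. -/
lemma abs_div_sqrt_cube_le {t A N : ℝ} (ht : 0 < t) (hA : 0 ≤ A) (hN : |N| ≤ A * t) :
    |N / (2 * √(π * t ^ 3))| ≤ A / √t := by
  have h1 := mul_sqrt_le_sqrt_pi_mul_cube ht
  have h0 : 0 < √t := sqrt_pos.2 ht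
  have h2 : 0 < √(π * t ^ 3) := lt_of_lt_of_le (by positivity) h1
  rw [abs_div, abs_of_pos (by positivity : 0 < 2 * √(π * t ^ 3)), div_le_div_iff₀ (by positivity) h0]
  calc |N| * √t ≤ A * t * √t := by gcongr
    _ = A * (t * √t) := by ring
    _ ≤ A * (2 * √(π * t ^ 3)) := mul_le_mul_of_nonneg_left (by linarith) hA

lemma abs_gradKernel_le (hb : IsC1With T L b) (hτ : τ ∈ Ioc 0 T) (hs : s ∈ Ico 0 τ) :
    |gradKernel b τ s| ≤ L / √(τ - s) := by
  have ht := sub_pos.2 hs.2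
  rw [gradKernel, abs_mul, abs_of_pos (exp_pos _)]
  refine (mul_le_of_le_one_right (abs_nonneg _) (exp_le_one_iff.2 ?_)).trans
    (abs_div_sqrt_cube_le ht hb.nonneg (abs_increment_le hb hτ hs))
  exact div_nonpos_of_nonpos_of_nonneg (by simpa using sq_nonneg _) (by positivity)

/-- Uses 1 - exp(-v) ≤ v with v = (b(τ) - b(s))²/(4(τ - s)), which is O(τ - s) for a Lipschitz
boundary. -/
lemma abs_exp_sub_one_le (hb : IsC1With T L b) (hτ : τ ∈ Ioc 0 T) (hs : s ∈ Ico 0 τ) :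
    |exp (-(b τ - b s) ^ 2 / (4 * (τ - s))) - 1| ≤ L ^ 2 * (τ - s) := by
  have ht := sub_pos.2 hs.2
  have h1 := abs_increment_le hb hτ hs
  have h2 : (b τ - b s) ^ 2 ≤ (L * (τ - s)) ^ 2 := sq_le_sq' (by linarith [neg_abs_le (b τ - b s)])
    (by linarith [le_abs_self (b τ - b s)])
  have h3 : (b τ - b s) ^ 2 / (4 * (τ - s)) ≤ L ^ 2 * (τ - s) := by
    rw [div_le_iff₀ (by positivity)]
    nlinarith [sq_nonneg (L * (τ - s))]
  have h4 : 0 ≤ (b τ - b s) ^ 2 / (4 * (τ - s)) := by positivity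
  have h5 := add_one_le_exp (-((b τ - b s) ^ 2 / (4 * (τ - s))))
  rw [neg_div]
  rw [abs_of_nonpos (sub_nonpos.2 (exp_le_one_iff.2 (by linarith)))]
  linarith

lemma abs_incrementKernel_le (hf : IsC1With T L f) (hτ : τ ∈ Ioc 0 T) (hs : s ∈ Ico 0 τ) :
    |incrementKernel f τ s| ≤ L / √(τ - s) := by
  refine abs_div_sqrt_cube_le (sub_pos.2 hs.2) hf.nonneg ?_
  rw [abs_sub_comm]
  exact abs_increment_le hf hτ hs

/-- Separates the increment of f from a factor that depends on b alone. That factor reappears as the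
derivative of the singular part of η (`hasDerivAt_etaMinus_lower`), which links the two forms of the
system. -/
lemma rebateKernel_eq (f b : ℝ → ℝ) (τ s : ℝ) :
    rebateKernel f b τ s = incrementKernel f τ s + f s *
      ((exp (-(b τ - b s) ^ 2 / (4 * (τ - s))) *
      (1 + deriv b s * (b τ - b s) - (b τ - b s) ^ 2 / (2 * (τ - s))) - 1) /
      (2 * √(π * (τ - s) ^ 3))) := by
  rw [rebateKernel, incrementKernel]
  ring

/-- With e the Gaussian and Δ the increment of b, the numerator is (e - 1) + e(b'Δ - Δ²/(2(τ - s))).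
Each of the three contributions is at most L²(τ - s), whence the 3. -/
lemma abs_unitRebate_le (hb : IsC1With T L b) (hτ : τ ∈ Ioc 0 T) (hs : s ∈ Ioo 0 τ) :
    |(exp (-(b τ - b s) ^ 2 / (4 * (τ - s))) *
      (1 + deriv b s * (b τ - b s) - (b τ - b s) ^ 2 / (2 * (τ - s))) - 1) /
      (2 * √(π * (τ - s) ^ 3))| ≤ 3 * L ^ 2 / √(τ - s) := by
  have hs' : s ∈ Ico 0 τ := ⟨hs.1.le, hs.2⟩
  have ht := sub_pos.2 hs.2
  refine abs_div_sqrt_cube_le ht (by positivity) ?_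
  have h1 := abs_increment_le hb hτ hs'
  have h2 := abs_exp_sub_one_le hb hτ hs'
  have h3 := hb.abs_deriv_le s ⟨hs.1, hs.2.trans_le hτ.2⟩
  have hL := hb.nonneg
  have h4 : |deriv b s * (b τ - b s)| ≤ L ^ 2 * (τ - s) := by
    rw [abs_mul]
    calc |deriv b s| * |b τ - b s| ≤ L * (L * (τ - s)) := by gcongr
      _ = _ := by ring
  have h5 : (b τ - b s) ^ 2 / (2 * (τ - s)) ≤ L ^ 2 * (τ - s) := by
    rw [div_le_iff₀ (by positivity)]
    have : (b τ - b s) ^ 2 ≤ (L * (τ - s)) ^ 2 :=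
      sq_le_sq' (by linarith [neg_abs_le (b τ - b s)]) (by linarith [le_abs_self (b τ - b s)])
    nlinarith [sq_nonneg (L * (τ - s))]
  have h6 : 0 ≤ (b τ - b s) ^ 2 / (2 * (τ - s)) := by positivity
  set e := exp (-(b τ - b s) ^ 2 / (4 * (τ - s)))
  have he0 : 0 ≤ e := (exp_pos _).le
  have he1 : e ≤ 1 := exp_le_one_iff.2
    (div_nonpos_of_nonpos_of_nonneg (by simpa using sq_nonneg _) (by positivity))
  have h7 : |deriv b s * (b τ - b s) - (b τ - b s) ^ 2 / (2 * (τ - s))| ≤ 2 * (L ^ 2 * (τ - s)) := by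
    rw [abs_le] at h4 ⊢
    constructor <;> linarith
  calc _ = |(e - 1) + e * (deriv b s * (b τ - b s) - (b τ - b s) ^ 2 / (2 * (τ - s)))| := by ring_nf
    _ ≤ |e - 1| + |e * (deriv b s * (b τ - b s) - (b τ - b s) ^ 2 / (2 * (τ - s)))| :=
      abs_add_le _ _
    _ ≤ L ^ 2 * (τ - s) + 1 * (2 * (L ^ 2 * (τ - s))) := by
      rw [abs_mul, abs_of_nonneg he0]
      gcongr
    _ = _ := by ring

lemma abs_rebateKernel_le (hf : IsC1With T L f) (hb : IsC1With T L b) (hτ : τ ∈ Ioc 0 T)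
    (hs : s ∈ Ioo 0 τ) : |rebateKernel f b τ s| ≤ (L + 3 * L ^ 3) / √(τ - s) := by
  rw [rebateKernel_eq]
  have hs' : s ∈ Ico 0 τ := ⟨hs.1.le, hs.2⟩
  refine (abs_add_le _ _).trans ?_
  rw [abs_mul, add_div]
  have h1 := hf.abs_le s ⟨hs.1.le, hs.2.le.trans hτ.2⟩
  have h2 := abs_unitRebate_le hb hτ hs
  have hL := hb.nonneg
  have h3 := abs_incrementKernel_le hf hτ hs'
  have : L * (3 * L ^ 2 / √(τ - s)) = 3 * L ^ 3 / √(τ - s) := by ring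
  rw [← this]
  gcongr

end singular

/-! ### Uniform bounds and limits of the regular kernels -/

section regular

variable {T L l₀ : ℝ} {y z : ℝ → ℝ}

lemma etaMinus_upper_eq {τ s : ℝ} (hs : y s < z s) :
    etaMinus y z τ (z s) s = ∑' n : ℤ, monopole (shift y z n τ (z s)) (τ - s) := by
  rw [etaMinus, kronecker, if_neg hs.ne', ← tsum_mul_left]
  simp only [gaussTerm_eq, neg_zero, zero_div, zero_add]

lemma etaPlus_lower_eq {τ s : ℝ} (hs : y s < z s) :
    etaPlus y z τ (y s) s = ∑' n : ℤ, monopole (shift y z (n + 1 / 2) τ (y s)) (τ - s) := by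
  rw [etaPlus, kronecker, if_neg hs.ne, ← tsum_mul_left]
  simp only [gaussTerm_eq, neg_zero, zero_div, zero_add]

lemma tsum_eq_add_tsum_ne {f : ℤ → ℝ} (hf : Summable f) :
    ∑' n, f n = f 0 + ∑' n : {n : ℤ // n ≠ 0}, f n := by
  rw [hf.tsum_eq_add_tsum_ite 0,
    show (∑' n : {n : ℤ // n ≠ 0}, f n) = _ from tsum_subtype {n : ℤ | n ≠ 0} f]
  congr 1
  refine tsum_congr fun n => ?_
  by_cases hn : n = 0 <;> simp [hn]

/-- The Kronecker term cancels the singularity of the image n = 0: their difference is O(√(τ - s)),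
although each of the two is of order 1/√(τ - s). -/
lemma etaMinus_lower_eq {τ s : ℝ} (hyz : y τ < z τ) (hs : s < τ) :
    etaMinus y z τ (y s) s =
      (exp (-(y τ - y s) ^ 2 / (4 * (τ - s))) - 1) / √(π * (τ - s)) +
      ∑' n : {n : ℤ // n ≠ 0}, monopole (shift y z (n : ℤ) τ (y s)) (τ - s) := by
  have h := (summable_image hyz hs (y s) 0).2.2
  simp only [add_zero] at h
  rw [etaMinus, kronecker, if_pos rfl, tsum_eq_add_tsum_ne h, mul_add, ← tsum_mul_left]
  simp only [gaussTerm_eq]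
  simp only [monopole, shift, Int.cast_zero]
  ring_nf

lemma etaPlus_upper_eq {τ s : ℝ} (hyz : y τ < z τ) (hs : s < τ) :
    etaPlus y z τ (z s) s =
      (exp (-(z τ - z s) ^ 2 / (4 * (τ - s))) - 1) / √(π * (τ - s)) +
      ∑' n : {n : ℤ // n ≠ 0}, monopole (shift y z ((n : ℤ) + 1 / 2) τ (z s)) (τ - s) := by
  have h := (summable_image hyz hs (z s) (1 / 2)).2.2
  rw [etaPlus, kronecker, if_pos rfl, tsum_eq_add_tsum_ne h, mul_add, ← tsum_mul_left]
  simp only [gaussTerm_eq]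
  have : shift y z ((0 : ℤ) + 1 / 2) τ (z s) = z τ - z s := by simp [shift]
  rw [this]
  simp only [monopole]
  ring

/-- All kernels of the system other than the weakly singular ones are `O(√(τ - s))`. -/
lemma exists_regular_bound (h : IsStrip T L l₀ y z) :
    ∃ C, 0 ≤ C ∧ ∀ τ ∈ Ioc 0 T, ∀ s ∈ Ioo 0 τ,
      (|upsilonMinus y z τ (z s) s| ≤ C * √(τ - s) ∧ |upsilonMinus₀ y z τ s| ≤ C * √(τ - s) ∧
      |upsilonPlus y z τ (y s) s| ≤ C * √(τ - s) ∧ |upsilonPlus₀ y z τ s| ≤ C * √(τ - s)) ∧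
      (|lambdaMinus y z τ (z s) s| ≤ C * √(τ - s) ∧ |lambdaMinus₀ y z τ s| ≤ C * √(τ - s) ∧
      |lambdaPlus y z τ (y s) s| ≤ C * √(τ - s) ∧ |lambdaPlus₀ y z τ s| ≤ C * √(τ - s)) ∧
      (|etaMinus y z τ (y s) s| ≤ C * √(τ - s) ∧ |etaMinus y z τ (z s) s| ≤ C * √(τ - s) ∧
      |etaPlus y z τ (y s) s| ≤ C * √(τ - s) ∧ |etaPlus y z τ (z s) s| ≤ C * √(τ - s)) := by
  obtain ⟨C, hC, H⟩ := exists_image_bound h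
  set S := ∑' n, weight n
  have hS : 0 ≤ S := tsum_nonneg weight_nonneg
  -- The four sums are the same for dipole, dipole derivative and monopole, so they are treated once
  -- for a generic kernel g.
  have key : ∀ τ ∈ Ioc 0 T, ∀ s ∈ Ioo 0 τ, ∀ g : ℝ → ℝ → ℝ,
      (∀ n : ℤ, ∀ X, l₀ / 2 * (1 + |(n : ℝ)|) - L * (τ - s) ≤ |X| →
        |g X (τ - s)| ≤ C * √(τ - s) * weight n) →
      |∑' n : ℤ, g (shift y z n τ (z s)) (τ - s)| ≤ C * S * √(τ - s) ∧
      |∑' n : {n : ℤ // n ≠ 0}, g (shift y z (n : ℤ) τ (y s)) (τ - s)| ≤ C * S * √(τ - s) ∧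
      |∑' n : ℤ, g (shift y z (n + 1 / 2) τ (y s)) (τ - s)| ≤ C * S * √(τ - s) ∧
      |∑' n : {n : ℤ // n ≠ 0}, g (shift y z ((n : ℤ) + 1 / 2) τ (z s)) (τ - s)|
        ≤ C * S * √(τ - s) := by
    intro τ hτ s hs g hg
    have hτ' : τ ∈ Icc 0 T := ⟨hτ.1.le, hτ.2⟩
    have hs' : s ∈ Icc 0 T := ⟨hs.1.le, hs.2.le.trans hτ.2⟩
    have hA : 0 ≤ C * √(τ - s) := by positivity
    rw [mul_right_comm]
    exact ⟨abs_tsum_le_of_le_weight fun n => hg n _ (le_abs_shift_upper h hτ' hs' hs.2.le n),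
      abs_tsum_ne_le_of_le_weight (f := fun n : ℤ => g (shift y z n τ (y s)) (τ - s)) hA
        fun n hn => hg n _ (le_abs_shift_lower h hτ' hs' hs.2.le hn),
      abs_tsum_le_of_le_weight fun n => hg n _ (le_abs_shift_add_half_lower h hτ' hs' hs.2.le n),
      abs_tsum_ne_le_of_le_weight (f := fun n : ℤ => g (shift y z (n + 1 / 2) τ (z s)) (τ - s)) hA
        fun n hn => hg n _ (le_abs_shift_add_half_upper h hτ' hs' hs.2.le hn)⟩
  -- CS bounds the image sums; L² pays for the regularized zeroth image in η at its own boundary.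
  refine ⟨C * S + L ^ 2, by positivity, fun τ hτ s hs => ?_⟩
  have hτ' : τ ∈ Icc 0 T := ⟨hτ.1.le, hτ.2⟩
  have hs' : s ∈ Icc 0 T := ⟨hs.1.le, hs.2.le.trans hτ.2⟩
  have hs'' : s ∈ Ico 0 τ := ⟨hs.1.le, hs.2⟩
  have ht := sub_pos.2 hs.2
  have hrel : ∀ {x : ℝ}, x ≤ C * S * √(τ - s) → x ≤ (C * S + L ^ 2) * √(τ - s) := fun hx =>
    hx.trans (by gcongr; exact le_add_of_nonneg_right (sq_nonneg _))
  have hsing : ∀ b, IsC1With T L b →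
      |(exp (-(b τ - b s) ^ 2 / (4 * (τ - s))) - 1) / √(π * (τ - s))| ≤ L ^ 2 * √(τ - s) := by
    intro b hb
    have h1 := abs_exp_sub_one_le hb hτ hs''
    have h2 : √(τ - s) ≤ √(π * (τ - s)) := sqrt_le_sqrt (by nlinarith [pi_gt_three])
    rw [abs_div, abs_of_nonneg (sqrt_nonneg _), div_le_iff₀ (sqrt_pos.2 (by positivity))]
    calc _ ≤ _ := h1
      _ = L ^ 2 * √(τ - s) * √(τ - s) := by rw [mul_assoc, mul_self_sqrt ht.le]
      _ ≤ _ := by gcongr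
  have h1 := key τ hτ s hs dipole fun n X hX => (H τ hτ s hs'' n X hX).1
  have h2 := key τ hτ s hs dipoleDeriv fun n X hX => (H τ hτ s hs'' n X hX).2.1
  have h3 := key τ hτ s hs monopole fun n X hX => (H τ hτ s hs'' n X hX).2.2
  refine ⟨⟨hrel h1.1, hrel h1.2.1, hrel h1.2.2.1, hrel h1.2.2.2⟩,
    ⟨hrel h2.1, hrel h2.2.1, hrel h2.2.2.1, hrel h2.2.2.2⟩, ?_, ?_, ?_, ?_⟩
  · rw [etaMinus_lower_eq (h.lt hτ') hs.2, add_comm, add_mul]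
    exact (abs_add_le _ _).trans (add_le_add h3.2.1 (hsing y h.lower))
  · rw [etaMinus_upper_eq (h.lt hs')]
    exact hrel h3.1
  · rw [etaPlus_lower_eq (h.lt hs')]
    exact hrel h3.2.2.1
  · rw [etaPlus_upper_eq (h.lt hτ') hs.2, add_comm, add_mul]
    exact (abs_add_le _ _).trans (add_le_add h3.2.2.2 (hsing z h.upper))

lemma tendsto_zero_of_abs_le_sqrt {τ C : ℝ} {g : ℝ → ℝ} (hτ : 0 < τ)
    (hg : ∀ s ∈ Ioo 0 τ, |g s| ≤ C * √(τ - s)) : Tendsto g (𝓝[<] τ) (𝓝 0) := by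
  have h1 : Tendsto (fun s => C * √(τ - s)) (𝓝[<] τ) (𝓝 0) := by
    have : ContinuousAt (fun s => C * √(τ - s)) τ := by fun_prop
    have h2 := this.tendsto.mono_left (nhdsWithin_le_nhds (s := Iio τ))
    simpa using h2
  refine squeeze_zero_norm' ?_ h1
  filter_upwards [Ioo_mem_nhdsLT hτ] with s hs using hg s hs

end regular

/-! ### Fourier and theta representations -/

section fourier

variable {y z : ℝ → ℝ} {τ s : ℝ}

/-- The `n`-th Gaussian factor `exp (-π² n² (τ - s) / l²)`. -/
noncomputable def nome (l t : ℝ) (n : ℕ) : ℝ := exp (-π ^ 2 * (n + 1) ^ 2 / l ^ 2 * t)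

lemma shift_eq (hyz : y τ < z τ) (c : ℝ) (n : ℤ) (ξ : ℝ) :
    shift y z (n + c) τ ξ =
      2 * (z τ - y τ) * (n + (c - (ξ - y τ) / (2 * (z τ - y τ)))) := by
  have hl : z τ - y τ ≠ 0 := (sub_pos.2 hyz).ne'
  rw [shift]
  field_simp
  ring

lemma gaussTerm_eq_exp (hyz : y τ < z τ) (hs : s < τ) (c : ℝ) (n : ℤ) (ξ : ℝ) :
    gaussTerm y z (n + c) τ ξ s =
      exp (-π * (n + (c - (ξ - y τ) / (2 * (z τ - y τ)))) ^ 2 *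
        ((z τ - y τ) ^ 2 / (π * (τ - s)))) := by
  have ht := (sub_pos.2 hs).ne'
  rw [gaussTerm, shift_eq hyz]
  congr 1
  field_simp
  ring

/-- Jacobi's transformation (Poisson summation). The displacement is 2l(n + a) with a = c - (ξ -
y)/(2l), so the image sum is the even theta kernel at l²/(π(τ - s)), and its functional equation
inverts the argument. -/
lemma tsum_gaussTerm (hyz : y τ < z τ) (hs : s < τ) (c ξ : ℝ) :
    1 / √(π * (τ - s)) * ∑' n : ℤ, gaussTerm y z (n + c) τ ξ s =
      1 / (z τ - y τ) * HurwitzZeta.cosKernel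
        ((c - (ξ - y τ) / (2 * (z τ - y τ)) : ℝ) : UnitAddCircle)
        (π * (τ - s) / (z τ - y τ) ^ 2) := by
  have ht := sub_pos.2 hs
  have hl := sub_pos.2 hyz
  have hx : 0 < (z τ - y τ) ^ 2 / (π * (τ - s)) := by positivity
  simp_rw [gaussTerm_eq_exp hyz hs]
  rw [(HurwitzZeta.hasSum_int_evenKernel _ hx).tsum_eq, HurwitzZeta.evenKernel_functional_equation,
    ← sqrt_eq_rpow, sqrt_div (sq_nonneg _), sqrt_sq hl.le, one_div_div]
  have : √(π * (τ - s)) ≠ 0 := by positivity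
  field_simp

/-- The odd counterpart: the factor n + a makes the sum an odd theta kernel, whose functional
equation has exponent 3/2. -/
lemma tsum_upsilonTerm (hyz : y τ < z τ) (hs : s < τ) (c ξ : ℝ) :
    ∑' n : ℤ, upsilonTerm y z (n + c) τ ξ s =
      -(π / (z τ - y τ) ^ 2 * HurwitzZeta.sinKernel
        ((c - (ξ - y τ) / (2 * (z τ - y τ)) : ℝ) : UnitAddCircle)
        (π * (τ - s) / (z τ - y τ) ^ 2)) := by
  have ht := sub_pos.2 hs
  have hl := sub_pos.2 hyz
  have hx : 0 < (z τ - y τ) ^ 2 / (π * (τ - s)) := by positivity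
  have h1 : ∀ n : ℤ, upsilonTerm y z (n + c) τ ξ s = -((z τ - y τ) / √(π * (τ - s) ^ 3)) *
      ((n + (c - (ξ - y τ) / (2 * (z τ - y τ))) : ℝ) *
      exp (-π * (n + (c - (ξ - y τ) / (2 * (z τ - y τ)))) ^ 2 *
        ((z τ - y τ) ^ 2 / (π * (τ - s))))) := by
    intro n
    rw [← gaussTerm_eq_exp hyz hs, upsilonTerm, gaussTerm]
    nth_rw 1 [shift_eq hyz]
    ring
  simp_rw [h1]
  rw [tsum_mul_left, (HurwitzZeta.hasSum_int_oddKernel _ hx).tsum_eq,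
    HurwitzZeta.oddKernel_functional_equation, one_div_div, sqrt_pi_mul_cube ht,
    show (3 / 2 : ℝ) = 1 + 1 / 2 by norm_num, rpow_add hx, rpow_one,
    ← sqrt_eq_rpow, sqrt_div (sq_nonneg _), sqrt_sq hl.le]
  have : √(π * (τ - s)) ≠ 0 := by positivity
  field_simp

lemma hasSum_cosKernel_sub_one {l t : ℝ} (hl : 0 < l) (ht : 0 < t) (a : ℝ) :
    HasSum (fun n : ℕ => nome l t n * cos (2 * π * a * (n + 1)))
      ((HurwitzZeta.cosKernel (a : UnitAddCircle) (π * t / l ^ 2) - 1) / 2) := by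
  have := (HurwitzZeta.hasSum_nat_cosKernel₀ a (t := π * t / l ^ 2) (by positivity)).div_const 2
  refine this.congr_fun fun n => ?_
  rw [nome, show -π * ((n : ℝ) + 1) ^ 2 * (π * t / l ^ 2) = -π ^ 2 * (n + 1) ^ 2 / l ^ 2 * t by ring]
  ring

lemma hasSum_sinKernel {l t : ℝ} (hl : 0 < l) (ht : 0 < t) (a : ℝ) :
    HasSum (fun n : ℕ => (n + 1) * nome l t n * sin (2 * π * a * (n + 1)))
      (HurwitzZeta.sinKernel (a : UnitAddCircle) (π * t / l ^ 2) / 2) := by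
  have := (HurwitzZeta.hasSum_nat_sinKernel a (t := π * t / l ^ 2) (by positivity)).div_const 2
  -- The sine series is indexed from n = 0, where its term vanishes; the index is shifted by one.
  rw [← hasSum_nat_add_iff' 1] at this
  simp only [Finset.range_one, Finset.sum_singleton, Nat.cast_zero, mul_zero, zero_mul, zero_div,
    sub_zero, Nat.cast_add, Nat.cast_one] at this
  refine this.congr_fun fun n => ?_
  rw [nome, show -π * ((n : ℝ) + 1) ^ 2 * (π * t / l ^ 2) = -π ^ 2 * (n + 1) ^ 2 / l ^ 2 * t by ring]
  ring

lemma cos_succ_mul_pi_sub (n : ℕ) (x : ℝ) : cos ((n + 1) * π - x) = (-1) ^ (n + 1) * cos x := by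
  have := Real.cos_nat_mul_pi_sub x (n + 1)
  exact_mod_cast this

lemma sin_succ_mul_pi_sub (n : ℕ) (x : ℝ) : sin ((n + 1) * π - x) = -((-1) ^ (n + 1) * sin x) := by
  have := Real.sin_nat_mul_pi_sub x (n + 1)
  exact_mod_cast this

lemma hasSum_etaMinus (hyz : y τ < z τ) (hs : s < τ) (ξ : ℝ) :
    ∃ S : ℝ, HasSum (fun n : ℕ => nome (z τ - y τ) (τ - s) n *
        cos (π * (n + 1) * (ξ - y τ) / (z τ - y τ))) S ∧
      etaMinus y z τ ξ s =
        -kronecker ξ (y s) / √(π * (τ - s)) + 1 / (z τ - y τ) * (1 + 2 * S) := by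
  have hl := sub_pos.2 hyz
  refine ⟨_, (hasSum_cosKernel_sub_one hl (sub_pos.2 hs)
    (0 - (ξ - y τ) / (2 * (z τ - y τ)))).congr_fun fun n => ?_, ?_⟩
  · rw [← cos_neg]
    congr 2
    field_simp
    ring
  · have := tsum_gaussTerm hyz hs 0 ξ
    simp only [add_zero] at this
    rw [etaMinus, this]
    ring

/-- The offset 1/2 adds (n + 1)π to the phase of the cosine, which is where the alternating sign
comes from. -/
lemma hasSum_etaPlus (hyz : y τ < z τ) (hs : s < τ) (ξ : ℝ) :
    ∃ S : ℝ, HasSum (fun n : ℕ => nome (z τ - y τ) (τ - s) n *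
        (-1) ^ (n + 1) * cos (π * (n + 1) * (ξ - y τ) / (z τ - y τ))) S ∧
      etaPlus y z τ ξ s =
        -kronecker ξ (z s) / √(π * (τ - s)) + 1 / (z τ - y τ) * (1 + 2 * S) := by
  have hl := sub_pos.2 hyz
  refine ⟨_, (hasSum_cosKernel_sub_one hl (sub_pos.2 hs)
    (1 / 2 - (ξ - y τ) / (2 * (z τ - y τ)))).congr_fun fun n => ?_, ?_⟩
  · rw [mul_assoc, ← cos_succ_mul_pi_sub]
    congr 2
    field_simp
  · rw [etaPlus, tsum_gaussTerm hyz hs (1 / 2) ξ]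
    ring

lemma hasSum_upsilonMinus (hyz : y τ < z τ) (hs : s < τ) (ξ : ℝ) :
    ∃ S : ℝ, HasSum (fun n : ℕ => (n + 1) * nome (z τ - y τ) (τ - s) n *
        sin (π * (n + 1) * (ξ - y τ) / (z τ - y τ))) S ∧
      upsilonMinus y z τ ξ s = 2 * π / (z τ - y τ) ^ 2 * S := by
  have hl := sub_pos.2 hyz
  refine ⟨_, (hasSum_sinKernel hl (sub_pos.2 hs)
    (0 - (ξ - y τ) / (2 * (z τ - y τ)))).neg.congr_fun fun n => ?_, ?_⟩
  · rw [← mul_neg, ← sin_neg]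
    congr 2
    field_simp
    ring
  · have := tsum_upsilonTerm hyz hs 0 ξ
    simp only [add_zero] at this
    rw [upsilonMinus, this]
    ring

lemma hasSum_upsilonPlus (hyz : y τ < z τ) (hs : s < τ) (ξ : ℝ) :
    ∃ S : ℝ, HasSum (fun n : ℕ => (n + 1) * nome (z τ - y τ) (τ - s) n *
        (-1) ^ (n + 1) * sin (π * (n + 1) * (ξ - y τ) / (z τ - y τ))) S ∧
      upsilonPlus y z τ ξ s = 2 * π / (z τ - y τ) ^ 2 * S := by
  have hl := sub_pos.2 hyz
  refine ⟨_, (hasSum_sinKernel hl (sub_pos.2 hs)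
    (1 / 2 - (ξ - y τ) / (2 * (z τ - y τ)))).neg.congr_fun fun n => ?_, ?_⟩
  · rw [mul_assoc, ← neg_neg ((-1) ^ (n + 1) * _), ← sin_succ_mul_pi_sub, mul_neg]
    congr 3
    field_simp
  · rw [upsilonPlus, tsum_upsilonTerm hyz hs (1 / 2) ξ]
    ring

/-- Termwise differentiation: ω^((n+1)²) ≤ ω^(n+1), so the differentiated series is dominated by Σ
2(n + 1)ω^(n+1), uniformly in v. -/
lemma hasDerivAt_theta₃ {ω : ℝ} (h0 : 0 ≤ ω) (h1 : ω < 1) (v : ℝ) :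
    HasDerivAt (fun v => theta₃ v ω)
      (2 * ∑' n : ℕ, ω ^ ((n + 1) ^ 2) * (-sin (2 * (n + 1) * v) * (2 * (n + 1)))) v := by
  have hpow : ∀ n : ℕ, ω ^ ((n + 1) ^ 2) ≤ ω ^ (n + 1) := fun n =>
    pow_le_pow_of_le_one h0 h1.le (by nlinarith)
  have hω : ‖ω‖ < 1 := by rwa [norm_of_nonneg h0]
  have hu : Summable fun n : ℕ => ω ^ (n + 1) * (1 * (2 * ((n : ℝ) + 1))) := by
    have h2 := (summable_pow_mul_geometric_of_norm_lt_one (R := ℝ) 1 hω).mul_left 2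
    have h3 := (summable_nat_add_iff (f := fun n : ℕ => 2 * ((n : ℝ) ^ 1 * ω ^ n)) 1).2 h2
    refine h3.congr fun n => ?_
    push_cast
    ring
  have hg : Summable fun n : ℕ => ω ^ ((n + 1) ^ 2) * cos (2 * (n + 1) * v) := by
    refine Summable.of_norm_bounded ((summable_nat_add_iff (f := fun n : ℕ => ω ^ n) 1).2
      (summable_geometric_of_lt_one h0 h1)) fun n => ?_
    rw [norm_mul, norm_of_nonneg (pow_nonneg h0 _)]
    exact (mul_le_of_le_one_right (pow_nonneg h0 _) (abs_cos_le_one _)).trans (hpow n)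
  have hd : ∀ (n : ℕ), ∀ x ∈ univ, HasDerivAt (fun v => ω ^ ((n + 1) ^ 2) * cos (2 * (n + 1) * v))
      (ω ^ ((n + 1) ^ 2) * (-sin (2 * (n + 1) * x) * (2 * (n + 1)))) x := by
    intro n x _
    have hd : HasDerivAt (fun v : ℝ => 2 * ((n : ℝ) + 1) * v) (2 * (n + 1)) x := by
      simpa using (hasDerivAt_id x).const_mul (2 * ((n : ℝ) + 1))
    exact hd.cos.const_mul _
  have hb : ∀ (n : ℕ), ∀ x ∈ univ,
      ‖ω ^ ((n + 1) ^ 2) * (-sin (2 * ((n : ℝ) + 1) * x) * (2 * (n + 1)))‖ ≤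
        ω ^ (n + 1) * (1 * (2 * ((n : ℝ) + 1))) := by
    intro n x _
    rw [norm_mul, norm_mul, norm_of_nonneg (pow_nonneg h0 _),
      norm_of_nonneg (by positivity : (0 : ℝ) ≤ 2 * (n + 1)), norm_neg]
    exact mul_le_mul (hpow n) (mul_le_mul_of_nonneg_right (abs_sin_le_one _) (by positivity))
      (by positivity) (pow_nonneg h0 _)
  have := hasDerivAt_tsum_of_isPreconnected hu isOpen_univ isPreconnected_univ hd hb
    (mem_univ v) hg (mem_univ v)
  exact (this.const_mul 2).const_add 1

lemma omega₂_nonneg (y z : ℝ → ℝ) (τ s : ℝ) : 0 ≤ omega₂ y z τ s := (exp_pos _).le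

lemma omega₂_pow (y z : ℝ → ℝ) (τ s : ℝ) (n : ℕ) :
    omega₂ y z τ s ^ ((n + 1) ^ 2) = nome (z τ - y τ) (τ - s) n := by
  rw [omega₂, nome, ← exp_nat_mul]
  push_cast
  ring_nf

lemma omega₂_lt_one (hyz : y τ < z τ) (hs : s < τ) : omega₂ y z τ s < 1 := by
  have hl := sub_pos.2 hyz
  have ht := sub_pos.2 hs
  rw [omega₂, exp_lt_one_iff, neg_mul, neg_div, neg_lt_zero]
  positivity

lemma two_mul_phiMinus_lower (hyz : y τ < z τ) (n : ℕ) (ξ : ℝ) :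
    2 * ((n : ℝ) + 1) * phiMinus y z τ ξ (y τ) = π * (n + 1) * (ξ - y τ) / (z τ - y τ) := by
  have hl := (sub_pos.2 hyz).ne'
  rw [phiMinus]
  field_simp

lemma two_mul_phiMinus_add (hyz : y τ < z τ) (n : ℕ) (ξ : ℝ) :
    2 * ((n : ℝ) + 1) * phiMinus y z τ (ξ + (z τ - y τ)) (y τ) =
      (n + 1) * π - -(π * (n + 1) * (ξ - y τ) / (z τ - y τ)) := by
  have hl := (sub_pos.2 hyz).ne'
  rw [phiMinus]
  field_simp
  ring

lemma etaMinus_eq_theta₃ (hyz : y τ < z τ) (hs : s < τ) (ξ : ℝ) :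
    etaMinus y z τ ξ s = -kronecker ξ (y s) / √(π * (τ - s))
        + 1 / (z τ - y τ) * theta₃ (phiMinus y z τ ξ (y τ)) (omega₂ y z τ s) := by
  obtain ⟨S, hS, h⟩ := hasSum_etaMinus hyz hs ξ
  rw [h, theta₃, ← hS.tsum_eq]
  simp only [omega₂_pow, two_mul_phiMinus_lower hyz]

lemma etaPlus_eq_theta₃ (hyz : y τ < z τ) (hs : s < τ) (ξ : ℝ) :
    etaPlus y z τ ξ s = -kronecker ξ (z s) / √(π * (τ - s))
        + 1 / (z τ - y τ) * theta₃ (phiMinus y z τ (ξ + (z τ - y τ)) (y τ)) (omega₂ y z τ s) := by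
  obtain ⟨S, hS, h⟩ := hasSum_etaPlus hyz hs ξ
  rw [h, theta₃, ← hS.tsum_eq]
  simp only [omega₂_pow, two_mul_phiMinus_add hyz, cos_succ_mul_pi_sub, cos_neg, mul_assoc]

lemma upsilonMinus_eq_deriv_theta₃ (hyz : y τ < z τ) (hs : s < τ) (ξ : ℝ) :
    upsilonMinus y z τ ξ s = -(π / (2 * (z τ - y τ) ^ 2)) *
        deriv (fun v => theta₃ v (omega₂ y z τ s)) (phiMinus y z τ ξ (y τ)) := by
  obtain ⟨S, hS, h⟩ := hasSum_upsilonMinus hyz hs ξ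
  rw [h, (hasDerivAt_theta₃ (omega₂_nonneg y z τ s) (omega₂_lt_one hyz hs) _).deriv]
  simp only [omega₂_pow, two_mul_phiMinus_lower hyz]
  have : ∀ n : ℕ, nome (z τ - y τ) (τ - s) n *
      (-sin (π * (n + 1) * (ξ - y τ) / (z τ - y τ)) * (2 * (n + 1))) =
      -2 * ((n + 1) * nome (z τ - y τ) (τ - s) n *
        sin (π * (n + 1) * (ξ - y τ) / (z τ - y τ))) := fun n => by ring
  simp_rw [this]
  rw [tsum_mul_left, hS.tsum_eq]
  field_simp

lemma upsilonPlus_eq_deriv_theta₃ (hyz : y τ < z τ) (hs : s < τ) (ξ : ℝ) :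
    upsilonPlus y z τ ξ s = -(π / (2 * (z τ - y τ) ^ 2)) *
        deriv (fun v => theta₃ v (omega₂ y z τ s))
          (phiMinus y z τ (ξ + (z τ - y τ)) (y τ)) := by
  obtain ⟨S, hS, h⟩ := hasSum_upsilonPlus hyz hs ξ
  rw [h, (hasDerivAt_theta₃ (omega₂_nonneg y z τ s) (omega₂_lt_one hyz hs) _).deriv]
  simp only [omega₂_pow, two_mul_phiMinus_add hyz, sin_succ_mul_pi_sub, sin_neg]
  have : ∀ n : ℕ, nome (z τ - y τ) (τ - s) n *
      (- -((-1) ^ (n + 1) * -sin (π * (n + 1) * (ξ - y τ) / (z τ - y τ))) * (2 * (n + 1))) =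
      -2 * ((n + 1) * nome (z τ - y τ) (τ - s) n * (-1) ^ (n + 1) *
        sin (π * (n + 1) * (ξ - y τ) / (z τ - y τ))) := fun n => by ring
  simp_rw [this]
  rw [tsum_mul_left, hS.tsum_eq]
  field_simp

end fourier

/-! ### A maximum principle -/

lemma HasDerivAt.nonneg_of_eventually_le_left {f : ℝ → ℝ} {f' x : ℝ} (h : HasDerivAt f f' x)
    (hf : ∀ᶠ u in 𝓝[<] x, f u ≤ f x) : 0 ≤ f' := by
  have h1 := (hasDerivWithinAt_iff_tendsto_slope' (s := Iio x) (by simp)).1 h.hasDerivWithinAt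
  refine ge_of_tendsto h1 ?_
  filter_upwards [hf, self_mem_nhdsWithin] with u hu hux
  rw [slope_def_field]
  exact div_nonneg_of_nonpos (sub_nonpos.2 hu) (sub_nonpos.2 (le_of_lt hux))

/-- A positive second derivative would make x a local minimum too; then f is constant near x and its
second derivative is 0. -/
lemma IsLocalMax.deriv_deriv_nonpos {f : ℝ → ℝ} {x : ℝ} (h : IsLocalMax f x)
    (hc : ContinuousAt f x) : deriv (deriv f) x ≤ 0 := by
  by_contra! hpos
  have hmin := isLocalMin_of_deriv_deriv_pos hpos h.deriv_eq_zero hc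
  have heq : f =ᶠ[𝓝 x] fun _ => f x := by
    filter_upwards [h, hmin] with u hu hu' using le_antisymm hu hu'
  have h2 := heq.deriv.deriv_eq
  simp at h2
  linarith

/-- A strict subsolution of the heat equation on a moving strip that is nonpositive on the parabolic
boundary is nonpositive. -/
lemma nonpos_of_subsolution {σ₀ σ r : ℝ} {y : ℝ → ℝ} {v vt : ℝ → ℝ → ℝ}
    (hσ : σ₀ < σ) (hy : ContinuousOn y (Icc σ₀ σ))
    (hv : ContinuousOn (fun p : ℝ × ℝ => v p.1 (y p.1 + p.2)) (Icc σ₀ σ ×ˢ Icc 0 r))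
    (hd : ∀ s ∈ Ioo σ₀ σ, ∀ x ∈ Ioo (y s) (y s + r), DifferentiableAt ℝ (v s) x)
    (ht : ∀ s ∈ Ioo σ₀ σ, ∀ x ∈ Ioo (y s) (y s + r), HasDerivAt (fun u => v u x) (vt s x) s)
    (hlt : ∀ s ∈ Ioo σ₀ σ, ∀ x ∈ Ioo (y s) (y s + r), vt s x < deriv (deriv (v s)) x)
    (h0 : ∀ ζ ∈ Icc 0 r, v σ₀ (y σ₀ + ζ) ≤ 0) (hl : ∀ s ∈ Icc σ₀ σ, v s (y s) ≤ 0)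
    (hu : ∀ s ∈ Icc σ₀ σ, v s (y s + r) ≤ 0) :
    ∀ s ∈ Icc σ₀ σ, ∀ ζ ∈ Icc 0 r, v s (y s + ζ) ≤ 0 := by
  -- The differential inequality is available only before σ. Maximizing over times up to s₁ < σ
  -- ensures that it holds at the maximum even if this is attained at the last time s₁.
  have interior : ∀ s ∈ Ico σ₀ σ, ∀ ζ ∈ Icc 0 r, v s (y s + ζ) ≤ 0 := by
    intro s₁ hs₁ ζ₁ hζ₁
    by_contra! hpos
    have hsub : Icc σ₀ s₁ ×ˢ Icc 0 r ⊆ Icc σ₀ σ ×ˢ Icc 0 r :=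
      prod_mono (Icc_subset_Icc_right hs₁.2.le) le_rfl
    obtain ⟨⟨s, ζ⟩, ⟨hs, hζ⟩, hmax⟩ := (isCompact_Icc.prod isCompact_Icc).exists_isMaxOn
      ⟨(s₁, ζ₁), ⟨right_mem_Icc.2 hs₁.1, hζ₁⟩⟩ (hv.mono hsub)
    simp only at hs hζ
    have hM : 0 < v s (y s + ζ) :=
      hpos.trans_le (hmax (show (s₁, ζ₁) ∈ _ from ⟨right_mem_Icc.2 hs₁.1, hζ₁⟩))
    have hsσ : s ∈ Icc σ₀ σ := ⟨hs.1, hs.2.trans hs₁.2.le⟩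
    have hs0 : s ≠ σ₀ := by
      rintro rfl
      exact (h0 ζ hζ).not_gt hM
    have hζ0 : ζ ≠ 0 := by
      rintro rfl
      rw [add_zero] at hM
      exact (hl s hsσ).not_gt hM
    have hζr : ζ ≠ r := by
      rintro rfl
      exact (hu s hsσ).not_gt hM
    have hs' : s ∈ Ioo σ₀ σ := ⟨lt_of_le_of_ne hs.1 hs0.symm, hs.2.trans_lt hs₁.2⟩
    have hζ' : ζ ∈ Ioo 0 r := ⟨lt_of_le_of_ne hζ.1 hζ0.symm, lt_of_le_of_ne hζ.2 hζr⟩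
    set x := y s + ζ with hx
    have hxm : x ∈ Ioo (y s) (y s + r) := ⟨by linarith [hζ'.1], by linarith [hζ'.2]⟩
    have hmax' : ∀ u ∈ Icc σ₀ s₁, ∀ w ∈ Icc (y u) (y u + r), v u w ≤ v s x := by
      intro u hu w hw
      have := hmax (show (u, w - y u) ∈ Icc σ₀ s₁ ×ˢ Icc 0 r from
        ⟨hu, by linarith [hw.1], by linarith [hw.2]⟩)
      simpa using this
    have hspace : IsLocalMax (v s) x := by
      filter_upwards [Ioo_mem_nhds hxm.1 hxm.2] with w hw
      exact hmax' s hs w (Ioo_subset_Icc_self hw)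
    have htime : 0 ≤ vt s x := by
      refine HasDerivAt.nonneg_of_eventually_le_left (ht s hs' x hxm) ?_
      -- The time derivative is taken at fixed x, not at fixed distance from the boundary; by
      -- continuity of y the point (u, x) is still in the strip for u slightly before s.
      have hyc : ContinuousAt y s := hy.continuousAt (Icc_mem_nhds hs'.1 hs'.2)
      have h1 : ∀ᶠ u in 𝓝 s, y u < x := hyc.eventually_lt_const hxm.1
      have h2 : ∀ᶠ u in 𝓝 s, x < y u + r := (hyc.add_const r).eventually_const_lt hxm.2
      filter_upwards [nhdsWithin_le_nhds h1, nhdsWithin_le_nhds h2, Ioo_mem_nhdsLT hs'.1]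
        with u hu1 hu2 hu3
      exact hmax' u ⟨hu3.1.le, hu3.2.le.trans hs.2⟩ x ⟨hu1.le, hu2.le⟩
    have := IsLocalMax.deriv_deriv_nonpos hspace (hd s hs' x hxm).continuousAt
    linarith [hlt s hs' x hxm]
  intro s hs ζ hζ
  rcases hs.2.lt_or_eq with hlt' | rfl
  · exact interior s ⟨hs.1, hlt'⟩ ζ hζ
  -- The final time is reached by continuity along a curve at constant distance ζ from the boundary.
  · have hc : ContinuousWithinAt (fun u => v u (y u + ζ)) (Icc σ₀ s) s :=
      ((hv.comp (f := fun u : ℝ => (u, ζ)) (by fun_prop) fun u hu => ⟨hu, hζ⟩) s hs)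
    have hc' : Tendsto (fun u => v u (y u + ζ)) (𝓝[<] s) (𝓝 (v s (y s + ζ))) := by
      refine hc.tendsto.mono_left ?_
      rw [← nhdsWithin_Ico_eq_nhdsLT hσ]
      exact nhdsWithin_mono _ Ico_subset_Icc_self
    refine le_of_tendsto hc' ?_
    filter_upwards [Ico_mem_nhdsLT hσ] with u hu using interior u hu ζ hζ

/-! ### Elementary properties of solutions -/

section solution

variable {T L l₀ : ℝ} {y z fm fp U₀ : ℝ → ℝ} {U : ℝ → ℝ → ℝ}

lemma openStrip_mem_nhds (hy : ContinuousOn y (Icc 0 T)) (hz : ContinuousOn z (Icc 0 T))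
    {p : ℝ × ℝ} (hp : p ∈ openStrip T y z) : openStrip T y z ∈ 𝓝 p := by
  obtain ⟨h1, h2⟩ := hp
  have hyc : ContinuousAt (fun q : ℝ × ℝ => y q.1) p :=
    (hy.continuousAt (Icc_mem_nhds h1.1 h1.2)).comp continuousAt_fst
  have hzc : ContinuousAt (fun q : ℝ × ℝ => z q.1) p :=
    (hz.continuousAt (Icc_mem_nhds h1.1 h1.2)).comp continuousAt_fst
  filter_upwards [continuousAt_fst.eventually_mem (Ioo_mem_nhds h1.1 h1.2),
    hyc.eventually_lt continuousAt_snd h2.1, continuousAt_snd.eventually_lt hzc h2.2]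
    with q hq1 hq2 hq3 using ⟨hq1, hq2, hq3⟩

lemma openStrip_subset_strip : openStrip T y z ⊆ strip T y z :=
  fun _ hp => ⟨Ioo_subset_Ioc_self hp.1, Ioo_subset_Icc_self hp.2⟩

namespace IsSolution

lemma neg (hU : IsSolution T y z fm fp U₀ U) :
    IsSolution T y z (fun s => -fm s) (fun s => -fp s) (fun s => -U₀ s) (fun s x => -U s x) := by
  have hg : ∀ s x, grad y z (fun s x => -U s x) s x = -grad y z U s x := fun s x =>
    derivWithin.fun_neg
  have hd : ∀ s, deriv (fun x => -U s x) = fun x => -deriv (U s) x := fun s => by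
    ext x
    exact deriv.fun_neg
  have hdd : ∀ s x, deriv (deriv (fun x => -U s x)) x = -deriv (deriv (U s)) x := fun s x => by
    rw [hd]
    exact deriv.fun_neg
  refine ⟨?_, hU.continuousOn.neg, fun s hs => (hU.differentiableOn s hs).neg, ?_, fun p hp => ?_,
    ?_, fun p hp => ?_, fun x hx => ?_, fun s hs => ?_, fun s hs => ?_⟩
  · obtain ⟨M, hM⟩ := hU.bounded
    exact ⟨M, fun p hp => by simpa using hM p hp⟩
  · exact hU.continuousOn_grad.neg.congr fun p _ => hg _ _
  · rw [hd]
    exact (hU.differentiableAt_deriv p hp).neg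
  · exact hU.continuousOn_deriv_deriv.neg.congr fun p _ => hdd _ _
  · rw [hdd]
    exact (hU.heat p hp).neg
  · exact ⟨by rw [(hU.initial x hx).1], (hU.initial x hx).2.neg⟩
  · rw [hU.boundary_lower s hs]
  · rw [hU.boundary_upper s hs]

lemma differentiableAt (hU : IsSolution T y z fm fp U₀ U) {s x : ℝ} (hs : s ∈ Ioc 0 T)
    (hx : x ∈ Ioo (y s) (z s)) : DifferentiableAt ℝ (U s) x :=
  (hU.differentiableOn s hs).differentiableAt (Icc_mem_nhds hx.1 hx.2)

lemma grad_eq_deriv {s x : ℝ} (hx : x ∈ Ioo (y s) (z s)) : grad y z U s x = deriv (U s) x :=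
  derivWithin_of_mem_nhds (Icc_mem_nhds hx.1 hx.2)

lemma hasDerivWithinAt (hU : IsSolution T y z fm fp U₀ U) {s x : ℝ} (hs : s ∈ Ioc 0 T)
    (hx : x ∈ Icc (y s) (z s)) : HasDerivWithinAt (U s) (grad y z U s x) (Icc (y s) (z s)) x :=
  (hU.differentiableOn s hs x hx).hasDerivWithinAt

lemma hasDerivAt (hU : IsSolution T y z fm fp U₀ U) {s x : ℝ} (hs : s ∈ Ioc 0 T)
    (hx : x ∈ Ioo (y s) (z s)) : HasDerivAt (U s) (grad y z U s x) x :=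
  (hU.hasDerivWithinAt hs (Ioo_subset_Icc_self hx)).hasDerivAt (Icc_mem_nhds hx.1 hx.2)

lemma hasDerivAt_grad (hU : IsSolution T y z fm fp U₀ U) {s x : ℝ} (hs : s ∈ Ioo 0 T)
    (hx : x ∈ Ioo (y s) (z s)) :
    HasDerivAt (grad y z U s) (deriv (deriv (U s)) x) x := by
  refine (hU.differentiableAt_deriv (s, x) ⟨hs, hx⟩).hasDerivAt.congr_of_eventuallyEq ?_
  filter_upwards [Ioo_mem_nhds hx.1 hx.2] with w hw using grad_eq_deriv hw

/-! ### The boundary gradient estimate -/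

/-- Comparison with W = f⁻(σ) + K(σ - s) + Q(2ρ/r - ρ²/r²), ρ = x - y(s), on the parabolic box of
duration r² and width r. At the bottom Kr² ≥ 2M lifts W above U; on ρ = 0 the term K(σ - s)
dominates the variation of f⁻; on ρ = r the parabola equals 1 and Q ≥ 2M suffices. Strictness holds
because W_xx = -2Q/r², while Kr² < Q and, by Lr ≤ 1/4, the drift of the boundary costs at most
Q/(2r²). -/
lemma le_barrier (hU : IsSolution T y z fm fp U₀ U) (h : IsStrip T L l₀ y z)
    (hfm : IsC1With T L fm) {M σ r : ℝ} (hM : ∀ p ∈ strip T y z, U p.1 p.2 ≤ M) (hM0 : L ≤ M)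
    (hσ : σ ∈ Ioc 0 T) (hr : 0 < r) (hrσ : r ^ 2 < σ) (hrl : r ≤ l₀) (hLr : L * r ≤ 1 / 4)
    {ζ : ℝ} (hζ : ζ ∈ Icc 0 r) :
    U σ (y σ + ζ) ≤ fm σ + (2 * M + L * r ^ 2 + 1) * (2 * ζ / r - ζ ^ 2 / r ^ 2) := by
  set Q := 2 * M + L * r ^ 2 + 1 with hQ
  set K := 2 * M / r ^ 2 + L with hK
  have hL := h.lower.nonneg
  have hMp : 0 ≤ M := hL.trans hM0
  have hQ0 : 0 ≤ Q := by positivity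
  set W : ℝ → ℝ → ℝ := fun s x =>
    fm σ + K * (σ - s) + Q * (2 * (x - y s) / r - (x - y s) ^ 2 / r ^ 2) with hW
  have hsub : ∀ s ∈ Icc (σ - r ^ 2) σ, s ∈ Ioc 0 T := fun s hs =>
    ⟨by linarith [hs.1], hs.2.trans hσ.2⟩
  have hsub' : ∀ s ∈ Ioo (σ - r ^ 2) σ, s ∈ Ioo 0 T := fun s hs =>
    ⟨by linarith [hs.1], hs.2.trans_le hσ.2⟩
  have hle : ∀ s ∈ Icc (σ - r ^ 2) σ, y s + r ≤ z s := fun s hs => by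
    linarith [h.le_sub s (Ioc_subset_Icc_self (hsub s hs))]
  have hf : fm σ ≤ M := (le_abs_self _).trans ((hfm.abs_le σ ⟨hσ.1.le, hσ.2⟩).trans hM0)
  have hf' : -M ≤ fm σ := by
    linarith [neg_abs_le (fm σ), hfm.abs_le σ ⟨hσ.1.le, hσ.2⟩]
  have hycont : ContinuousOn y (Icc (σ - r ^ 2) σ) :=
    h.lower.continuousOn.mono fun s hs => Ioc_subset_Icc_self (hsub s hs)
  have hWx : ∀ s x, HasDerivAt (W s) (Q * (2 / r - 2 * (x - y s) / r ^ 2)) x := by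
    intro s x
    have h1 : HasDerivAt (fun x => x - y s) 1 x := (hasDerivAt_id x).sub_const _
    have h2 := (((h1.const_mul 2).div_const r).sub ((h1.pow 2).div_const (r ^ 2))).const_mul Q
    refine (h2.const_add (fm σ + K * (σ - s))).congr_deriv ?_
    simp
  have hWxx : ∀ s x, HasDerivAt (fun x => Q * (2 / r - 2 * (x - y s) / r ^ 2))
      (-(2 * Q / r ^ 2)) x := by
    intro s x
    have h1 : HasDerivAt (fun x => x - y s) 1 x := (hasDerivAt_id x).sub_const _
    refine ((((h1.const_mul 2).div_const (r ^ 2)).const_sub (2 / r)).const_mul Q).congr_deriv ?_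
    ring
  have key := nonpos_of_subsolution (σ₀ := σ - r ^ 2) (σ := σ) (r := r) (y := y)
    (v := fun s x => U s x - W s x)
    (vt := fun s x => deriv (deriv (U s)) x -
      (-K - deriv y s * (Q * (2 / r - 2 * (x - y s) / r ^ 2))))
    (by linarith [pow_pos hr 2]) hycont ?_ ?_ ?_ ?_ ?_ ?_ ?_ σ
    ⟨by linarith [pow_pos hr 2], le_rfl⟩ ζ hζ
  · simp only [hW, sub_self, mul_zero, add_zero, add_sub_cancel_left] at key
    linarith
  · refine ContinuousOn.sub ?_ ?_
    · refine hU.continuousOn.comp (f := fun p : ℝ × ℝ => (p.1, y p.1 + p.2)) ?_ ?_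
      · exact continuousOn_fst.prodMk
          ((hycont.comp continuousOn_fst fun p hp => hp.1).add continuousOn_snd)
      · rintro p ⟨hp1, hp2⟩
        exact ⟨hsub _ hp1, by simpa using hp2.1, by linarith [hp2.2, hle _ hp1]⟩
    · simp only [hW, add_sub_cancel_left]
      fun_prop
  · intro s hs x hx
    exact (hU.differentiableAt (hsub s (Ioo_subset_Icc_self hs))
      ⟨hx.1, hx.2.trans_le (hle s (Ioo_subset_Icc_self hs))⟩).sub (hWx s x).differentiableAt
  · intro s hs x hx
    have hp : (s, x) ∈ openStrip T y z :=
      ⟨hsub' s hs, hx.1, hx.2.trans_le (hle s (Ioo_subset_Icc_self hs))⟩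
    refine (hU.heat (s, x) hp).sub ?_
    have h1 : HasDerivAt (fun s => x - y s) (-deriv y s) s :=
      (h.lower.hasDerivAt s (hsub' s hs)).const_sub x
    have h2 := (((h1.const_mul 2).div_const r).sub ((h1.pow 2).div_const (r ^ 2))).const_mul Q
    have h3 : HasDerivAt (fun s => fm σ + K * (σ - s)) (-K) s := by
      simpa using (((hasDerivAt_id s).const_sub σ).const_mul K).const_add (fm σ)
    refine (h3.add h2).congr_deriv ?_
    simp
    ring
  · intro s hs x hx
    have hxz : x ∈ Ioo (y s) (z s) := ⟨hx.1, hx.2.trans_le (hle s (Ioo_subset_Icc_self hs))⟩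
    have hp : (s, x) ∈ openStrip T y z := ⟨hsub' s hs, hxz⟩
    have h1 : deriv (fun x => U s x - W s x) =ᶠ[𝓝 x]
        fun x => deriv (U s) x - Q * (2 / r - 2 * (x - y s) / r ^ 2) := by
      filter_upwards [Ioo_mem_nhds hxz.1 hxz.2] with w hw
      exact ((hU.differentiableAt (hsub s (Ioo_subset_Icc_self hs)) hw).hasDerivAt.sub
        (hWx s w)).deriv
    rw [h1.deriv_eq, ((hU.differentiableAt_deriv _ hp).hasDerivAt.fun_sub (hWxx s x)).deriv]
    simp only
    have h2 := h.lower.abs_deriv_le s (hsub' s hs)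
    have h3 : |2 / r - 2 * (x - y s) / r ^ 2| ≤ 2 / r := by
      have h4 : 2 / r - 2 * (x - y s) / r ^ 2 = (2 / r ^ 2) * (r - (x - y s)) := by
        field_simp
      have h5 : 2 / r = (2 / r ^ 2) * r := by field_simp
      rw [h4, h5, abs_of_nonneg (mul_nonneg (by positivity) (by linarith [hx.2]))]
      gcongr
      linarith [hx.1]
    have h4 : |deriv y s * (Q * (2 / r - 2 * (x - y s) / r ^ 2))| ≤ Q / (2 * r ^ 2) := by
      rw [abs_mul, abs_mul, abs_of_nonneg hQ0]
      calc |deriv y s| * (Q * |2 / r - 2 * (x - y s) / r ^ 2|) ≤ L * (Q * (2 / r)) := by gcongr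
        _ = Q * (2 * (L * r)) / r ^ 2 := by field_simp
        _ ≤ Q * (2 * (1 / 4)) / r ^ 2 := by gcongr
        _ = _ := by field_simp; norm_num
    have h5 : K < 3 / 2 * Q / r ^ 2 := by
      rw [lt_div_iff₀ (by positivity), hK, add_mul, div_mul_cancel₀ _ (by positivity)]
      rw [hQ]
      nlinarith [mul_nonneg hL (sq_nonneg r)]
    have h6 : 2 * Q / r ^ 2 = 3 / 2 * Q / r ^ 2 + Q / (2 * r ^ 2) := by field_simp; ring
    have h7 := le_abs_self (deriv y s * (Q * (2 / r - 2 * (x - y s) / r ^ 2)))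
    linarith
  · intro ζ hζ
    have h1 := hM (σ - r ^ 2, y (σ - r ^ 2) + ζ) ⟨hsub _ ⟨le_rfl, by linarith [sq_nonneg r]⟩,
      by simpa using hζ.1, by linarith [hζ.2, hle _ ⟨le_rfl, by linarith [sq_nonneg r]⟩]⟩
    simp only [hW, add_sub_cancel_left, sub_sub_cancel] at h1 ⊢
    have h2 : K * r ^ 2 = 2 * M + L * r ^ 2 := by rw [hK]; field_simp
    have h3 : 0 ≤ 2 * ζ / r - ζ ^ 2 / r ^ 2 := by
      have : 2 * ζ / r - ζ ^ 2 / r ^ 2 = ζ * (2 * r - ζ) / r ^ 2 := by field_simp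
      rw [this]
      exact div_nonneg (mul_nonneg hζ.1 (by linarith [hζ.2])) (sq_nonneg r)
    nlinarith [mul_nonneg hQ0 h3, mul_nonneg hL (sq_nonneg r)]
  · intro s hs
    rw [hU.boundary_lower s (hsub s hs)]
    simp only [hW, sub_self, mul_zero, zero_div]
    have h1 := hfm.abs_sub_le s (Ioc_subset_Icc_self (hsub s hs)) σ ⟨hσ.1.le, hσ.2⟩
    rw [abs_of_nonneg (sub_nonneg.2 hs.2)] at h1
    have h2 : L * (σ - s) ≤ K * (σ - s) := by
      have : 0 ≤ σ - s := sub_nonneg.2 hs.2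
      gcongr
      rw [hK]
      have : 0 ≤ 2 * M / r ^ 2 := by positivity
      linarith
    norm_num
    linarith [neg_abs_le (fm σ - fm s)]
  · intro s hs
    have h1 := hM (s, y s + r) ⟨hsub _ hs, by simpa using hr.le, hle s hs⟩
    simp only [hW, add_sub_cancel_left] at h1 ⊢
    have h2 : 2 * r / r - r ^ 2 / r ^ 2 = 1 := by field_simp; norm_num
    have h3 : 0 ≤ K * (σ - s) := mul_nonneg (by positivity) (sub_nonneg.2 hs.2)
    rw [h2]
    nlinarith [mul_nonneg hL (sq_nonneg r)]

/-- U and the barrier agree at the boundary point at time σ, so the gradient of U is at most the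
slope 2Q/r of the barrier there; r² < σ ≤ T makes Q uniform in r. -/
lemma grad_lower_le (hU : IsSolution T y z fm fp U₀ U) (h : IsStrip T L l₀ y z)
    (hfm : IsC1With T L fm) {M σ r : ℝ} (hM : ∀ p ∈ strip T y z, U p.1 p.2 ≤ M) (hM0 : L ≤ M)
    (hσ : σ ∈ Ioc 0 T) (hr : 0 < r) (hrσ : r ^ 2 < σ) (hrl : r ≤ l₀) (hLr : L * r ≤ 1 / 4) :
    grad y z U σ (y σ) ≤ 2 * (2 * M + L * T + 1) / r := by
  have hlt := h.le_sub σ ⟨hσ.1.le, hσ.2⟩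
  have h1 : HasDerivWithinAt (U σ) (grad y z U σ (y σ)) (Ioc (y σ) (y σ + r)) (y σ) :=
    (hU.hasDerivWithinAt hσ ⟨le_rfl, by linarith⟩).mono
      (Ioc_subset_Icc_self.trans (Icc_subset_Icc_right (by linarith)))
  rw [hasDerivWithinAt_iff_tendsto_slope' (by simp), nhdsWithin_Ioc_eq_nhdsGT (by linarith)] at h1
  refine le_of_tendsto h1 ?_
  filter_upwards [Ioc_mem_nhdsGT (by linarith : y σ < y σ + r)] with x hx
  have h2 := hU.le_barrier h hfm hM hM0 hσ hr hrσ hrl hLr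
    (ζ := x - y σ) ⟨by linarith [hx.1], by linarith [hx.2]⟩
  have hx0 : 0 < x - y σ := sub_pos.2 hx.1
  rw [add_sub_cancel] at h2
  rw [slope_def_field, div_le_iff₀ hx0, hU.boundary_lower σ hσ]
  have hQ : 0 ≤ 2 * M + L * r ^ 2 + 1 := by
    have := h.lower.nonneg
    have : 0 ≤ M := this.trans hM0
    positivity
  have h3 : 0 ≤ (x - y σ) ^ 2 / r ^ 2 := by positivity
  have h4 : L * r ^ 2 ≤ L * T := mul_le_mul_of_nonneg_left (by linarith [hσ.2]) h.lower.nonneg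
  have h5 : 0 ≤ 2 * (x - y σ) / r := by positivity
  calc U σ x - fm σ ≤ (2 * M + L * r ^ 2 + 1) * (2 * (x - y σ) / r - (x - y σ) ^ 2 / r ^ 2) := by
        linarith
    _ ≤ (2 * M + L * T + 1) * (2 * (x - y σ) / r) := by
        refine mul_le_mul (by linarith) (by linarith) ?_ (by linarith)
        have : 2 * (x - y σ) / r - (x - y σ) ^ 2 / r ^ 2
          = (x - y σ) * (2 * r - (x - y σ)) / r ^ 2 := by field_simp
        rw [this]
        exact div_nonneg (mul_nonneg hx0.le (by linarith [hx.2])) (sq_nonneg r)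
    _ = _ := by ring

/-- The gradient at the lower boundary has at most an inverse square root singularity at time 0. -/
lemma exists_abs_grad_lower_le (hU : IsSolution T y z fm fp U₀ U) (h : IsStrip T L l₀ y z)
    (hfm : IsC1With T L fm) :
    ∃ C, 0 ≤ C ∧ ∀ σ ∈ Ioc 0 T, |grad y z U σ (y σ)| ≤ C / √σ := by
  rcases le_or_gt T 0 with hT | hT
  · exact ⟨0, le_rfl, fun t ht => absurd (ht.1.trans_le ht.2) (not_lt.2 hT)⟩
  obtain ⟨M₀, hM₀⟩ := hU.bounded
  have hL := h.lower.nonneg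
  have hl₀ := h.pos
  set M := max M₀ L with hMdef
  have hM : 0 ≤ M := hL.trans (le_max_right _ _)
  have hsT : 0 < √T := sqrt_pos.2 hT
  -- The box has width r = c√σ. The three entries of the minimum give r² < σ, r ≤ l₀ and Lr ≤ 1/4.
  set c := min (1 / 2) (min (l₀ / √T) (1 / (4 * (L + 1) * √T))) with hc
  have hc0 : 0 < c := lt_min (by norm_num) (lt_min (by positivity) (by positivity))
  have hc1 : c ≤ 1 / 2 := min_le_left _ _
  have hc2 : c ≤ l₀ / √T := (min_le_right _ _).trans (min_le_left _ _)
  have hc3 : c ≤ 1 / (4 * (L + 1) * √T) := (min_le_right _ _).trans (min_le_right _ _)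
  refine ⟨2 * (2 * M + L * T + 1) / c, by positivity, fun σ hσ => ?_⟩
  have hsσ : 0 < √σ := sqrt_pos.2 hσ.1
  have hσT : √σ ≤ √T := sqrt_le_sqrt hσ.2
  have hr : 0 < c * √σ := by positivity
  have hrσ : (c * √σ) ^ 2 < σ := by
    rw [mul_pow, sq_sqrt hσ.1.le]
    have : c ^ 2 ≤ (1 / 2) ^ 2 := by gcongr
    nlinarith [hσ.1]
  have hrl : c * √σ ≤ l₀ := by
    calc c * √σ ≤ l₀ / √T * √T := by gcongr
      _ = l₀ := by field_simp
  have hLr : L * (c * √σ) ≤ 1 / 4 := by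
    calc L * (c * √σ) ≤ (L + 1) * (1 / (4 * (L + 1) * √T) * √T) := by gcongr; linarith
      _ = 1 / 4 := by field_simp
  have hb1 : ∀ p ∈ strip T y z, U p.1 p.2 ≤ M := fun p hp =>
    (le_abs_self _).trans ((hM₀ p hp).trans (le_max_left _ _))
  have hb2 : ∀ p ∈ strip T y z, -U p.1 p.2 ≤ M := fun p hp =>
    (neg_le_abs _).trans ((hM₀ p hp).trans (le_max_left _ _))
  have h1 := hU.grad_lower_le h hfm hb1 (le_max_right _ _) hσ hr hrσ hrl hLr
  -- The estimate is one-sided; applied to -U it yields the lower bound.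
  have h2 := hU.neg.grad_lower_le h hfm.neg hb2 (le_max_right _ _) hσ hr hrσ hrl hLr
  have h3 : grad y z (fun s x => -U s x) σ (y σ) = -grad y z U σ (y σ) := derivWithin.fun_neg
  rw [h3] at h2
  rw [div_div]
  exact abs_le.2 ⟨by linarith, h1⟩

end IsSolution

end solution

/-! ### Green's identity on a moving strip -/

/-- The chain rule along a curve `u ↦ (u, c u)` for a function with continuous partial
derivatives. -/
lemma hasDerivAt_comp_of_partials {F F₁ F₂ : ℝ → ℝ → ℝ} {s c' : ℝ} {c : ℝ → ℝ}
    (h₁ : ∀ᶠ q in 𝓝 (s, c s), HasDerivAt (fun u => F u q.2) (F₁ q.1 q.2) q.1)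
    (h₂ : ∀ᶠ q in 𝓝 (s, c s), HasDerivAt (F q.1) (F₂ q.1 q.2) q.2)
    (c₁ : ContinuousAt (fun q : ℝ × ℝ => F₁ q.1 q.2) (s, c s))
    (c₂ : ContinuousAt (fun q : ℝ × ℝ => F₂ q.1 q.2) (s, c s))
    (hc : HasDerivAt c c' s) :
    HasDerivAt (fun u => F u (c u)) (F₁ s (c s) + F₂ s (c s) * c') s := by
  have h := hasStrictFDerivAt_uncurry_coprod (𝕜 := ℝ) (u := (s, c s)) (f := F)
    (f₁ := fun u x => ContinuousLinearMap.toSpanSingleton ℝ (F₁ u x))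
    (f₂ := fun u x => ContinuousLinearMap.toSpanSingleton ℝ (F₂ u x))
    (h₁.mono fun q hq => hq.hasFDerivAt) (h₂.mono fun q hq => hq.hasFDerivAt)
    ((ContinuousLinearMap.toSpanSingletonCLE (𝕜 := ℝ) (E := ℝ)).continuous.continuousAt.comp c₁)
    ((ContinuousLinearMap.toSpanSingletonCLE (𝕜 := ℝ) (E := ℝ)).continuous.continuousAt.comp c₂)
  have h3 : HasDerivAt (fun u => (u, c u)) (1, c') s := (hasDerivAt_id s).prodMk hc
  refine (h.hasFDerivAt.comp_hasDerivAt s h3).congr_deriv ?_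
  simp [Function.HasUncurry.uncurry, mul_comm]

/-- If `∂g/∂s = ∂h/∂p` in the open rectangle then the flux through the boundary vanishes. -/
lemma integral_sub_eq_of_conservation {a b : ℝ} (hab : a ≤ b) {g h D : ℝ → ℝ → ℝ}
    (hg : ContinuousOn (fun q : ℝ × ℝ => g q.1 q.2) (Icc a b ×ˢ Icc 0 1))
    (hh : ContinuousOn (fun q : ℝ × ℝ => h q.1 q.2) (Icc a b ×ˢ Icc 0 1))
    (hD : ContinuousOn (fun q : ℝ × ℝ => D q.1 q.2) (Icc a b ×ˢ Ioo 0 1))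
    (hgs : ∀ s ∈ Icc a b, ∀ p ∈ Ioo (0 : ℝ) 1, HasDerivAt (fun s => g s p) (D s p) s)
    (hhp : ∀ s ∈ Icc a b, ∀ p ∈ Ioo (0 : ℝ) 1, HasDerivAt (h s) (D s p) p) :
    (∫ p in (0)..1, g b p) - ∫ p in (0)..1, g a p = ∫ s in a..b, (h s 1 - h s 0) := by
  have hslice : ∀ {k : ℝ → ℝ → ℝ}, ContinuousOn (fun q : ℝ × ℝ => k q.1 q.2) (Icc a b ×ˢ Icc 0 1) →
      ∀ s ∈ Icc a b, ContinuousOn (k s) (Icc 0 1) := fun hk s hs =>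
    hk.comp (f := fun p : ℝ => (s, p)) (by fun_prop) fun p hp => ⟨hs, hp⟩
  have hgi : ∀ s ∈ Icc a b, IntervalIntegrable (g s) volume 0 1 := fun s hs =>
    ((hslice hg s hs).mono (by simp)).intervalIntegrable
  -- D need not be continuous or bounded up to p = 0 and p = 1, so Fubini is applied on [δ, 1 - δ].
  -- The limit δ → 0 then involves only g and h, which are continuous on the closed rectangle.
  have inner : ∀ δ ∈ Ioo (0 : ℝ) (1 / 2),
      ∫ p in δ..(1 - δ), (g b p - g a p) = ∫ s in a..b, (h s (1 - δ) - h s δ) := by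
    intro δ hδ
    have hle : δ ≤ 1 - δ := by linarith [hδ.2]
    have hsub : Icc δ (1 - δ) ⊆ Ioo 0 1 := Icc_subset_Ioo hδ.1 (by linarith [hδ.1])
    have h1 : ∀ p ∈ uIcc δ (1 - δ), g b p - g a p = ∫ s in a..b, D s p := by
      intro p hp
      rw [uIcc_of_le hle] at hp
      rw [intervalIntegral.integral_eq_sub_of_hasDerivAt (f := fun s => g s p)]
      · intro s hs
        rw [uIcc_of_le hab] at hs
        exact hgs s hs p (hsub hp)
      · refine ContinuousOn.intervalIntegrable ?_
        rw [uIcc_of_le hab]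
        exact hD.comp (f := fun s : ℝ => (s, p)) (by fun_prop) fun s hs => ⟨hs, hsub hp⟩
    have h2 : ∀ s ∈ uIcc a b, h s (1 - δ) - h s δ = ∫ p in δ..(1 - δ), D s p := by
      intro s hs
      rw [uIcc_of_le hab] at hs
      rw [intervalIntegral.integral_eq_sub_of_hasDerivAt (f := h s)]
      · intro p hp
        rw [uIcc_of_le hle] at hp
        exact hhp s hs p (hsub hp)
      · refine ContinuousOn.intervalIntegrable ?_
        rw [uIcc_of_le hle]
        exact hD.comp (f := fun p : ℝ => (s, p)) (by fun_prop) fun p hp => ⟨hs, hsub hp⟩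
    rw [intervalIntegral.integral_congr h1, intervalIntegral.integral_congr h2]
    refine (intervalIntegral_intervalIntegral_swap (F := D) ?_).symm
    rw [uIoc_of_le hab, uIoc_of_le hle]
    refine IntegrableOn.mono_set ?_ (prod_mono Ioc_subset_Icc_self Ioc_subset_Icc_self)
    exact ContinuousOn.integrableOn_compact (isCompact_Icc.prod isCompact_Icc)
      (hD.mono (prod_mono le_rfl hsub))
  have hmem : Ioo (0 : ℝ) (1 / 2) ∈ 𝓝[>] (0 : ℝ) := Ioo_mem_nhdsGT (by norm_num)
  have hd0 : Tendsto (fun δ : ℝ => δ) (𝓝[>] 0) (𝓝[Icc 0 1] 0) :=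
    tendsto_nhdsWithin_iff.2 ⟨tendsto_id.mono_left nhdsWithin_le_nhds,
      by filter_upwards [hmem] with δ hδ using ⟨hδ.1.le, by linarith [hδ.2]⟩⟩
  have hd1 : Tendsto (fun δ : ℝ => 1 - δ) (𝓝[>] 0) (𝓝[Icc 0 1] 1) := by
    refine tendsto_nhdsWithin_iff.2 ⟨?_, ?_⟩
    · have : ContinuousAt (fun δ : ℝ => 1 - δ) 0 := by fun_prop
      simpa using this.tendsto.mono_left (nhdsWithin_le_nhds (s := Ioi 0))
    · filter_upwards [hmem] with δ hδ using ⟨by linarith [hδ.2], by linarith [hδ.1]⟩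
  have hlim1 : Tendsto (fun δ => ∫ p in δ..(1 - δ), (g b p - g a p)) (𝓝[>] 0)
      (𝓝 (∫ p in (0)..1, (g b p - g a p))) := by
    set G : ℝ → ℝ := fun p => g b p - g a p
    have hGc : ContinuousOn G (Icc 0 1) :=
      (hslice hg b (right_mem_Icc.2 hab)).sub (hslice hg a (left_mem_Icc.2 hab))
    have hprim : ContinuousOn (fun x => ∫ p in (0)..x, G p) (Icc 0 1) := by
      have := intervalIntegral.continuousOn_primitive_interval (a := 0) (b := 1) (μ := volume)
        (f := G) (by rw [uIcc_of_le zero_le_one]; exact hGc.integrableOn_Icc)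
      rwa [uIcc_of_le zero_le_one] at this
    have h0 := (hprim 0 (by simp)).tendsto.comp hd0
    have h1 := (hprim 1 (by simp)).tendsto.comp hd1
    have h2 := h1.sub h0
    simp only [intervalIntegral.integral_same, sub_zero] at h2
    refine h2.congr' ?_
    filter_upwards [hmem] with δ hδ
    refine intervalIntegral.integral_interval_sub_left ?_ ?_
    · exact (hGc.mono (by
        rw [uIcc_of_le (by linarith [hδ.2])]
        exact Icc_subset_Icc_right (by linarith [hδ.1]))).intervalIntegrable
    · exact (hGc.mono (by
        rw [uIcc_of_le hδ.1.le]
        exact Icc_subset_Icc_right (by linarith [hδ.2]))).intervalIntegrable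
  have hlim2 : Tendsto (fun δ => ∫ s in a..b, (h s (1 - δ) - h s δ)) (𝓝[>] 0)
      (𝓝 (∫ s in a..b, (h s 1 - h s 0))) := by
    obtain ⟨B, hB⟩ := (isCompact_Icc.prod isCompact_Icc).exists_bound_of_continuousOn hh
    refine intervalIntegral.tendsto_integral_filter_of_dominated_convergence (fun _ => B + B)
      ?_ ?_ intervalIntegrable_const ?_
    · filter_upwards [hmem] with δ hδ
      rw [uIoc_of_le hab]
      refine ContinuousOn.aestronglyMeasurable ?_ measurableSet_Ioc
      exact (hh.comp (f := fun s : ℝ => (s, 1 - δ)) (by fun_prop) fun s hs =>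
          ⟨Ioc_subset_Icc_self hs, by linarith [hδ.2], by linarith [hδ.1]⟩).sub
        (hh.comp (f := fun s : ℝ => (s, δ)) (by fun_prop) fun s hs =>
          ⟨Ioc_subset_Icc_self hs, hδ.1.le, by linarith [hδ.2]⟩)
    · filter_upwards [hmem] with δ hδ
      refine Eventually.of_forall fun s hs => ?_
      rw [uIoc_of_le hab] at hs
      exact (norm_sub_le _ _).trans (add_le_add
        (hB (s, 1 - δ) ⟨Ioc_subset_Icc_self hs, by linarith [hδ.2], by linarith [hδ.1]⟩)
        (hB (s, δ) ⟨Ioc_subset_Icc_self hs, hδ.1.le, by linarith [hδ.2]⟩))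
    · refine Eventually.of_forall fun s hs => ?_
      rw [uIoc_of_le hab] at hs
      have hc := hslice hh s (Ioc_subset_Icc_self hs)
      exact ((hc 1 (by simp)).tendsto.comp hd1).sub ((hc 0 (by simp)).tendsto.comp hd0)
  have heq := tendsto_nhds_unique (hlim1.congr' (by
    filter_upwards [hmem] with δ hδ using inner δ hδ)) hlim2
  rw [← heq, intervalIntegral.integral_sub (hgi b (right_mem_Icc.2 hab))
    (hgi a (left_mem_Icc.2 hab))]

section green

variable {T L l₀ : ℝ} {y z fm fp U₀ : ℝ → ℝ} {U : ℝ → ℝ → ℝ}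

/-- Green's identity for a solution `U` and a solution `V` of the backward heat equation, with
`V' = ∂V/∂x` and `V'' = ∂²V/∂x²`. -/
lemma IsSolution.green (hU : IsSolution T y z fm fp U₀ U) (h : IsStrip T L l₀ y z)
    {a b τ : ℝ} (ha : 0 < a) (hab : a ≤ b) (hb : b < τ) (hτ : τ ≤ T) {V V' V'' : ℝ → ℝ → ℝ}
    (hVs : ∀ s < τ, ∀ x, HasDerivAt (fun s => V s x) (-V'' s x) s)
    (hVx : ∀ s < τ, ∀ x, HasDerivAt (V s) (V' s x) x)
    (hVxx : ∀ s < τ, ∀ x, HasDerivAt (V' s) (V'' s x) x)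
    (hV : ContinuousOn (fun q : ℝ × ℝ => V q.1 q.2) (Iio τ ×ˢ univ))
    (hV' : ContinuousOn (fun q : ℝ × ℝ => V' q.1 q.2) (Iio τ ×ˢ univ))
    (hV'' : ContinuousOn (fun q : ℝ × ℝ => V'' q.1 q.2) (Iio τ ×ˢ univ)) :
    (∫ x in (y b)..(z b), U b x * V b x) - ∫ x in (y a)..(z a), U a x * V a x =
      ∫ s in a..b, (((grad y z U s (z s) + fp s * deriv z s) * V s (z s) - fp s * V' s (z s)) +
        ((-grad y z U s (y s) - fm s * deriv y s) * V s (y s) + fm s * V' s (y s))) := by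
  have hI : Icc a b ⊆ Ioo 0 T := Icc_subset_Ioo ha (hb.trans_le hτ)
  have hIτ : Icc a b ⊆ Iio τ := fun s hs => hs.2.trans_lt hb
  have hyc : ContinuousOn y (Icc a b) :=
    h.lower.continuousOn.mono (hI.trans Ioo_subset_Icc_self)
  have hzc : ContinuousOn z (Icc a b) :=
    h.upper.continuousOn.mono (hI.trans Ioo_subset_Icc_self)
  have hyd : ContinuousOn (deriv y) (Icc a b) := h.lower.continuousOn_deriv.mono hI
  have hzd : ContinuousOn (deriv z) (Icc a b) := h.upper.continuousOn_deriv.mono hI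
  have hlt : ∀ s ∈ Icc a b, 0 < z s - y s := fun s hs =>
    sub_pos.2 (h.lt (Ioo_subset_Icc_self (hI hs)))
  -- The coordinate p ∈ [0, 1] straightens the moving strip into a rectangle; X' is the velocity of
  -- the point with coordinate p.
  set X : ℝ → ℝ → ℝ := fun s p => y s + p * (z s - y s) with hX
  set X' : ℝ → ℝ → ℝ := fun s p => deriv y s + p * (deriv z s - deriv y s) with hX'
  have comp1 : ∀ {k : ℝ → ℝ}, ContinuousOn k (Icc a b) → ∀ S : Set ℝ,
      ContinuousOn (fun q : ℝ × ℝ => k q.1) (Icc a b ×ˢ S) := fun hk S =>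
    hk.comp continuousOn_fst fun q hq => hq.1
  have hXc : ∀ S : Set ℝ, ContinuousOn (fun q : ℝ × ℝ => X q.1 q.2) (Icc a b ×ˢ S) := fun S =>
    (comp1 hyc S).add (continuousOn_snd.mul ((comp1 hzc S).sub (comp1 hyc S)))
  have hX'c : ∀ S : Set ℝ, ContinuousOn (fun q : ℝ × ℝ => X' q.1 q.2) (Icc a b ×ˢ S) := fun S =>
    (comp1 hyd S).add (continuousOn_snd.mul ((comp1 hzd S).sub (comp1 hyd S)))
  have hpair : ∀ S : Set ℝ, ContinuousOn (fun q : ℝ × ℝ => (q.1, X q.1 q.2)) (Icc a b ×ˢ S) :=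
    fun S => continuousOn_fst.prodMk (hXc S)
  have hmaps : MapsTo (fun q : ℝ × ℝ => (q.1, X q.1 q.2)) (Icc a b ×ˢ Icc 0 1) (strip T y z) := by
    rintro ⟨s, p⟩ ⟨hs, hp⟩
    have := hlt s hs
    exact ⟨Ioo_subset_Ioc_self (hI hs), by simp only [hX]; nlinarith [hp.1],
      by simp only [hX]; nlinarith [hp.2]⟩
  have hmaps' : MapsTo (fun q : ℝ × ℝ => (q.1, X q.1 q.2)) (Icc a b ×ˢ Ioo 0 1)
      (openStrip T y z) := by
    rintro ⟨s, p⟩ ⟨hs, hp⟩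
    have := hlt s hs
    exact ⟨hI hs, by simp only [hX]; nlinarith [hp.1], by simp only [hX]; nlinarith [hp.2]⟩
  have hmapsτ : ∀ S : Set ℝ, MapsTo (fun q : ℝ × ℝ => (q.1, X q.1 q.2)) (Icc a b ×ˢ S)
      (Iio τ ×ˢ univ) := fun S q hq => ⟨hIτ hq.1, mem_univ _⟩
  have hUc := hU.continuousOn.comp (hpair (Icc 0 1)) hmaps
  have hGc := hU.continuousOn_grad.comp (hpair (Icc 0 1)) hmaps
  have hUxxc := hU.continuousOn_deriv_deriv.comp (hpair (Ioo 0 1)) hmaps'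
  have hVc := fun S => hV.comp (hpair S) (hmapsτ S)
  have hV'c := fun S => hV'.comp (hpair S) (hmapsτ S)
  have hV''c := fun S => hV''.comp (hpair S) (hmapsτ S)
  have hs01 : Icc a b ×ˢ Ioo (0 : ℝ) 1 ⊆ Icc a b ×ˢ Icc 0 1 := prod_mono le_rfl Ioo_subset_Icc_self
  have hlc := fun S => (comp1 hzc S).sub (comp1 hyc S)
  have hl'c := fun S => (comp1 hzd S).sub (comp1 hyd S)
  -- The density is UV times the Jacobian z - y. The flux is U_x V - U V' plus the transport term UV
  -- X' due to the moving coordinates. Conservation reduces to (UV)_s = (U_x V - U V')_x, valid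
  -- because V solves the backward equation.
  have key := integral_sub_eq_of_conservation hab
    (g := fun s p => U s (X s p) * V s (X s p) * (z s - y s))
    (h := fun s p => (grad y z U s (X s p) * V s (X s p) - U s (X s p) * V' s (X s p))
      + U s (X s p) * V s (X s p) * X' s p)
    (D := fun s p => ((deriv (deriv (U s)) (X s p) * V s (X s p) - U s (X s p) * V'' s (X s p))
      + (grad y z U s (X s p) * V s (X s p) + U s (X s p) * V' s (X s p)) * X' s p) * (z s - y s)
      + U s (X s p) * V s (X s p) * (deriv z s - deriv y s))
    ((hUc.mul (hVc _)).mul (hlc _))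
    (((hGc.mul (hVc _)).sub (hUc.mul (hV'c _))).add ((hUc.mul (hVc _)).mul (hX'c _)))
    (((((hUxxc.mul (hVc _)).sub ((hUc.mono hs01).mul (hV''c _))).add
      ((((hGc.mono hs01).mul (hVc _)).add ((hUc.mono hs01).mul (hV'c _))).mul (hX'c _))).mul
      (hlc _)).add (((hUc.mono hs01).mul (hVc _)).mul (hl'c _)))
    ?_ ?_
  · have hsubst : ∀ s ∈ Icc a b, ∫ p in (0)..1, U s (X s p) * V s (X s p) * (z s - y s) =
        ∫ x in (y s)..(z s), U s x * V s x := by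
      intro s hs
      have h1 := intervalIntegral.integral_comp_mul_add (a := 0) (b := 1)
        (fun x => U s x * V s x) (hlt s hs).ne' (y s)
      simp only [mul_zero, zero_add, mul_one, sub_add_cancel, smul_eq_mul] at h1
      rw [intervalIntegral.integral_mul_const]
      have h2 : ∀ p, X s p = (z s - y s) * p + y s := fun p => by simp only [hX]; ring
      simp only [h2]
      rw [h1, mul_comm, mul_inv_cancel_left₀ (hlt s hs).ne']
    rw [hsubst b (right_mem_Icc.2 hab), hsubst a (left_mem_Icc.2 hab)] at key
    rw [key]
    refine intervalIntegral.integral_congr fun s hs => ?_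
    rw [uIcc_of_le hab] at hs
    have hsT := Ioo_subset_Ioc_self (hI hs)
    have h0 : X s 0 = y s := by simp [hX]
    have h1 : X s 1 = z s := by simp [hX]
    simp only [h0, h1, hU.boundary_lower s hsT, hU.boundary_upper s hsT]
    simp only [hX', one_mul, zero_mul]
    ring
  · intro s hs p hp
    have hos : (s, X s p) ∈ openStrip T y z := hmaps' (show (s, p) ∈ _ from ⟨hs, hp⟩)
    have hnhds := openStrip_mem_nhds h.lower.continuousOn h.upper.continuousOn hos
    have hnhdsτ : Iio τ ×ˢ (univ : Set ℝ) ∈ 𝓝 (s, X s p) :=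
      prod_mem_nhds (Iio_mem_nhds (hIτ hs)) univ_mem
    have hXd : HasDerivAt (fun s => X s p) (X' s p) s :=
      (h.lower.hasDerivAt s (hI hs)).add
        (((h.upper.hasDerivAt s (hI hs)).sub (h.lower.hasDerivAt s (hI hs))).const_mul p)
    have hcU := (hU.continuousOn.mono openStrip_subset_strip).continuousAt hnhds
    have hcG := (hU.continuousOn_grad.mono openStrip_subset_strip).continuousAt hnhds
    have hcUxx := hU.continuousOn_deriv_deriv.continuousAt hnhds
    have hF := hasDerivAt_comp_of_partials (F := fun s x => U s x * V s x)
      (F₁ := fun s x => deriv (deriv (U s)) x * V s x + U s x * -V'' s x)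
      (F₂ := fun s x => grad y z U s x * V s x + U s x * V' s x) (c := fun s => X s p)
      (by filter_upwards [hnhds, hnhdsτ] with q hq hq' using
        (hU.heat q hq).mul (hVs q.1 hq'.1 q.2))
      (by filter_upwards [hnhds, hnhdsτ] with q hq hq' using
        (hU.hasDerivAt (Ioo_subset_Ioc_self hq.1) hq.2).mul (hVx q.1 hq'.1 q.2))
      ((hcUxx.mul (hV.continuousAt hnhdsτ)).add (hcU.mul (hV''.continuousAt hnhdsτ).neg))
      ((hcG.mul (hV.continuousAt hnhdsτ)).add (hcU.mul (hV'.continuousAt hnhdsτ))) hXd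
    refine (hF.mul ((h.upper.hasDerivAt s (hI hs)).sub (h.lower.hasDerivAt s (hI hs)))).congr_deriv
      ?_
    simp only [Pi.sub_apply]
    ring
  · intro s hs p hp
    have hos : (s, X s p) ∈ openStrip T y z := hmaps' (show (s, p) ∈ _ from ⟨hs, hp⟩)
    have hsT := Ioo_subset_Ioc_self (hI hs)
    have hXd : HasDerivAt (fun p => X s p) (z s - y s) p := 
      (((hasDerivAt_id p).mul_const (z s - y s)).const_add (y s)).congr_deriv (one_mul _)
    have hX'd : HasDerivAt (fun p => X' s p) (deriv z s - deriv y s) p := 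
      (((hasDerivAt_id p).mul_const (deriv z s - deriv y s)).const_add (deriv y s)).congr_deriv
        (one_mul _)
    have hUd := (hU.hasDerivAt hsT hos.2).comp p hXd
    have hGd := (hU.hasDerivAt_grad (hI hs) hos.2).comp p hXd
    have hVd := (hVx s (hIτ hs) (X s p)).comp p hXd
    have hV'd := (hVxx s (hIτ hs) (X s p)).comp p hXd
    refine (((hGd.mul hVd).sub (hUd.mul hV'd)).add ((hUd.mul hVd).mul hX'd)).congr_deriv ?_
    simp only [Function.comp_apply, Pi.mul_apply]
    ring

end green

/-! ### Reflection `x ↦ -x` -/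

section reflection

variable {T L l₀ : ℝ} {y z fm fp U₀ : ℝ → ℝ} {U : ℝ → ℝ → ℝ}

lemma grad_reflect (y z : ℝ → ℝ) (U : ℝ → ℝ → ℝ) (s x : ℝ) :
    grad (fun s => -z s) (fun s => -y s) (fun s x => U s (-x)) s x = -grad y z U s (-x) := by
  rw [grad, derivWithin_comp_neg, neg_Icc, neg_neg, neg_neg, grad]

/-- Reflection exchanges the two boundaries and their data, so only the lower boundary needs a
direct argument. -/
lemma IsSolution.reflect (hU : IsSolution T y z fm fp U₀ U) :
    IsSolution T (fun s => -z s) (fun s => -y s) fp fm (fun x => U₀ (-x)) (fun s x => U s (-x)) := by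
  have hd : ∀ s, deriv (fun x => U s (-x)) = fun x => -deriv (U s) (-x) := fun s =>
    funext fun x => deriv_comp_neg (U s) x
  have hdd : ∀ s x, deriv (deriv (fun x => U s (-x))) x = deriv (deriv (U s)) (-x) := fun s x => by
    rw [hd, deriv.fun_neg, deriv_comp_neg (deriv (U s)), neg_neg]
  have hIcc : ∀ {s x : ℝ}, x ∈ Icc (-z s) (-y s) → -x ∈ Icc (y s) (z s) := fun hx =>
    ⟨le_neg_of_le_neg hx.2, neg_le.1 hx.1⟩
  have hIoo : ∀ {s x : ℝ}, x ∈ Ioo (-z s) (-y s) → -x ∈ Ioo (y s) (z s) := fun hx =>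
    ⟨lt_neg_of_lt_neg hx.2, neg_lt.1 hx.1⟩
  have hc : Continuous fun p : ℝ × ℝ => (p.1, -p.2) := by fun_prop
  have hmap : MapsTo (fun p : ℝ × ℝ => (p.1, -p.2)) (strip T (fun s => -z s) (fun s => -y s))
      (strip T y z) := fun p hp => ⟨hp.1, hIcc hp.2⟩
  have hmap' : MapsTo (fun p : ℝ × ℝ => (p.1, -p.2)) (openStrip T (fun s => -z s) (fun s => -y s))
      (openStrip T y z) := fun p hp => ⟨hp.1, hIoo hp.2⟩
  refine ⟨?_, hU.continuousOn.comp hc.continuousOn hmap, fun s hs => ?_, ?_, fun p hp => ?_,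
    ?_, fun p hp => ?_, fun x hx => ?_, fun s hs => ?_, fun s hs => ?_⟩
  · obtain ⟨M, hM⟩ := hU.bounded
    exact ⟨M, fun p hp => hM _ (hmap hp)⟩
  · exact (hU.differentiableOn s hs).comp differentiable_neg.differentiableOn fun x hx => hIcc hx
  · exact (hU.continuousOn_grad.comp hc.continuousOn hmap).neg.congr fun p _ =>
      grad_reflect y z U p.1 p.2
  · rw [hd]
    exact ((hU.differentiableAt_deriv _ (hmap' hp)).comp p.2 differentiable_neg.differentiableAt).neg
  · exact (hU.continuousOn_deriv_deriv.comp hc.continuousOn hmap').congr fun p _ => hdd _ _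
  · rw [hdd]
    exact hU.heat _ (hmap' hp)
  · exact hU.initial (-x) (hIoo hx)
  · simpa using hU.boundary_upper s hs
  · simpa using hU.boundary_lower s hs

lemma IsSolution.exists_abs_grad_upper_le (hU : IsSolution T y z fm fp U₀ U)
    (h : IsStrip T L l₀ y z) (hfp : IsC1With T L fp) :
    ∃ C, 0 ≤ C ∧ ∀ σ ∈ Ioc 0 T, |grad y z U σ (z σ)| ≤ C / √σ := by
  obtain ⟨C, hC, H⟩ := hU.reflect.exists_abs_grad_lower_le h.neg hfp
  refine ⟨C, hC, fun σ hσ => ?_⟩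
  have := H σ hσ
  rwa [grad_reflect, neg_neg, abs_neg] at this

end reflection

/-! ### Integrability on `(0, τ)` -/

/-- The integrable weight `1 / √s + 1 / √(τ - s)`. -/
noncomputable def sqrtWeight (τ s : ℝ) : ℝ := 1 / √s + 1 / √(τ - s)

lemma sqrtWeight_nonneg (τ s : ℝ) : 0 ≤ sqrtWeight τ s := by
  unfold sqrtWeight
  positivity

lemma intervalIntegrable_sqrtWeight (τ : ℝ) : IntervalIntegrable (sqrtWeight τ) volume 0 τ := by
  have h : ∀ a b : ℝ, IntervalIntegrable (fun s : ℝ => 1 / √s) volume a b := fun a b => by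
    have := intervalIntegral.intervalIntegrable_rpow' (a := a) (b := b) (r := -(1 / 2))
      (by norm_num)
    refine (this.norm).mono_fun'
      (measurable_const.div continuous_sqrt.measurable).aestronglyMeasurable ?_
    refine ae_of_all _ fun s => ?_
    rcases le_or_gt s 0 with hs | hs
    -- For s ≤ 0 the weight is 1/0 = 0 by convention.
    · simp [sqrt_eq_zero_of_nonpos hs]
    · dsimp only
      rw [rpow_neg hs.le, ← sqrt_eq_rpow, one_div]
  have h2 := (h τ 0).comp_sub_left τ
  rw [sub_self, sub_zero] at h2
  exact (h 0 τ).add h2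

lemma div_sqrt_le_sqrtWeight {A τ s : ℝ} (hA : 0 ≤ A) :
    A / √s ≤ A * sqrtWeight τ s ∧ A / √(τ - s) ≤ A * sqrtWeight τ s := by
  simp only [sqrtWeight, mul_add, mul_one_div]
  constructor
  · linarith [div_nonneg hA (sqrt_nonneg (τ - s))]
  · linarith [div_nonneg hA (sqrt_nonneg s)]

lemma one_le_sqrtWeight {τ s : ℝ} (hs : s ∈ Ioo 0 τ) : 1 ≤ √τ * sqrtWeight τ s := by
  have h0 : 0 < √s := sqrt_pos.2 hs.1
  have h1 : √s ≤ √τ := sqrt_le_sqrt hs.2.le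
  have h2 : 1 ≤ √τ / √s := (one_le_div h0).2 h1
  exact h2.trans (div_sqrt_le_sqrtWeight (sqrt_nonneg τ)).1

/-- Needed where a boundary gradient, singular at 0, meets a kernel singular at τ. The sum √s + √(τ
- s) times the left side is the weight, and this sum is at least √τ. -/
lemma one_div_sqrt_mul_le {τ s : ℝ} (hs : s ∈ Ioo 0 τ) :
    1 / √s * (1 / √(τ - s)) ≤ 1 / √τ * sqrtWeight τ s := by
  have h0 : 0 < √s := sqrt_pos.2 hs.1
  have h1 : 0 < √(τ - s) := sqrt_pos.2 (sub_pos.2 hs.2)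
  have h2 : 0 < √τ := sqrt_pos.2 (hs.1.trans hs.2)
  have h3 : √τ ≤ √s + √(τ - s) := by
    rw [sqrt_le_left (by positivity)]
    nlinarith [sq_sqrt hs.1.le, sq_sqrt (sub_pos.2 hs.2).le]
  have h4 : 1 / √τ * sqrtWeight τ s = (√s + √(τ - s)) / √τ * (1 / √s * (1 / √(τ - s))) := by
    unfold sqrtWeight
    field_simp
    ring
  rw [h4]
  exact le_mul_of_one_le_left (by positivity) ((one_le_div h2).2 h3)

lemma ae_restrict_uIoc_of_Ioo {τ : ℝ} {p : ℝ → Prop} (hτ : 0 < τ) (hp : ∀ s ∈ Ioo 0 τ, p s) :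
    ∀ᵐ s ∂volume.restrict (uIoc 0 τ), p s := by
  rw [uIoc_of_le hτ.le, ← restrict_Ioo_eq_restrict_Ioc]
  exact (ae_restrict_iff' measurableSet_Ioo).2 (ae_of_all _ hp)

lemma aestronglyMeasurable_uIoc {τ : ℝ} {g : ℝ → ℝ} (hτ : 0 < τ) (hg : ContinuousOn g (Ioo 0 τ)) :
    AEStronglyMeasurable g (volume.restrict (uIoc 0 τ)) := by
  rw [uIoc_of_le hτ.le, ← restrict_Ioo_eq_restrict_Ioc]
  exact hg.aestronglyMeasurable measurableSet_Ioo

lemma intervalIntegrable_of_le_sqrtWeight {τ A : ℝ} {g : ℝ → ℝ} (hτ : 0 < τ)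
    (hg : ContinuousOn g (Ioo 0 τ)) (hA : ∀ s ∈ Ioo 0 τ, |g s| ≤ A * sqrtWeight τ s) :
    IntervalIntegrable g volume 0 τ :=
  ((intervalIntegrable_sqrtWeight τ).const_mul A).mono_fun' (aestronglyMeasurable_uIoc hτ hg)
    (ae_restrict_uIoc_of_Ioo hτ hA)

/-- The fundamental theorem of calculus on `(0, τ)` for an integral function with limits at the
end points. -/
lemma sub_eq_integral_of_tendsto {τ J₀ J₁ : ℝ} {G J : ℝ → ℝ} (hτ : 0 < τ)
    (hG : IntervalIntegrable G volume 0 τ)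
    (h : ∀ a b, 0 < a → a ≤ b → b < τ → J b - J a = ∫ s in a..b, G s)
    (h₀ : Tendsto J (𝓝[>] 0) (𝓝 J₀)) (h₁ : Tendsto J (𝓝[<] τ) (𝓝 J₁)) :
    J₁ - J₀ = ∫ s in (0)..τ, G s := by
  set P : ℝ → ℝ := fun x => ∫ s in (0)..x, G s with hP
  have hPc : ContinuousOn P (Icc 0 τ) := by
    have := intervalIntegral.continuousOn_primitive_interval (a := 0) (b := τ) (μ := volume)
      (f := G) (by
        rw [uIcc_of_le hτ.le]
        exact (intervalIntegrable_iff_integrableOn_Icc_of_le hτ.le).1 hG)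
    rwa [uIcc_of_le hτ.le] at this
  have hsub : ∀ a b, 0 < a → a ≤ b → b < τ → J b - P b = J a - P a := by
    intro a b ha hab hb
    have h1 : ∀ x ∈ Icc 0 τ, IntervalIntegrable G volume 0 x := fun x hx =>
      hG.mono_set (by rw [uIcc_of_le hx.1, uIcc_of_le hτ.le]; exact Icc_subset_Icc_right hx.2)
    have h2 : P b - P a = ∫ s in a..b, G s := intervalIntegral.integral_interval_sub_left
      (h1 b ⟨by linarith, hb.le⟩) (h1 a ⟨ha.le, by linarith⟩)
    linarith [h a b ha hab hb]
  -- J minus the primitive of G is constant on the open interval; comparing its limits at the two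
  -- ends gives the claim.
  have hconst : ∀ x ∈ Ioo 0 τ, J x - P x = J (τ / 2) - P (τ / 2) := by
    intro x hx
    rcases le_total x (τ / 2) with hx2 | hx2
    · exact (hsub x (τ / 2) hx.1 hx2 (by linarith)).symm
    · exact hsub (τ / 2) x (by linarith) hx2 hx.2
  have hP0 : Tendsto P (𝓝[>] 0) (𝓝 0) := by
    have := (hPc 0 (left_mem_Icc.2 hτ.le)).mono_left
      (nhdsWithin_le_of_mem (mem_of_superset (Ioo_mem_nhdsGT hτ) Ioo_subset_Icc_self))
    simpa [hP] using this
  have hP1 : Tendsto P (𝓝[<] τ) (𝓝 (P τ)) :=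
    (hPc τ (right_mem_Icc.2 hτ.le)).mono_left
      (nhdsWithin_le_of_mem (mem_of_superset (Ioo_mem_nhdsLT hτ) Ioo_subset_Icc_self))
  have e0 := tendsto_nhds_unique ((h₀.sub hP0).congr' (by
    filter_upwards [Ioo_mem_nhdsGT hτ] with x hx using hconst x hx)) tendsto_const_nhds
  have e1 := tendsto_nhds_unique ((h₁.sub hP1).congr' (by
    filter_upwards [Ioo_mem_nhdsLT hτ] with x hx using hconst x hx)) tendsto_const_nhds
  linarith

/-! ### Limit of the space integrals as s → 0 -/

section initialLimit

variable {T L l₀ : ℝ} {y z fm fp U₀ : ℝ → ℝ} {U : ℝ → ℝ → ℝ}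

/-- The slice `U s`, extended by zero. -/
noncomputable def slice (y z : ℝ → ℝ) (U : ℝ → ℝ → ℝ) (s : ℝ) : ℝ → ℝ :=
  (Ioo (y s) (z s)).indicator (U s)

lemma integral_slice_mul {s : ℝ} (hs : y s < z s) (g : ℝ → ℝ) :
    ∫ x in (y s)..(z s), U s x * g x = ∫ x, slice y z U s x * g x := by
  rw [intervalIntegral.integral_of_le hs.le, integral_Ioc_eq_integral_Ioo,
    ← integral_indicator measurableSet_Ioo]
  congr 1
  ext x
  by_cases hx : x ∈ Ioo (y s) (z s) <;> simp [slice, hx]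

lemma IsStrip.Icc_subset (h : IsStrip T L l₀ y z) {s : ℝ} (hs : s ∈ Icc 0 T) :
    Icc (y s) (z s) ⊆ Icc (-L) L :=
  Icc_subset_Icc (neg_le_of_abs_le (h.lower.abs_le s hs)) (le_of_abs_le (h.upper.abs_le s hs))

namespace IsSolution

lemma continuousOn_slice (hU : IsSolution T y z fm fp U₀ U) {s : ℝ} (hs : s ∈ Ioc 0 T) :
    ContinuousOn (U s) (Icc (y s) (z s)) :=
  (hU.differentiableOn s hs).continuousOn

lemma measurable_slice (hU : IsSolution T y z fm fp U₀ U) {s : ℝ} (hs : s ∈ Ioc 0 T) :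
    AEStronglyMeasurable (slice y z U s) volume :=
  (aestronglyMeasurable_indicator_iff measurableSet_Ioo).2
    (((hU.continuousOn_slice hs).mono Ioo_subset_Icc_self).aestronglyMeasurable measurableSet_Ioo)

lemma abs_slice_le (h : IsStrip T L l₀ y z) {M : ℝ} (hM : ∀ p ∈ strip T y z, |U p.1 p.2| ≤ M)
    {s : ℝ} (hs : s ∈ Ioc 0 T) (x : ℝ) :
    |slice y z U s x| ≤ (Icc (-L) L).indicator (fun _ => |M|) x := by
  have hs' := Ioc_subset_Icc_self hs
  by_cases hx : x ∈ Ioo (y s) (z s)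
  · have hx' := Ioo_subset_Icc_self hx
    rw [slice, indicator_of_mem hx, indicator_of_mem (h.Icc_subset hs' hx')]
    exact (hM (s, x) ⟨hs, hx'⟩).trans (le_abs_self M)
  · rw [slice, indicator_of_notMem hx, abs_zero]
    exact indicator_nonneg (fun _ _ => abs_nonneg M) x

/-- Any x other than y(0) and z(0) lies, for small s, in the strip exactly when it does at s = 0. At
the two corners no limit is known, whence the null set. -/
lemma tendsto_slice (hU : IsSolution T y z fm fp U₀ U) (h : IsStrip T L l₀ y z) (hT : 0 < T) :
    ∀ᵐ x, Tendsto (fun s => slice y z U s x) (𝓝[>] 0) (𝓝 (slice y z U 0 x)) := by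
  have hmem : Icc 0 T ∈ 𝓝[>] (0 : ℝ) := mem_of_superset (Ioo_mem_nhdsGT hT) Ioo_subset_Icc_self
  have h0 : (0 : ℝ) ∈ Icc 0 T := left_mem_Icc.2 hT.le
  have hy : Tendsto y (𝓝[>] 0) (𝓝 (y 0)) :=
    (h.lower.continuousOn 0 h0).mono_left (nhdsWithin_le_of_mem hmem)
  have hz : Tendsto z (𝓝[>] 0) (𝓝 (z 0)) :=
    (h.upper.continuousOn 0 h0).mono_left (nhdsWithin_le_of_mem hmem)
  have hne : ∀ᵐ x : ℝ, x ∉ ({y 0, z 0} : Set ℝ) :=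
    measure_eq_zero_iff_ae_notMem.1 ((toFinite _).measure_zero _)
  filter_upwards [hne] with x hx
  simp only [mem_insert_iff, mem_singleton_iff, not_or] at hx
  by_cases hx0 : x ∈ Ioo (y 0) (z 0)
  · rw [slice, indicator_of_mem hx0]
    refine ((hU.initial x hx0).2.mono_left (nhdsWithin_mono _ Ioi_subset_Ici_self)).congr' ?_
    filter_upwards [hy.eventually_lt_const hx0.1, hz.eventually_const_lt hx0.2] with s h1 h2
    rw [slice, indicator_of_mem (show x ∈ Ioo (y s) (z s) from ⟨h1, h2⟩)]
  · rw [slice, indicator_of_notMem hx0]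
    refine tendsto_const_nhds.congr' ?_
    rcases lt_or_ge x (y 0) with h1 | h1
    · filter_upwards [hy.eventually_const_lt h1] with s hs
      rw [slice, indicator_of_notMem fun hm => lt_asymm hm.1 hs]
    · have h2 : z 0 < x := lt_of_le_of_ne
        (not_lt.1 fun h3 => hx0 ⟨lt_of_le_of_ne h1 (Ne.symm hx.1), h3⟩) (Ne.symm hx.2)
      filter_upwards [hz.eventually_lt_const h2] with s hs
      rw [slice, indicator_of_notMem fun hm => lt_asymm hm.2 hs]

/-- The initial value is not assumed measurable. Its extension by zero is an almost everywhere limit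
of the uniformly bounded measurable slices at times T/(n + 1), hence integrable. -/
lemma intervalIntegrable_initial (hU : IsSolution T y z fm fp U₀ U) (h : IsStrip T L l₀ y z)
    (hT : 0 < T) : IntervalIntegrable (U 0) volume (y 0) (z 0) := by
  have h0 : (0 : ℝ) ∈ Icc 0 T := left_mem_Icc.2 hT.le
  obtain ⟨M, hM⟩ := hU.bounded
  have hseq : Tendsto (fun n : ℕ => T / (n + 1)) atTop (𝓝[>] 0) := by
    refine tendsto_nhdsWithin_iff.2 ⟨?_, Eventually.of_forall fun n => ?_⟩
    · simpa only [mul_one_div, mul_zero] using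
        (tendsto_one_div_add_atTop_nhds_zero_nat (𝕜 := ℝ)).const_mul T
    · exact div_pos hT (by positivity)
  have hseqm : ∀ n : ℕ, T / (n + 1) ∈ Ioc 0 T := fun n =>
    ⟨by positivity, div_le_self hT.le (by linarith [(Nat.cast_nonneg n : (0 : ℝ) ≤ n)])⟩
  have hlim := hU.tendsto_slice h hT
  have hmeas : AEStronglyMeasurable (slice y z U 0) volume :=
    aestronglyMeasurable_of_tendsto_ae atTop (fun n => hU.measurable_slice (hseqm n))
      (hlim.mono fun x hx => hx.comp hseq)
  have hbd : Integrable ((Icc (-L) L).indicator fun _ : ℝ => |M|) volume :=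
    (integrable_indicator_iff measurableSet_Icc).2 continuousOn_const.integrableOn_Icc
  have hint : Integrable (slice y z U 0) volume := by
    refine hbd.mono' hmeas (hlim.mono fun x hx => ?_)
    exact le_of_tendsto (hx.comp hseq).norm
      (Eventually.of_forall fun n => abs_slice_le h hM (hseqm n) x)
  rw [intervalIntegrable_iff_integrableOn_Ioo_of_le (h.lt h0).le]
  exact (integrable_indicator_iff measurableSet_Ioo).1 hint

/-- Extending the slices by zero removes the moving limits of integration, so dominated convergence
applies on the fixed interval [-L, L]; V is bounded there because s stays below τ/2. -/
lemma tendsto_integral_initial (hU : IsSolution T y z fm fp U₀ U) (h : IsStrip T L l₀ y z)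
    {τ : ℝ} (hτ : τ ∈ Ioc 0 T) {V : ℝ → ℝ → ℝ}
    (hV : ContinuousOn (fun q : ℝ × ℝ => V q.1 q.2) (Iio τ ×ˢ univ)) :
    Tendsto (fun s => ∫ x in (y s)..(z s), U s x * V s x) (𝓝[>] 0)
      (𝓝 (∫ x in (y 0)..(z 0), U 0 x * V 0 x)) := by
  have hT : 0 < T := hτ.1.trans_le hτ.2
  have h0 : (0 : ℝ) ∈ Icc 0 T := left_mem_Icc.2 hT.le
  obtain ⟨M, hM⟩ := hU.bounded
  have hmem : Ioo 0 (τ / 2) ∈ 𝓝[>] (0 : ℝ) := Ioo_mem_nhdsGT (half_pos hτ.1)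
  have hmemT : ∀ s ∈ Ioo 0 (τ / 2), s ∈ Ioc 0 T := fun s hs =>
    ⟨hs.1, by linarith [hs.2, hτ.2, hτ.1]⟩
  have hVs : ∀ s < τ, Continuous (V s) := fun s hs =>
    continuousOn_univ.1 (hV.comp (f := fun x : ℝ => (s, x)) (by fun_prop)
      fun x _ => ⟨hs, mem_univ _⟩)
  obtain ⟨B, hB⟩ := (isCompact_Icc.prod isCompact_Icc).exists_bound_of_continuousOn
    (hV.mono (prod_mono (fun s hs => lt_of_le_of_lt hs.2 (half_lt_self hτ.1)) (subset_univ _) :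
      Icc 0 (τ / 2) ×ˢ Icc (-L) L ⊆ _))
  rw [integral_slice_mul (h.lt h0)]
  have : Tendsto (fun s => ∫ x, slice y z U s x * V s x) (𝓝[>] 0)
      (𝓝 (∫ x, slice y z U 0 x * V 0 x)) := by
    refine tendsto_integral_filter_of_dominated_convergence
      ((Icc (-L) L).indicator fun _ => |M| * |B|) ?_ ?_
      ((integrable_indicator_iff measurableSet_Icc).2 continuousOn_const.integrableOn_Icc) ?_
    · filter_upwards [hmem] with s hs
      exact (hU.measurable_slice (hmemT s hs)).mul
        (hVs s (by linarith [hs.2, hτ.1])).aestronglyMeasurable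
    · filter_upwards [hmem] with s hs
      refine ae_of_all _ fun x => ?_
      rw [norm_mul]
      have h1 := abs_slice_le h hM (hmemT s hs) x
      by_cases hx : x ∈ Icc (-L) L
      · rw [indicator_of_mem hx] at h1 ⊢
        exact mul_le_mul h1 ((hB (s, x) ⟨Ioo_subset_Icc_self hs, hx⟩).trans (le_abs_self B))
          (norm_nonneg _) (abs_nonneg M)
      · rw [indicator_of_notMem hx] at h1 ⊢
        rw [show slice y z U s x = 0 from abs_nonpos_iff.1 h1]
        simp
    · filter_upwards [hU.tendsto_slice h hT] with x hx
      refine hx.mul ?_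
      have h1 : ContinuousAt (fun q : ℝ × ℝ => V q.1 q.2) (0, x) :=
        hV.continuousAt (prod_mem_nhds (Iio_mem_nhds hτ.1) univ_mem)
      have h2 : Tendsto (fun s : ℝ => (s, x)) (𝓝[>] 0) (𝓝 (0, x)) :=
        (Continuous.tendsto (by fun_prop) (0 : ℝ)).mono_left nhdsWithin_le_nhds
      exact h1.tendsto.comp h2
  refine this.congr' ?_
  filter_upwards [hmem] with s hs
  exact (integral_slice_mul (h.lt (Ioc_subset_Icc_self (hmemT s hs))) (V s)).symm

end IsSolution

end initialLimit

/-! ### Limit of the space integrals as s → τ -/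

section terminalLimit

variable {T L l₀ τ : ℝ} {y z fm fp U₀ : ℝ → ℝ} {U : ℝ → ℝ → ℝ}

lemma shift_zero (y z : ℝ → ℝ) (τ ξ : ℝ) : shift y z ((0 : ℤ) : ℝ) τ ξ = y τ - ξ := by
  simp [shift]

namespace IsSolution

/-- The kernel is O(√(τ - s)) uniformly over the strip, while U and the width are bounded. -/
lemma tendsto_integral_dipole (hU : IsSolution T y z fm fp U₀ U) (h : IsStrip T L l₀ y z)
    (hτ : τ ∈ Ioc 0 T) {n : ℤ} (hn : n ≠ 0) :
    Tendsto (fun s => ∫ x in (y s)..(z s), U s x * dipole (shift y z n τ x) (τ - s)) (𝓝[<] τ)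
      (𝓝 0) := by
  obtain ⟨M, hM⟩ := hU.bounded
  obtain ⟨C, hC, H⟩ := exists_image_bound h
  have hL := h.lower.nonneg
  refine tendsto_zero_of_abs_le_sqrt (C := |M| * C * weight n * (2 * L)) hτ.1 fun s hs => ?_
  have hsT : s ∈ Icc 0 T := ⟨hs.1.le, hs.2.le.trans hτ.2⟩
  have hlt := h.lt hsT
  have h1 := intervalIntegral.norm_integral_le_of_norm_le_const
    (a := y s) (b := z s) (f := fun x => U s x * dipole (shift y z n τ x) (τ - s))
    (C := |M| * (C * √(τ - s) * weight n)) fun x hx => ?_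
  · refine h1.trans ?_
    have h2 : |z s - y s| ≤ 2 * L := by
      have h3 := abs_le.1 (h.upper.abs_le s hsT)
      have h4 := abs_le.1 (h.lower.abs_le s hsT)
      rw [abs_le]
      constructor <;> linarith
    calc |M| * (C * √(τ - s) * weight n) * |z s - y s|
        ≤ |M| * (C * √(τ - s) * weight n) * (2 * L) := by
          have := weight_nonneg n
          gcongr
      _ = _ := by ring
  · rw [uIoc_of_le hlt.le] at hx
    have hx' := Ioc_subset_Icc_self hx
    rw [norm_mul]
    exact mul_le_mul ((hM (s, x) ⟨⟨hs.1, hsT.2⟩, hx'⟩).trans (le_abs_self M))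
      (H τ hτ s ⟨hs.1.le, hs.2⟩ n _ (le_abs_shift_of_mem h (Ioc_subset_Icc_self hτ) hsT hs.2.le hn
        hx')).1 (norm_nonneg _) (abs_nonneg M)

/-- Compactness after straightening the strip; a > 0 is needed because the gradient may be unbounded
near time 0. -/
lemma exists_abs_grad_le (hU : IsSolution T y z fm fp U₀ U) (h : IsStrip T L l₀ y z) {a : ℝ}
    (ha : 0 < a) : ∃ B, ∀ s ∈ Icc a T, ∀ x ∈ Icc (y s) (z s), |grad y z U s x| ≤ B := by
  have hI : Icc a T ⊆ Icc 0 T := Icc_subset_Icc_left ha.le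
  have comp1 : ∀ {k : ℝ → ℝ}, ContinuousOn k (Icc 0 T) →
      ContinuousOn (fun q : ℝ × ℝ => k q.1) (Icc a T ×ˢ Icc 0 1) := fun hk =>
    hk.comp continuousOn_fst fun q hq => hI hq.1
  have hc : ContinuousOn (fun q : ℝ × ℝ => (q.1, y q.1 + q.2 * (z q.1 - y q.1)))
      (Icc a T ×ˢ Icc 0 1) :=
    continuousOn_fst.prodMk ((comp1 h.lower.continuousOn).add
      (continuousOn_snd.mul ((comp1 h.upper.continuousOn).sub (comp1 h.lower.continuousOn))))
  obtain ⟨B, hB⟩ := (isCompact_Icc.prod isCompact_Icc).exists_bound_of_continuousOn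
    (hU.continuousOn_grad.comp hc (by
      rintro ⟨s, p⟩ ⟨hs, hp⟩
      have := sub_pos.2 (h.lt (hI hs))
      exact ⟨⟨ha.trans_le hs.1, hs.2⟩, by dsimp only; nlinarith [hp.1],
        by dsimp only; nlinarith [hp.2]⟩))
  refine ⟨B, fun s hs x hx => ?_⟩
  have hl := sub_pos.2 (h.lt (hI hs))
  have := hB (s, (x - y s) / (z s - y s)) ⟨hs, div_nonneg (sub_nonneg.2 hx.1) hl.le,
    (div_le_one hl).2 (by linarith [hx.2])⟩
  simpa [div_mul_cancel₀ _ hl.ne'] using this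

lemma continuousOn_grad_slice (hU : IsSolution T y z fm fp U₀ U) {s : ℝ} (hs : s ∈ Ioc 0 T) :
    ContinuousOn (grad y z U s) (Icc (y s) (z s)) :=
  hU.continuousOn_grad.comp (f := fun x : ℝ => (s, x)) (by fun_prop) fun _ hx => ⟨hs, hx⟩

/-- The monopole potential of the gradient tends to the boundary gradient. -/
lemma tendsto_integral_grad_mul_monopole (hU : IsSolution T y z fm fp U₀ U)
    (h : IsStrip T L l₀ y z) (hτ : τ ∈ Ioc 0 T) :
    Tendsto (fun s => ∫ x in (y s)..(z s), grad y z U s x * monopole (y τ - x) (τ - s)) (𝓝[<] τ)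
      (𝓝 (grad y z U τ (y τ))) := by
  obtain ⟨B, hB⟩ := hU.exists_abs_grad_le h (half_pos hτ.1)
  have hτ' := Ioc_subset_Icc_self hτ
  set G := grad y z U τ (y τ)
  -- Diffusive rescaling around y(τ): in the variable w the kernel becomes the fixed Gaussian 2/√π ·
  -- exp(-w²).
  set X : ℝ → ℝ → ℝ := fun s w => y τ + 2 * √(τ - s) * w with hX
  have hmem : Ioo (τ / 2) τ ∈ 𝓝[<] τ := Ioo_mem_nhdsLT (half_lt_self hτ.1)
  have hmemT : ∀ s ∈ Ioo (τ / 2) τ, s ∈ Icc (τ / 2) T := fun s hs =>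
    ⟨hs.1.le, hs.2.le.trans hτ.2⟩
  have hIoc : ∀ s ∈ Ioo (τ / 2) τ, s ∈ Ioc 0 T := fun s hs =>
    ⟨(half_pos hτ.1).trans hs.1, hs.2.le.trans hτ.2⟩
  have hsqrt : Tendsto (fun s => √(τ - s)) (𝓝[<] τ) (𝓝 0) := by
    have h1 : ContinuousAt (fun s => √(τ - s)) τ := by fun_prop
    simpa using h1.tendsto.mono_left (nhdsWithin_le_nhds (s := Iio τ))
  have hXc : ∀ s, Continuous (X s) := fun s => by fun_prop
  have hsubst : ∀ s ∈ Ioo (τ / 2) τ,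
      ∫ x in (y s)..(z s), grad y z U s x * monopole (y τ - x) (τ - s) =
        ∫ w, slice y z (grad y z U) s (X s w) * (2 / √π * exp (-w ^ 2)) := by
    intro s hs
    have ht := sub_pos.2 hs.2
    have ht' : 0 < √(τ - s) := sqrt_pos.2 ht
    rw [integral_slice_mul (h.lt (Ioc_subset_Icc_self (hIoc s hs))),
      ← integral_add_left_eq_self _ (y τ)]
    have h1 := Measure.integral_comp_mul_left
      (fun x => slice y z (grad y z U) s (y τ + x) * monopole (y τ - (y τ + x)) (τ - s))
      (2 * √(τ - s))
    rw [abs_of_pos (by positivity), smul_eq_mul, eq_inv_mul_iff_mul_eq₀ (by positivity)] at h1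
    rw [← h1, ← integral_const_mul]
    refine integral_congr_ae (ae_of_all _ fun w => ?_)
    have h2 : monopole (y τ - (y τ + 2 * √(τ - s) * w)) (τ - s) =
        1 / (√π * √(τ - s)) * exp (-w ^ 2) := by
      have h3 : -(y τ - (y τ + 2 * √(τ - s) * w)) ^ 2 / (4 * (τ - s)) = -w ^ 2 := by
        rw [show -(y τ - (y τ + 2 * √(τ - s) * w)) ^ 2 = -(4 * √(τ - s) ^ 2 * w ^ 2) by ring,
          sq_sqrt ht.le]
        field_simp
      rw [monopole, h3, sqrt_mul pi_pos.le]
    dsimp only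
    rw [h2]
    have := sqrt_pos.2 pi_pos
    field_simp
    rfl
  -- The rescaled density has mass 1 on the half line: the kernel is twice the heat kernel, and half
  -- of it is used.
  have hlimval : ∫ w, (Ioi (0 : ℝ)).indicator (fun w => G * (2 / √π * exp (-w ^ 2))) w = G := by
    rw [integral_indicator measurableSet_Ioi, integral_const_mul, integral_const_mul]
    have h1 := integral_gaussian_Ioi 1
    simp only [neg_mul, one_mul, div_one] at h1
    have := sqrt_pos.2 pi_pos
    rw [h1]
    field_simp
  have hpt : ∀ w ≠ 0, Tendsto (fun s => slice y z (grad y z U) s (X s w)) (𝓝[<] τ)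
      (𝓝 ((Ioi (0 : ℝ)).indicator (fun _ => G) w)) := by
    intro w hw
    -- The boundary moves by O(τ - s), which is negligible on the scale √(τ - s). In the variable w
    -- the rescaled strip therefore fills exactly w > 0 in the limit.
    have hLw : ∀ ε > 0, ∀ᶠ s in 𝓝[<] τ, |y τ - y s| < 2 * √(τ - s) * ε := by
      intro ε hε
      filter_upwards [hmem, (hsqrt.const_mul L).eventually_lt_const
        (by simpa using hε : L * 0 < ε)] with s hs h2
      have ht' : 0 < √(τ - s) := sqrt_pos.2 (sub_pos.2 hs.2)
      calc |y τ - y s| ≤ L * (τ - s) := abs_increment_le h.lower hτ ⟨(hIoc s hs).1.le, hs.2⟩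
        _ = L * √(τ - s) * √(τ - s) := by rw [mul_assoc, mul_self_sqrt (sub_pos.2 hs.2).le]
        _ < ε * √(τ - s) := by gcongr
        _ ≤ 2 * √(τ - s) * ε := by nlinarith
    rcases lt_or_gt_of_ne hw with h0 | h0
    · rw [indicator_of_notMem (by simpa using h0.le)]
      refine tendsto_const_nhds.congr' ?_
      filter_upwards [hLw (-w) (by linarith)] with s hs
      rw [slice, indicator_of_notMem]
      intro hm
      have := hm.1
      simp only [hX] at this
      linarith [le_abs_self (y τ - y s)]
    · rw [indicator_of_mem (show w ∈ Ioi 0 from h0)]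
      have hXlim : Tendsto (fun s => X s w) (𝓝[<] τ) (𝓝 (y τ)) := by
        have := ((hsqrt.const_mul 2).mul_const w).const_add (y τ)
        simpa [hX] using this
      have hzlim : Tendsto z (𝓝[<] τ) (𝓝 (z τ)) :=
        (h.upper.continuousOn τ hτ').mono_left (nhdsWithin_le_of_mem
          (mem_of_superset hmem fun s hs => Ioc_subset_Icc_self (hIoc s hs)))
      have hin : ∀ᶠ s in 𝓝[<] τ, X s w ∈ Ioo (y s) (z s) := by
        filter_upwards [hLw w h0, hXlim.eventually_lt hzlim (h.lt hτ')] with s h1 h2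
        refine ⟨?_, h2⟩
        simp only [hX]
        linarith [neg_abs_le (y τ - y s)]
      have hw : Tendsto (fun s => (s, X s w)) (𝓝[<] τ) (𝓝[strip T y z] (τ, y τ)) := by
        refine tendsto_nhdsWithin_iff.2 ⟨(tendsto_id.mono_left nhdsWithin_le_nhds).prodMk_nhds hXlim,
          ?_⟩
        filter_upwards [hmem, hin] with s hs h1 using ⟨hIoc s hs, Ioo_subset_Icc_self h1⟩
      have h3 := (hU.continuousOn_grad (τ, y τ) ⟨hτ, left_mem_Icc.2 (h.lt hτ').le⟩).tendsto.comp hw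
      refine h3.congr' ?_
      filter_upwards [hin] with s hs
      rw [slice, indicator_of_mem hs]
      rfl
  have hgauss : Integrable (fun w : ℝ => exp (-w ^ 2)) volume := by
    simpa using integrable_exp_neg_mul_sq (b := 1) one_pos
  have hmain : Tendsto (fun s => ∫ w, slice y z (grad y z U) s (X s w) * (2 / √π * exp (-w ^ 2)))
      (𝓝[<] τ)
      (𝓝 (∫ w, (Ioi (0 : ℝ)).indicator (fun w => G * (2 / √π * exp (-w ^ 2))) w)) := by
    refine tendsto_integral_filter_of_dominated_convergence
      (fun w => |B| * (2 / √π * exp (-w ^ 2))) ?_ ?_ ((hgauss.const_mul _).const_mul _) ?_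
    · filter_upwards [hmem] with s hs
      refine AEStronglyMeasurable.mul ?_ (by fun_prop)
      have hm : MeasurableSet (X s ⁻¹' Ioo (y s) (z s)) :=
        measurableSet_Ioo.preimage (hXc s).measurable
      exact (aestronglyMeasurable_indicator_iff (f := grad y z U s ∘ X s) hm).2
        ((((hU.continuousOn_grad_slice (hIoc s hs)).mono Ioo_subset_Icc_self).comp
          (hXc s).continuousOn (mapsTo_preimage _ _)).aestronglyMeasurable hm)
    · filter_upwards [hmem] with s hs
      refine ae_of_all _ fun w => ?_
      rw [norm_mul, norm_of_nonneg (by positivity : 0 ≤ 2 / √π * exp (-w ^ 2))]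
      gcongr
      by_cases hx : X s w ∈ Ioo (y s) (z s)
      · rw [slice, indicator_of_mem hx]
        exact (hB s (hmemT s hs) _ (Ioo_subset_Icc_self hx)).trans (le_abs_self B)
      · rw [slice, indicator_of_notMem hx, norm_zero]
        exact abs_nonneg B
    · have hne : ∀ᵐ w : ℝ, w ≠ 0 := by simp [ae_iff]
      filter_upwards [hne] with w hw
      have h1 := (hpt w hw).mul_const (2 / √π * exp (-w ^ 2))
      by_cases h0 : w ∈ Ioi (0 : ℝ)
      · simpa only [indicator_of_mem h0] using h1
      · simpa only [indicator_of_notMem h0, zero_mul] using h1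
  rw [hlimval] at hmain
  refine hmain.congr' ?_
  filter_upwards [hmem] with s hs using (hsubst s hs).symm

/-- Integration by parts with -monopole(y(τ) - x) as primitive of the dipole: the derivative passes
to U, and the singularity as s → τ is confined to the boundary term at y(s). -/
lemma integral_mul_dipole (hU : IsSolution T y z fm fp U₀ U) (h : IsStrip T L l₀ y z) {s : ℝ}
    (hs : s ∈ Ioc 0 T) (hsτ : s < τ) :
    ∫ x in (y s)..(z s), U s x * dipole (y τ - x) (τ - s) =
      fm s * monopole (y τ - y s) (τ - s) - fp s * monopole (y τ - z s) (τ - s) +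
        ∫ x in (y s)..(z s), grad y z U s x * monopole (y τ - x) (τ - s) := by
  have ht := sub_pos.2 hsτ
  have hlt := h.lt (Ioc_subset_Icc_self hs)
  have hd : ∀ x, HasDerivAt (fun x => -monopole (y τ - x) (τ - s)) (dipole (y τ - x) (τ - s)) x := by
    intro x
    refine ((hasDerivAt_monopole ht).comp x ((hasDerivAt_id x).const_sub (y τ))).neg.congr_deriv ?_
    simp only [id]
    ring
  have hdc : Continuous fun x => dipole (y τ - x) (τ - s) := by
    have := continuousOn_dipole.comp (f := fun x : ℝ => (y τ - x, τ - s)) (s := univ)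
      (by fun_prop) fun x _ => ht
    exact continuousOn_univ.1 this
  have := intervalIntegral.integral_mul_deriv_eq_deriv_mul_of_hasDerivAt (a := y s) (b := z s)
    (u := U s) (u' := grad y z U s)
    (by rw [uIcc_of_le hlt.le]; exact hU.continuousOn_slice hs)
    (fun x _ => (hd x).continuousAt.continuousWithinAt)
    (fun x hx => by
      rw [min_eq_left hlt.le, max_eq_right hlt.le] at hx
      exact hU.hasDerivAt hs hx)
    (fun x _ => hd x)
    (ContinuousOn.intervalIntegrable (by
      rw [uIcc_of_le hlt.le]
      exact hU.continuousOn_grad_slice hs))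
    (hdc.intervalIntegrable _ _)
  rw [this, hU.boundary_lower s hs, hU.boundary_upper s hs]
  simp only [mul_neg, intervalIntegral.integral_neg]
  ring

/-- After integration by parts the boundary term f⁻(s)·monopole differs from f⁻(τ)/√(π(τ - s)) by
O(√(τ - s)), the term at the upper boundary vanishes, and the remaining integral tends to the
boundary gradient. -/
lemma tendsto_integral_dipole_zero (hU : IsSolution T y z fm fp U₀ U) (h : IsStrip T L l₀ y z)
    (hfm : IsC1With T L fm) (hfp : IsC1With T L fp) (hτ : τ ∈ Ioc 0 T) :
    Tendsto (fun s => (∫ x in (y s)..(z s), U s x * dipole (y τ - x) (τ - s)) -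
      fm τ / √(π * (τ - s))) (𝓝[<] τ) (𝓝 (grad y z U τ (y τ))) := by
  have hL := h.lower.nonneg
  obtain ⟨C, hC, H⟩ := exists_image_bound h
  have h1 : Tendsto (fun s => fm s * monopole (y τ - y s) (τ - s) - fm τ / √(π * (τ - s)))
      (𝓝[<] τ) (𝓝 0) := by
    refine tendsto_zero_of_abs_le_sqrt (C := L + L * L ^ 2) hτ.1 fun s hs => ?_
    have hs' : s ∈ Ico 0 τ := ⟨hs.1.le, hs.2⟩
    have ht := sub_pos.2 hs.2
    have ht' : 0 < √(τ - s) := sqrt_pos.2 ht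
    have hle : √(τ - s) ≤ √(π * (τ - s)) := sqrt_le_sqrt (by nlinarith [pi_gt_three])
    have e : fm s * monopole (y τ - y s) (τ - s) - fm τ / √(π * (τ - s)) =
        (-(fm τ - fm s) + fm s * (exp (-(y τ - y s) ^ 2 / (4 * (τ - s))) - 1)) /
          √(π * (τ - s)) := by
      rw [monopole]
      ring
    rw [e, abs_div, abs_of_nonneg (sqrt_nonneg (π * (τ - s))), div_le_iff₀ (ht'.trans_le hle)]
    have h2 := abs_increment_le hfm hτ hs'
    have h3 := abs_exp_sub_one_le h.lower hτ hs'
    have h4 := hfm.abs_le s ⟨hs.1.le, hs.2.le.trans hτ.2⟩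
    calc _ ≤ L * (τ - s) + L * (L ^ 2 * (τ - s)) := by
          refine (abs_add_le _ _).trans ?_
          rw [abs_neg, abs_mul]
          gcongr
      _ = (L + L * L ^ 2) * √(τ - s) * √(τ - s) := by
          rw [mul_assoc, mul_self_sqrt ht.le]
          ring
      _ ≤ _ := by gcongr
  -- The image bound applies with n = 0 because z(s) is at distance at least l₀ - L(τ - s) from
  -- y(τ).
  have h2 : Tendsto (fun s => fp s * monopole (y τ - z s) (τ - s)) (𝓝[<] τ) (𝓝 0) := by
    refine tendsto_zero_of_abs_le_sqrt (C := L * (C * weight 0)) hτ.1 fun s hs => ?_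
    have hsT : s ∈ Icc 0 T := ⟨hs.1.le, hs.2.le.trans hτ.2⟩
    have h3 := (H τ hτ s ⟨hs.1.le, hs.2⟩ 0 _
      (le_abs_shift_upper h (Ioc_subset_Icc_self hτ) hsT hs.2.le 0)).2.2
    rw [shift_zero] at h3
    rw [abs_mul]
    calc _ ≤ L * (C * √(τ - s) * weight 0) := by
          have := hfp.abs_le s hsT
          gcongr
      _ = _ := by ring
  have h3 := (h1.sub h2).add (hU.tendsto_integral_grad_mul_monopole h hτ)
  rw [sub_zero, zero_add] at h3
  refine h3.congr' ?_
  filter_upwards [Ioo_mem_nhdsLT hτ.1] with s hs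
  rw [hU.integral_mul_dipole h ⟨hs.1, hs.2.le.trans hτ.2⟩ hs.2]
  ring

end IsSolution

end terminalLimit

/-! ### Boundary fluxes against the images and their integrability -/

section flux

variable {T L l₀ τ : ℝ} {y z fm fp U₀ Ψ Φ : ℝ → ℝ} {U : ℝ → ℝ → ℝ}

/-- The flux through the upper boundary against the `n`-th image. -/
noncomputable def upperFlux (y z fp Φ : ℝ → ℝ) (τ : ℝ) (n : ℤ) (s : ℝ) : ℝ :=
  (Φ s + fp s * deriv z s) * upsilonTerm y z n τ (z s) s - fp s * lambdaTerm y z n τ (z s) s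

/-- The flux through the lower boundary against the `n`-th image. -/
noncomputable def lowerFlux (y z fm Ψ : ℝ → ℝ) (τ : ℝ) (n : ℤ) (s : ℝ) : ℝ :=
  (Ψ s - fm s * deriv y s) * upsilonTerm y z n τ (y s) s + fm s * lambdaTerm y z n τ (y s) s

lemma hasDerivAt_shift (y z : ℝ → ℝ) (ν τ x : ℝ) :
    HasDerivAt (fun x => shift y z ν τ x) (-1) x :=
  ((hasDerivAt_id x).const_sub (y τ)).add_const _

lemma continuousOn_kernel {k : ℝ → ℝ → ℝ} {b : ℝ → ℝ} {S : Set ℝ}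
    (hk : ContinuousOn (fun p : ℝ × ℝ => k p.1 p.2) {p | 0 < p.2}) (hb : ContinuousOn b S)
    (hS : S ⊆ Iio τ) (ν : ℝ) :
    ContinuousOn (fun s => k (shift y z ν τ (b s)) (τ - s)) S :=
  hk.comp (f := fun s => (shift y z ν τ (b s), τ - s))
    (((continuousOn_const.sub hb).add continuousOn_const).prodMk (by fun_prop))
    fun s hs => show 0 < τ - s from sub_pos.2 (hS hs)

/-- Green's identity with the n-th dipole as test function; it is stated on [a, b] inside (0, τ),
away from both singular times. -/
lemma IsSolution.green_image (hU : IsSolution T y z fm fp U₀ U) (h : IsStrip T L l₀ y z)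
    (hΨ : ∀ τ ∈ Ioc 0 T, Ψ τ = -grad y z U τ (y τ)) (hΦ : ∀ τ ∈ Ioc 0 T, Φ τ = grad y z U τ (z τ))
    (hτ : τ ∈ Ioc 0 T) (n : ℤ) {a b : ℝ} (ha : 0 < a) (hab : a ≤ b) (hb : b < τ) :
    (∫ x in (y b)..(z b), U b x * dipole (shift y z n τ x) (τ - b)) -
      ∫ x in (y a)..(z a), U a x * dipole (shift y z n τ x) (τ - a) =
      ∫ s in a..b, (upperFlux y z fp Φ τ n s + lowerFlux y z fm Ψ τ n s) := by
  have hX : ∀ k : ℝ → ℝ → ℝ, ContinuousOn (fun p : ℝ × ℝ => k p.1 p.2) {p | 0 < p.2} →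
      ContinuousOn (fun q : ℝ × ℝ => k (shift y z n τ q.2) (τ - q.1)) (Iio τ ×ˢ univ) :=
    fun k hk => hk.comp (f := fun q : ℝ × ℝ => (shift y z n τ q.2, τ - q.1))
      (by unfold shift; fun_prop) fun q hq =>
        show 0 < τ - q.1 from sub_pos.2 hq.1
  have key := hU.green h ha hab hb hτ.2 (V := fun s x => dipole (shift y z n τ x) (τ - s))
    (V' := fun s x => dipoleDeriv (shift y z n τ x) (τ - s))
    (V'' := fun s x => dipoleDeriv₂ (shift y z n τ x) (τ - s))
    (fun s hs x => ((hasDerivAt_dipole_time (sub_pos.2 hs)).comp s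
      ((hasDerivAt_id s).const_sub τ)).congr_deriv (by ring))
    (fun s hs x => ((hasDerivAt_dipole (sub_pos.2 hs)).comp x
      (hasDerivAt_shift y z n τ x)).congr_deriv (by ring))
    (fun s hs x => ((hasDerivAt_dipoleDeriv (sub_pos.2 hs)).comp x
      (hasDerivAt_shift y z n τ x)).congr_deriv (by ring))
    (hX _ continuousOn_dipole) (hX _ continuousOn_dipoleDeriv) (hX _ continuousOn_dipoleDeriv₂)
  rw [key]
  refine intervalIntegral.integral_congr fun s hs => ?_
  rw [uIcc_of_le hab] at hs
  have hsT : s ∈ Ioc 0 T := ⟨ha.trans_le hs.1, hs.2.trans (hb.le.trans hτ.2)⟩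
  simp only [upperFlux, lowerFlux, hΨ s hsT, hΦ s hsT, upsilonTerm_eq, lambdaTerm_eq]

/-- Isolates the only nonintegrable part of all the fluxes, f⁻(τ)/(2√(π(τ - s)³)). Its primitive
f⁻(τ)/√(π(τ - s)) is the divergent term in `IsSolution.tendsto_integral_dipole_zero`. -/
lemma lowerFlux_zero (y z fm Ψ : ℝ → ℝ) (τ s : ℝ) :
    lowerFlux y z fm Ψ τ 0 s = -(Ψ s * gradKernel y τ s) + rebateKernel fm y τ s +
      fm τ * (1 / (2 * √(π * (τ - s) ^ 3))) := by
  rw [lowerFlux, upsilonTerm, lambdaTerm, shift_zero, gradKernel, rebateKernel]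
  ring

lemma integral_one_div_sqrt_cube {a b : ℝ} (hab : a ≤ b) (hb : b < τ) :
    ∫ s in a..b, 1 / (2 * √(π * (τ - s) ^ 3)) = 1 / √(π * (τ - b)) - 1 / √(π * (τ - a)) := by
  have hlt : ∀ s ∈ uIcc a b, 0 < τ - s := fun s hs => by
    rw [uIcc_of_le hab] at hs
    linarith [hs.2]
  refine intervalIntegral.integral_eq_sub_of_hasDerivAt (f := fun s => 1 / √(π * (τ - s)))
    (fun s hs => ?_) ?_
  · exact ((hasDerivAt_inv_sqrt_pi_mul (hlt s hs)).comp s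
      ((hasDerivAt_id s).const_sub τ)).congr_deriv (by ring)
  · refine ContinuousOn.intervalIntegrable (ContinuousOn.div (by fun_prop) (by fun_prop) ?_)
    intro s hs
    have := hlt s hs
    positivity

section regularity

variable (hU : IsSolution T y z fm fp U₀ U) (h : IsStrip T L l₀ y z)

lemma IsC1With.continuousOn_Ioo {b : ℝ → ℝ} (hb : IsC1With T L b) (hτ : τ ∈ Ioc 0 T) :
    ContinuousOn b (Ioo 0 τ) ∧ ContinuousOn (deriv b) (Ioo 0 τ) :=
  ⟨hb.continuousOn.mono fun _ hs => ⟨hs.1.le, hs.2.le.trans hτ.2⟩,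
    hb.continuousOn_deriv.mono fun _ hs => ⟨hs.1, hs.2.trans_le hτ.2⟩⟩

lemma continuousOn_gradKernel {b : ℝ → ℝ} (hb : IsC1With T L b) (hτ : τ ∈ Ioc 0 T) :
    ContinuousOn (gradKernel b τ) (Ioo 0 τ) := by
  have h1 := (hb.continuousOn_Ioo hτ).1
  unfold gradKernel
  refine ContinuousOn.mul (ContinuousOn.div (by fun_prop) (by fun_prop) ?_)
    (ContinuousOn.rexp (ContinuousOn.div (by fun_prop) (by fun_prop) ?_)) <;>
  · intro s hs
    have := sub_pos.2 hs.2
    positivity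

lemma continuousOn_incrementKernel {f : ℝ → ℝ} (hf : IsC1With T L f) (hτ : τ ∈ Ioc 0 T) :
    ContinuousOn (incrementKernel f τ) (Ioo 0 τ) := by
  have h1 := (hf.continuousOn_Ioo hτ).1
  unfold incrementKernel
  refine ContinuousOn.div (by fun_prop) (by fun_prop) ?_
  intro s hs
  have := sub_pos.2 hs.2
  positivity

lemma continuousOn_rebateKernel {f b : ℝ → ℝ} (hf : IsC1With T L f) (hb : IsC1With T L b)
    (hτ : τ ∈ Ioc 0 T) : ContinuousOn (rebateKernel f b τ) (Ioo 0 τ) := by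
  have h1 := (hf.continuousOn_Ioo hτ).1
  obtain ⟨h2, h3⟩ := hb.continuousOn_Ioo hτ
  unfold rebateKernel
  refine ContinuousOn.div (ContinuousOn.sub (ContinuousOn.mul (ContinuousOn.mul h1
    (ContinuousOn.rexp (ContinuousOn.div (by fun_prop) (by fun_prop) ?_)))
    (ContinuousOn.sub (by fun_prop) (ContinuousOn.div (by fun_prop) (by fun_prop) ?_)))
    (by fun_prop)) (by fun_prop) ?_ <;>
  · intro s hs
    have := sub_pos.2 hs.2
    positivity

lemma intervalIntegrable_rebateKernel {f b : ℝ → ℝ} (hf : IsC1With T L f) (hb : IsC1With T L b)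
    (hτ : τ ∈ Ioc 0 T) : IntervalIntegrable (rebateKernel f b τ) volume 0 τ := by
  have hL := hf.nonneg
  exact intervalIntegrable_of_le_sqrtWeight hτ.1 (continuousOn_rebateKernel hf hb hτ) fun s hs =>
    (abs_rebateKernel_le hf hb hτ hs).trans
      (div_sqrt_le_sqrtWeight (by positivity : 0 ≤ L + 3 * L ^ 3)).2

lemma intervalIntegrable_incrementKernel {f : ℝ → ℝ} (hf : IsC1With T L f) (hτ : τ ∈ Ioc 0 T) :
    IntervalIntegrable (incrementKernel f τ) volume 0 τ :=
  intervalIntegrable_of_le_sqrtWeight hτ.1 (continuousOn_incrementKernel hf hτ) fun _ hs =>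
    (abs_incrementKernel_le hf hτ ⟨hs.1.le, hs.2⟩).trans (div_sqrt_le_sqrtWeight hf.nonneg).2

/-- A boundary gradient: continuous on `(0, T]`, with an inverse square root singularity at `0`. -/
structure IsGradient (T C : ℝ) (g : ℝ → ℝ) : Prop where
  continuousOn : ContinuousOn g (Ioc 0 T)
  abs_le : ∀ s ∈ Ioc 0 T, |g s| ≤ C / √s
  nonneg : 0 ≤ C

include hU h in
lemma exists_isGradient (hfm : IsC1With T L fm) (hfp : IsC1With T L fp)
    (hΨ : ∀ τ ∈ Ioc 0 T, Ψ τ = -grad y z U τ (y τ))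
    (hΦ : ∀ τ ∈ Ioc 0 T, Φ τ = grad y z U τ (z τ)) :
    ∃ C, IsGradient T C Ψ ∧ IsGradient T C Φ := by
  obtain ⟨C₁, hC₁, H₁⟩ := hU.exists_abs_grad_lower_le h hfm
  obtain ⟨C₂, hC₂, H₂⟩ := hU.exists_abs_grad_upper_le h hfp
  have hcont : ∀ b : ℝ → ℝ, ContinuousOn b (Icc 0 T) → (∀ s ∈ Ioc 0 T, b s ∈ Icc (y s) (z s)) →
      ContinuousOn (fun s => grad y z U s (b s)) (Ioc 0 T) := fun b hb hm =>
    hU.continuousOn_grad.comp (f := fun s => (s, b s))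
      (continuousOn_id.prodMk (hb.mono Ioc_subset_Icc_self)) fun s hs => ⟨hs, hm s hs⟩
  have hle : ∀ s ∈ Ioc 0 T, y s ≤ z s := fun s hs => (h.lt (Ioc_subset_Icc_self hs)).le
  refine ⟨max C₁ C₂, ⟨?_, fun s hs => ?_, hC₁.trans (le_max_left _ _)⟩, ⟨?_, fun s hs => ?_,
    hC₁.trans (le_max_left _ _)⟩⟩
  · exact ((hcont y h.lower.continuousOn fun s hs => left_mem_Icc.2 (hle s hs)).neg).congr hΨ
  · rw [hΨ s hs, abs_neg]
    refine (H₁ s hs).trans ?_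
    gcongr
    exact le_max_left _ _
  · exact (hcont z h.upper.continuousOn fun s hs => right_mem_Icc.2 (hle s hs)).congr hΦ
  · rw [hΦ s hs]
    refine (H₂ s hs).trans ?_
    gcongr
    exact le_max_right _ _

variable {C : ℝ} {g : ℝ → ℝ}

lemma IsGradient.continuousOn_Ioo (hg : IsGradient T C g) (hτ : τ ∈ Ioc 0 T) :
    ContinuousOn g (Ioo 0 τ) :=
  hg.continuousOn.mono fun _ hs => ⟨hs.1, hs.2.le.trans hτ.2⟩

/-- The gradient is O(1/√s) and the kernel O(1/√(τ - s)); the singularities sit at opposite ends. -/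
lemma intervalIntegrable_mul_gradKernel {b : ℝ → ℝ} (hg : IsGradient T C g)
    (hb : IsC1With T L b) (hτ : τ ∈ Ioc 0 T) :
    IntervalIntegrable (fun s => g s * gradKernel b τ s) volume 0 τ := by
  refine intervalIntegrable_of_le_sqrtWeight (A := C * L * (1 / √τ)) hτ.1
    ((hg.continuousOn_Ioo hτ).mul (continuousOn_gradKernel hb hτ)) fun s hs => ?_
  have h1 := hg.abs_le s ⟨hs.1, hs.2.le.trans hτ.2⟩
  have h2 := abs_gradKernel_le hb hτ ⟨hs.1.le, hs.2⟩
  have hC := hg.nonneg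
  have hL := hb.nonneg
  rw [abs_mul]
  calc |g s| * |gradKernel b τ s| ≤ C / √s * (L / √(τ - s)) := by gcongr
    _ = C * L * (1 / √s * (1 / √(τ - s))) := by ring
    _ ≤ C * L * (1 / √τ * sqrtWeight τ s) := 
      mul_le_mul_of_nonneg_left (one_div_sqrt_mul_le hs) (mul_nonneg hC hL)
    _ = _ := by ring

/-- `g + f b'` for a boundary gradient `g` and data `f`, `b`. -/
lemma IsGradient.abs_add_mul_deriv_le {f b : ℝ → ℝ} (hg : IsGradient T C g) (hf : IsC1With T L f)
    (hb : IsC1With T L b) (hτ : τ ∈ Ioc 0 T) {s : ℝ} (hs : s ∈ Ioo 0 τ) :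
    |g s + f s * deriv b s| ≤ (C + L ^ 2 * √τ) * sqrtWeight τ s ∧
    |g s - f s * deriv b s| ≤ (C + L ^ 2 * √τ) * sqrtWeight τ s ∧
    |f s| ≤ (L * √τ) * sqrtWeight τ s := by
  have hsT : s ∈ Ioc 0 T := ⟨hs.1, hs.2.le.trans hτ.2⟩
  have hL := hf.nonneg
  have h1 := (hg.abs_le s hsT).trans (div_sqrt_le_sqrtWeight (τ := τ) hg.nonneg).1
  have h2 := hf.abs_le s (Ioc_subset_Icc_self hsT)
  have h3 := hb.abs_deriv_le s ⟨hs.1, hs.2.trans_le hτ.2⟩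
  have h4 := one_le_sqrtWeight hs
  have h5 : |f s * deriv b s| ≤ L ^ 2 * √τ * sqrtWeight τ s := by
    rw [abs_mul]
    calc |f s| * |deriv b s| ≤ L * L := by gcongr
      _ ≤ L * L * (√τ * sqrtWeight τ s) := le_mul_of_one_le_right (by positivity) h4
      _ = _ := by ring
  refine ⟨?_, ?_, ?_⟩
  · rw [add_mul]
    exact (abs_add_le _ _).trans (add_le_add h1 h5)
  · rw [add_mul]
    exact (abs_sub _ _).trans (add_le_add h1 h5)
  · rw [mul_assoc]
    exact h2.trans (le_mul_of_one_le_right hL h4)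

end regularity

end flux

/-! ### Summation over images and the Volterra equation at the lower boundary -/

section volterra

variable {T L l₀ τ C : ℝ} {y z fm fp U₀ Ψ Φ : ℝ → ℝ} {U : ℝ → ℝ → ℝ}

/-- The bound √(τ - s) ≤ √τ makes the image bounds a uniform majorant on (0, τ), so the sums of
continuous terms are continuous. -/
lemma continuousOn_image_sums (h : IsStrip T L l₀ y z) (hτ : τ ∈ Ioc 0 T) {k : ℝ → ℝ → ℝ} {K : ℝ}
    (hk : ContinuousOn (fun p : ℝ × ℝ => k p.1 p.2) {p | 0 < p.2}) (hK : 0 ≤ K)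
    (hb : ∀ s ∈ Ico 0 τ, ∀ n : ℤ, ∀ X, l₀ / 2 * (1 + |(n : ℝ)|) - L * (τ - s) ≤ |X| →
      |k X (τ - s)| ≤ K * √(τ - s) * weight n) :
    ContinuousOn (fun s => ∑' n : ℤ, k (shift y z n τ (z s)) (τ - s)) (Ioo 0 τ) ∧
    ContinuousOn (fun s => ∑' n : {n : ℤ // n ≠ 0}, k (shift y z (n : ℤ) τ (y s)) (τ - s))
      (Ioo 0 τ) := by
  have hτ' := Ioc_subset_Icc_self hτ
  have hsT : ∀ s ∈ Ioo 0 τ, s ∈ Icc 0 T := fun s hs => ⟨hs.1.le, hs.2.le.trans hτ.2⟩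
  have hle : ∀ s ∈ Ioo 0 τ, ∀ n : ℤ, K * √(τ - s) * weight n ≤ K * √τ * weight n := fun s hs n => by
    have := weight_nonneg n
    gcongr
    linarith [hs.1]
  constructor
  · refine continuousOn_tsum (u := fun n => K * √τ * weight n)
      (fun n => continuousOn_kernel hk (h.upper.continuousOn_Ioo hτ).1 (fun s hs => hs.2) n)
      (summable_weight.mul_left _) fun n s hs => ?_
    exact (hb s ⟨hs.1.le, hs.2⟩ n _ (le_abs_shift_upper h hτ' (hsT s hs) hs.2.le n)).trans
      (hle s hs n)
  · refine continuousOn_tsum (u := fun n : {n : ℤ // n ≠ 0} => K * √τ * weight n)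
      (fun n => continuousOn_kernel hk (h.lower.continuousOn_Ioo hτ).1 (fun s hs => hs.2) (n : ℤ))
      ((summable_weight.mul_left _).subtype _) fun n s hs => ?_
    exact (hb s ⟨hs.1.le, hs.2⟩ n _ (le_abs_shift_lower h hτ' (hsT s hs) hs.2.le n.2)).trans
      (hle s hs n)

/-- A continuous and bounded kernel on `(0, τ)`. -/
def IsRegular (τ : ℝ) (k : ℝ → ℝ) : Prop :=
  ContinuousOn k (Ioo 0 τ) ∧ ∃ K, ∀ s ∈ Ioo 0 τ, |k s| ≤ K

lemma isRegular_of_le_sqrt {k : ℝ → ℝ} {K : ℝ} (hK : 0 ≤ K) (hk : ContinuousOn k (Ioo 0 τ))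
    (hb : ∀ s ∈ Ioo 0 τ, |k s| ≤ K * √(τ - s)) : IsRegular τ k := by
  refine ⟨hk, K * √τ, fun s hs => (hb s hs).trans ?_⟩
  gcongr
  linarith [hs.1]

lemma IsRegular.intervalIntegrable_mul {k p : ℝ → ℝ} {P : ℝ} (hk : IsRegular τ k) (hτ : 0 < τ)
    (hp : ContinuousOn p (Ioo 0 τ)) (hP : ∀ s ∈ Ioo 0 τ, |p s| ≤ P * sqrtWeight τ s) :
    IntervalIntegrable (fun s => p s * k s) volume 0 τ := by
  obtain ⟨hk, K, hK⟩ := hk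
  refine intervalIntegrable_of_le_sqrtWeight (A := P * K) hτ (hp.mul hk) fun s hs => ?_
  rw [abs_mul]
  calc |p s| * |k s| ≤ P * sqrtWeight τ s * K :=
        mul_le_mul (hP s hs) (hK s hs) (abs_nonneg _) ((abs_nonneg _).trans (hP s hs))
    _ = _ := by ring

lemma isRegular_kernels (h : IsStrip T L l₀ y z) (hτ : τ ∈ Ioc 0 T) :
    (IsRegular τ (fun s => upsilonMinus y z τ (z s) s) ∧ IsRegular τ (upsilonMinus₀ y z τ)) ∧
    (IsRegular τ (fun s => lambdaMinus y z τ (z s) s) ∧ IsRegular τ (lambdaMinus₀ y z τ)) := by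
  obtain ⟨K, hK, H⟩ := exists_regular_bound h
  obtain ⟨K', hK', H'⟩ := exists_image_bound h
  have c1 := continuousOn_image_sums h hτ continuousOn_dipole hK'
    fun s hs n X hX => (H' τ hτ s hs n X hX).1
  have c2 := continuousOn_image_sums h hτ continuousOn_dipoleDeriv hK'
    fun s hs n X hX => (H' τ hτ s hs n X hX).2.1
  exact ⟨⟨isRegular_of_le_sqrt hK c1.1 fun s hs => (H τ hτ s hs).1.1,
    isRegular_of_le_sqrt hK c1.2 fun s hs => (H τ hτ s hs).1.2.1⟩,
    ⟨isRegular_of_le_sqrt hK c2.1 fun s hs => (H τ hτ s hs).2.1.1,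
    isRegular_of_le_sqrt hK c2.2 fun s hs => (H τ hτ s hs).2.1.2.1⟩⟩

/-- The fluxes decay in the image index. -/
lemma exists_flux_bound (h : IsStrip T L l₀ y z) (hfm : IsC1With T L fm) (hfp : IsC1With T L fp)
    (hΨ : IsGradient T C Ψ) (hΦ : IsGradient T C Φ) (hτ : τ ∈ Ioc 0 T) :
    ∃ K, 0 ≤ K ∧ ∀ s ∈ Ioo 0 τ, ∀ n : ℤ,
      |upperFlux y z fp Φ τ n s| ≤ K * weight n * sqrtWeight τ s ∧
      (n ≠ 0 → |lowerFlux y z fm Ψ τ n s| ≤ K * weight n * sqrtWeight τ s) := by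
  obtain ⟨K, hK, H⟩ := exists_image_bound h
  have hL := h.lower.nonneg
  have hC := hΨ.nonneg
  have hτ' := Ioc_subset_Icc_self hτ
  refine ⟨(C + L ^ 2 * √τ + L * √τ) * (K * √τ), by positivity, fun s hs n => ?_⟩
  have hsT : s ∈ Icc 0 T := ⟨hs.1.le, hs.2.le.trans hτ.2⟩
  have hs' : s ∈ Ico 0 τ := ⟨hs.1.le, hs.2⟩
  have hw := weight_nonneg n
  have hW := sqrtWeight_nonneg τ s
  have hle : K * √(τ - s) * weight n ≤ K * √τ * weight n := by
    gcongr
    linarith [hs.1]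
  have key : ∀ p q d e : ℝ, |p| ≤ (C + L ^ 2 * √τ) * sqrtWeight τ s → |q| ≤ L * √τ * sqrtWeight τ s →
      |d| ≤ K * √(τ - s) * weight n → |e| ≤ K * √(τ - s) * weight n →
      |p * d| + |q * e| ≤ (C + L ^ 2 * √τ + L * √τ) * (K * √τ) * weight n * sqrtWeight τ s := by
    intro p q d e hp hq hd he
    rw [abs_mul, abs_mul]
    calc |p| * |d| + |q| * |e| ≤ (C + L ^ 2 * √τ) * sqrtWeight τ s * (K * √τ * weight n) +
          L * √τ * sqrtWeight τ s * (K * √τ * weight n) := by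
          have := hd.trans hle
          have := he.trans hle
          gcongr
      _ = _ := by ring
  constructor
  · obtain ⟨h1, -, h2⟩ := hΦ.abs_add_mul_deriv_le hfp h.upper hτ hs
    have h3 := H τ hτ s hs' n _ (le_abs_shift_upper h hτ' hsT hs.2.le n)
    exact (abs_sub _ _).trans (key _ _ _ _ h1 h2 h3.1 h3.2.1)
  · intro hn
    obtain ⟨-, h1, h2⟩ := hΨ.abs_add_mul_deriv_le hfm h.lower hτ hs
    have h3 := H τ hτ s hs' n _ (le_abs_shift_lower h hτ' hsT hs.2.le hn)
    exact (abs_add_le _ _).trans (key _ _ _ _ h1 h2 h3.1 h3.2.1)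

lemma continuousOn_upperFlux (h : IsStrip T L l₀ y z) (hfp : IsC1With T L fp)
    (hΦ : IsGradient T C Φ) (hτ : τ ∈ Ioc 0 T) (n : ℤ) :
    ContinuousOn (upperFlux y z fp Φ τ n) (Ioo 0 τ) := by
  have hz := h.upper.continuousOn_Ioo hτ
  have hf := (hfp.continuousOn_Ioo hτ).1
  exact (((hΦ.continuousOn_Ioo hτ).add (hf.mul hz.2)).mul
    (continuousOn_kernel continuousOn_dipole hz.1 (fun s hs => hs.2) n)).sub
    (hf.mul (continuousOn_kernel continuousOn_dipoleDeriv hz.1 (fun s hs => hs.2) n))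

lemma continuousOn_lowerFlux (h : IsStrip T L l₀ y z) (hfm : IsC1With T L fm)
    (hΨ : IsGradient T C Ψ) (hτ : τ ∈ Ioc 0 T) (n : ℤ) :
    ContinuousOn (lowerFlux y z fm Ψ τ n) (Ioo 0 τ) := by
  have hy := h.lower.continuousOn_Ioo hτ
  have hf := (hfm.continuousOn_Ioo hτ).1
  exact (((hΨ.continuousOn_Ioo hτ).sub (hf.mul hy.2)).mul
    (continuousOn_kernel continuousOn_dipole hy.1 (fun s hs => hs.2) n)).add
    (hf.mul (continuousOn_kernel continuousOn_dipoleDeriv hy.1 (fun s hs => hs.2) n))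

lemma continuousOn_initial_kernel {k : ℝ → ℝ → ℝ}
    (hk : ContinuousOn (fun p : ℝ × ℝ => k p.1 p.2) {p | 0 < p.2}) (τ : ℝ) (y z : ℝ → ℝ)
    (ν : ℝ) : ContinuousOn (fun q : ℝ × ℝ => k (shift y z ν τ q.2) (τ - q.1)) (Iio τ ×ˢ univ) :=
  hk.comp (f := fun q : ℝ × ℝ => (shift y z ν τ q.2, τ - q.1))
    (by unfold shift; fun_prop) fun q hq => show 0 < τ - q.1 from sub_pos.2 hq.1

namespace IsSolution

/-- The identity of a regular image. -/
lemma integral_flux_of_ne (hU : IsSolution T y z fm fp U₀ U) (h : IsStrip T L l₀ y z)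
    (hfm : IsC1With T L fm) (hfp : IsC1With T L fp)
    (hΨ : ∀ τ ∈ Ioc 0 T, Ψ τ = -grad y z U τ (y τ)) (hΦ : ∀ τ ∈ Ioc 0 T, Φ τ = grad y z U τ (z τ))
    (hτ : τ ∈ Ioc 0 T) {n : ℤ} (hn : n ≠ 0) :
    (∫ s in (0)..τ, (upperFlux y z fp Φ τ n s + lowerFlux y z fm Ψ τ n s)) +
      ∫ x in (y 0)..(z 0), U 0 x * upsilonTerm y z n τ x 0 = 0 := by
  obtain ⟨C, hgΨ, hgΦ⟩ := exists_isGradient hU h hfm hfp hΨ hΦ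
  obtain ⟨K, hK, H⟩ := exists_flux_bound h hfm hfp hgΨ hgΦ hτ
  have hint := intervalIntegrable_of_le_sqrtWeight (A := 2 * (K * weight n)) hτ.1
    ((continuousOn_upperFlux h hfp hgΦ hτ n).add (continuousOn_lowerFlux h hfm hgΨ hτ n))
    fun s hs => (abs_add_le _ _).trans (by linarith [(H s hs n).1, (H s hs n).2 hn])
  have := sub_eq_integral_of_tendsto hτ.1 hint
    (fun a b ha hab hb => hU.green_image h hΨ hΦ hτ n ha hab hb)
    (hU.tendsto_integral_initial h hτ (continuousOn_initial_kernel continuousOn_dipole τ y z n))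
    (hU.tendsto_integral_dipole h hτ hn)
  simp only [Pi.add_apply] at this
  rw [← this]
  simp only [upsilonTerm_eq]
  ring

/-- The identity of the singular image. -/
lemma integral_flux_zero (hU : IsSolution T y z fm fp U₀ U) (h : IsStrip T L l₀ y z)
    (hfm : IsC1With T L fm) (hfp : IsC1With T L fp)
    (hΨ : ∀ τ ∈ Ioc 0 T, Ψ τ = -grad y z U τ (y τ)) (hΦ : ∀ τ ∈ Ioc 0 T, Φ τ = grad y z U τ (z τ))
    (hτ : τ ∈ Ioc 0 T) :
    (∫ s in (0)..τ, upperFlux y z fp Φ τ 0 s) - (∫ s in (0)..τ, Ψ s * gradKernel y τ s) +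
      (∫ s in (0)..τ, rebateKernel fm y τ s) +
      ∫ x in (y 0)..(z 0), U 0 x * upsilonTerm y z (0 : ℤ) τ x 0 =
      -Ψ τ + fm τ / √(π * τ) := by
  obtain ⟨C, hgΨ, hgΦ⟩ := exists_isGradient hU h hfm hfp hΨ hΦ
  obtain ⟨K, hK, H⟩ := exists_flux_bound h hfm hfp hgΨ hgΦ hτ
  have i1 : IntervalIntegrable (upperFlux y z fp Φ τ 0) volume 0 τ :=
    intervalIntegrable_of_le_sqrtWeight hτ.1 (continuousOn_upperFlux h hfp hgΦ hτ 0)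
      fun s hs => (H s hs 0).1
  have i2 := intervalIntegrable_mul_gradKernel hgΨ h.lower hτ
  have i3 := intervalIntegrable_rebateKernel hfm h.lower hτ
  -- Subtracting f⁻(τ)/√(π(τ - s)) from the dipole integral removes the nonintegrable part of the
  -- flux and makes the limit at τ finite. Its value at s = 0 is the free term f⁻(τ)/√(πτ).
  have key := sub_eq_integral_of_tendsto
    (J := fun s => (∫ x in (y s)..(z s), U s x * dipole (shift y z (0 : ℤ) τ x) (τ - s)) -
      fm τ / √(π * (τ - s))) (J₁ := grad y z U τ (y τ))
    (J₀ := (∫ x in (y 0)..(z 0), U 0 x * dipole (shift y z (0 : ℤ) τ x) (τ - 0)) -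
      fm τ / √(π * (τ - 0)))
    hτ.1 ((i1.sub i2).add i3) ?_ ?_ ?_
  · rw [intervalIntegral.integral_add (i1.sub i2) i3, intervalIntegral.integral_sub i1 i2] at key
    simp only [upsilonTerm_eq]
    rw [sub_zero] at key ⊢
    rw [hΨ τ hτ]
    linarith
  · intro a b ha hab hb
    have hsub : uIcc a b ⊆ uIcc 0 τ := by
      rw [uIcc_of_le hab, uIcc_of_le hτ.1.le]
      exact Icc_subset_Icc ha.le hb.le
    have j := ((i1.sub i2).add i3).mono_set hsub
    have h1 := hU.green_image h hΨ hΦ hτ 0 ha hab hb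
    have h2 : ∀ s, upperFlux y z fp Φ τ 0 s + lowerFlux y z fm Ψ τ 0 s =
        (upperFlux y z fp Φ τ 0 s - Ψ s * gradKernel y τ s + rebateKernel fm y τ s) +
        fm τ * (1 / (2 * √(π * (τ - s) ^ 3))) := fun s => by
      rw [lowerFlux_zero]
      ring
    simp only [h2] at h1
    rw [intervalIntegral.integral_add j, intervalIntegral.integral_const_mul,
      integral_one_div_sqrt_cube hab hb] at h1
    · linear_combination h1
    · refine (ContinuousOn.intervalIntegrable (ContinuousOn.div (by fun_prop) (by fun_prop)
        ?_)).const_mul (fm τ)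
      intro s hs
      rw [uIcc_of_le hab] at hs
      have : 0 < τ - s := by linarith [hs.2]
      positivity
  · refine (hU.tendsto_integral_initial h hτ
      (continuousOn_initial_kernel continuousOn_dipole τ y z (0 : ℤ))).sub ?_
    have hc : ContinuousAt (fun s => fm τ / √(π * (τ - s))) 0 :=
      ContinuousAt.div (by fun_prop) (by fun_prop) (by
        have := hτ.1
        rw [sub_zero]
        positivity)
    exact hc.tendsto.mono_left nhdsWithin_le_nhds
  · simp only [shift_zero]
    exact hU.tendsto_integral_dipole_zero h hfm hfp hτ

end IsSolution

lemma hasSum_ite_ne_zero {f : ℤ → ℝ} (hf : Summable f) :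
    HasSum (fun n => if n = 0 then 0 else f n) (∑' n : {n : ℤ // n ≠ 0}, f n) := by
  have h1 := (hf.subtype {n : ℤ | n ≠ 0}).hasSum
  have h2 : (fun n => if n = 0 then 0 else f n) = {n : ℤ | n ≠ 0}.indicator f := by
    ext n
    by_cases hn : n = 0 <;> simp [indicator, hn]
  rw [h2]
  exact hasSum_subtype_iff_indicator.1 h1

/-- The flux without the singular term. -/
noncomputable def regularFlux (y z fm fp Ψ Φ : ℝ → ℝ) (τ : ℝ) (n : ℤ) (s : ℝ) : ℝ :=
  upperFlux y z fp Φ τ n s + if n = 0 then 0 else lowerFlux y z fm Ψ τ n s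

/-- Summation over images at fixed s produces exactly the integrands of the Volterra equation that
contain image sums; the lower flux of the image n = 0 is left out. -/
lemma hasSum_regularFlux (h : IsStrip T L l₀ y z) (hτ : τ ∈ Ioc 0 T) {s : ℝ} (hs : s < τ)
    (fm fp Ψ Φ : ℝ → ℝ) :
    HasSum (fun n => regularFlux y z fm fp Ψ Φ τ n s)
      (((Φ s + fp s * deriv z s) * upsilonMinus y z τ (z s) s
        + (Ψ s - fm s * deriv y s) * upsilonMinus₀ y z τ s)
        + (fm s * lambdaMinus₀ y z τ s - fp s * lambdaMinus y z τ (z s) s)) := by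
  have hyz := h.lt (Ioc_subset_Icc_self hτ)
  obtain ⟨u1, u2, -⟩ := summable_image hyz hs (z s) 0
  obtain ⟨v1, v2, -⟩ := summable_image hyz hs (y s) 0
  simp only [add_zero] at u1 u2 v1 v2
  have H := ((u1.hasSum.mul_left (Φ s + fp s * deriv z s)).sub (u2.hasSum.mul_left (fp s))).add
    (((hasSum_ite_ne_zero v1).mul_left (Ψ s - fm s * deriv y s)).add
      ((hasSum_ite_ne_zero v2).mul_left (fm s)))
  have e : (fun n => regularFlux y z fm fp Ψ Φ τ n s) = fun n : ℤ =>
      (Φ s + fp s * deriv z s) * upsilonTerm y z n τ (z s) s - fp s * lambdaTerm y z n τ (z s) s +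
        ((Ψ s - fm s * deriv y s) * (if n = 0 then 0 else upsilonTerm y z n τ (y s) s) +
          fm s * if n = 0 then 0 else lambdaTerm y z n τ (y s) s) := by
    ext n
    by_cases hn : n = 0 <;> simp [regularFlux, upperFlux, lowerFlux, hn]
  rw [e]
  refine (Eq.subst (motive := HasSum _) ?_ H)
  simp only [upsilonMinus, lambdaMinus, upsilonMinus₀, lambdaMinus₀]
  ring

/-- Dominated convergence: the terms are at most 2K·weight n times one integrable function of s, the
weight being summable in n. -/
lemma hasSum_integral_regularFlux (h : IsStrip T L l₀ y z) (hfm : IsC1With T L fm)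
    (hfp : IsC1With T L fp) (hΨ : IsGradient T C Ψ) (hΦ : IsGradient T C Φ) (hτ : τ ∈ Ioc 0 T) :
    HasSum (fun n => ∫ s in (0)..τ, regularFlux y z fm fp Ψ Φ τ n s)
      (∫ s in (0)..τ, (((Φ s + fp s * deriv z s) * upsilonMinus y z τ (z s) s
        + (Ψ s - fm s * deriv y s) * upsilonMinus₀ y z τ s)
        + (fm s * lambdaMinus₀ y z τ s - fp s * lambdaMinus y z τ (z s) s))) := by
  obtain ⟨K, hK, H⟩ := exists_flux_bound h hfm hfp hΨ hΦ hτ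
  have hsum : ∀ s, Summable fun n : ℤ => 2 * (K * weight n) * sqrtWeight τ s := fun s =>
    ((summable_weight.mul_left K).mul_left 2).mul_right _
  refine intervalIntegral.hasSum_integral_of_dominated_convergence
    (fun n s => 2 * (K * weight n) * sqrtWeight τ s) (fun n => ?_) (fun n => ?_) ?_ ?_ ?_
  · refine aestronglyMeasurable_uIoc hτ.1 ((continuousOn_upperFlux h hfp hΦ hτ n).add ?_)
    by_cases hn : n = 0
    · simpa only [hn, if_true] using continuousOn_const
    · simpa only [hn, if_false] using continuousOn_lowerFlux h hfm hΨ hτ n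
  · refine (ae_restrict_iff' measurableSet_uIoc).1 (ae_restrict_uIoc_of_Ioo hτ.1 fun s hs => ?_)
    have h1 := (H s hs n).1
    have h0 : 0 ≤ K * weight n * sqrtWeight τ s := (abs_nonneg _).trans h1
    refine (norm_add_le _ _).trans ?_
    by_cases hn : n = 0
    · simp only [hn, if_true, norm_zero, norm_eq_abs] at h1 h0 ⊢
      linarith
    · simp only [hn, if_false, norm_eq_abs]
      linarith [(H s hs n).2 hn]
  · exact ae_of_all _ fun s _ => hsum s
  · simp only [tsum_mul_right]
    exact (intervalIntegrable_sqrtWeight τ).const_mul _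
  · exact (ae_restrict_iff' measurableSet_uIoc).1 (ae_restrict_uIoc_of_Ioo hτ.1 fun s hs =>
      hasSum_regularFlux h hτ hs.2 fm fp Ψ Φ)

/-- Termwise integration of the initial value against the image sum. -/
lemma hasSum_integral_initial (h : IsStrip T L l₀ y z) (hτ : τ ∈ Ioc 0 T) {u : ℝ → ℝ}
    (hu : IntervalIntegrable u volume (y 0) (z 0)) :
    IntervalIntegrable (fun ξ => u ξ * upsilonMinus y z τ ξ 0) volume (y 0) (z 0) ∧
    HasSum (fun n : ℤ => ∫ ξ in (y 0)..(z 0), u ξ * upsilonTerm y z n τ ξ 0)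
      (∫ ξ in (y 0)..(z 0), u ξ * upsilonMinus y z τ ξ 0) := by
  have h0 : (0 : ℝ) ∈ Icc 0 T := left_mem_Icc.2 (hτ.1.le.trans hτ.2)
  have hτ' := Ioc_subset_Icc_self hτ
  have hlt := h.lt h0
  obtain ⟨K, hK, H⟩ := exists_image_bound h
  have hc : ∀ n : ℤ, ContinuousOn (fun ξ => upsilonTerm y z n τ ξ 0) (Icc (y 0) (z 0)) := fun n =>
    (continuousOn_initial_kernel continuousOn_dipole τ y z n).comp (f := fun ξ : ℝ => ((0 : ℝ), ξ))
      (by fun_prop) fun ξ _ => ⟨hτ.1, mem_univ ξ⟩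
  obtain ⟨B, hB⟩ := isCompact_Icc.exists_bound_of_continuousOn (hc 0)
  -- The image n = 0 is not covered by the image bound; at elapsed time τ > 0 it is continuous,
  -- hence bounded by B on the compact interval, and its weight is 1.
  set D := max (K * √τ) B
  have hbd : ∀ n : ℤ, ∀ ξ ∈ Icc (y 0) (z 0), ‖upsilonTerm y z n τ ξ 0‖ ≤ D * weight n := by
    intro n ξ hξ
    by_cases hn : n = 0
    · subst hn
      have h1 : weight 0 = 1 := by simp [weight]
      rw [h1, mul_one]
      exact (hB ξ hξ).trans (le_max_right _ _)
    · have h1 := (H τ hτ 0 ⟨le_rfl, hτ.1⟩ n _ (le_abs_shift_of_mem h hτ' h0 hτ.1.le hn hξ)).1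
      have := weight_nonneg n
      refine h1.trans ?_
      rw [sub_zero]
      gcongr
      exact le_max_left _ _
  have hU := continuousOn_tsum hc (summable_weight.mul_left D) hbd
  rw [← uIcc_of_le hlt.le] at hc hU
  have hsub : uIoc (y 0) (z 0) ⊆ Icc (y 0) (z 0) := by
    rw [uIoc_of_le hlt.le]
    exact Ioc_subset_Icc_self
  refine ⟨hu.mul_continuousOn hU, ?_⟩
  refine intervalIntegral.hasSum_integral_of_dominated_convergence
    (fun n ξ => |u ξ| * (D * weight n)) (fun n => ?_) (fun n => ?_) ?_ ?_ ?_
  · exact (intervalIntegrable_iff.1 (hu.mul_continuousOn (hc n))).aestronglyMeasurable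
  · refine ae_of_all _ fun ξ hξ => ?_
    rw [norm_mul, norm_eq_abs]
    gcongr
    exact hbd n ξ (hsub hξ)
  · exact ae_of_all _ fun ξ _ => (summable_weight.mul_left D).mul_left _
  · simp only [tsum_mul_left]
    exact hu.abs.mul_const _
  · refine ae_of_all _ fun ξ _ => HasSum.mul_left _ ?_
    have := (summable_image (h.lt hτ') hτ.1 ξ 0).1
    simp only [add_zero] at this
    exact this.hasSum

/-- The Volterra equation of the second kind for the gradient at the lower boundary. -/
lemma IsSolution.volterra_lower (hU : IsSolution T y z fm fp U₀ U) (h : IsStrip T L l₀ y z)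
    (hfm : IsC1With T L fm) (hfp : IsC1With T L fp)
    (hΨ : ∀ τ ∈ Ioc 0 T, Ψ τ = -grad y z U τ (y τ)) (hΦ : ∀ τ ∈ Ioc 0 T, Φ τ = grad y z U τ (z τ))
    (hτ : τ ∈ Ioc 0 T) :
    IntervalIntegrable (fun s => rebateKernel fm y τ s) volume 0 τ ∧
    IntervalIntegrable (fun s => Ψ s * gradKernel y τ s) volume 0 τ ∧
    IntervalIntegrable (fun ξ => U 0 ξ * upsilonMinus y z τ ξ 0) volume (y 0) (z 0) ∧
    IntervalIntegrable (fun s => (Φ s + fp s * deriv z s) * upsilonMinus y z τ (z s) s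
      + (Ψ s - fm s * deriv y s) * upsilonMinus₀ y z τ s) volume 0 τ ∧
    IntervalIntegrable (fun s => fm s * lambdaMinus₀ y z τ s
      - fp s * lambdaMinus y z τ (z s) s) volume 0 τ ∧
    -Ψ τ = -(fm τ / √(π * τ)) + (∫ s in 0..τ, rebateKernel fm y τ s)
      - (∫ s in 0..τ, Ψ s * gradKernel y τ s)
      + (∫ ξ in (y 0)..(z 0), U 0 ξ * upsilonMinus y z τ ξ 0)
      + (∫ s in 0..τ, ((Φ s + fp s * deriv z s) * upsilonMinus y z τ (z s) s
          + (Ψ s - fm s * deriv y s) * upsilonMinus₀ y z τ s))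
      + (∫ s in 0..τ, (fm s * lambdaMinus₀ y z τ s - fp s * lambdaMinus y z τ (z s) s)) := by
  obtain ⟨C, hgΨ, hgΦ⟩ := exists_isGradient hU h hfm hfp hΨ hΦ
  obtain ⟨⟨r1, r2⟩, r3, r4⟩ := isRegular_kernels h hτ
  have cy := h.lower.continuousOn_Ioo hτ
  have cz := h.upper.continuousOn_Ioo hτ
  have cm := (hfm.continuousOn_Ioo hτ).1
  have cp := (hfp.continuousOn_Ioo hτ).1
  have i1 := (r1.intervalIntegrable_mul hτ.1 ((hgΦ.continuousOn_Ioo hτ).add (cp.mul cz.2))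
    fun s hs => (hgΦ.abs_add_mul_deriv_le hfp h.upper hτ hs).1).add
    (r2.intervalIntegrable_mul hτ.1 ((hgΨ.continuousOn_Ioo hτ).sub (cm.mul cy.2))
    fun s hs => (hgΨ.abs_add_mul_deriv_le hfm h.lower hτ hs).2.1)
  have i2 := (r4.intervalIntegrable_mul hτ.1 cm
    fun s hs => (hgΨ.abs_add_mul_deriv_le hfm h.lower hτ hs).2.2).sub
    (r3.intervalIntegrable_mul hτ.1 cp
    fun s hs => (hgΦ.abs_add_mul_deriv_le hfp h.upper hτ hs).2.2)
  obtain ⟨i3, s3⟩ := hasSum_integral_initial h hτ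
    (hU.intervalIntegrable_initial h (hτ.1.trans_le hτ.2))
  refine ⟨intervalIntegrable_rebateKernel hfm h.lower hτ,
    intervalIntegrable_mul_gradKernel hgΨ h.lower hτ, i3, i1, i2, ?_⟩
  have hsum := (hasSum_integral_regularFlux h hfm hfp hgΨ hgΦ hτ).add s3
  -- The images n ≠ 0 contribute nothing, so the sum over all n reduces to its value at n = 0.
  -- Uniqueness of the sum then gives the equation.
  have hval : ∀ n : ℤ, (∫ s in (0)..τ, regularFlux y z fm fp Ψ Φ τ n s) +
      (∫ ξ in (y 0)..(z 0), U 0 ξ * upsilonTerm y z n τ ξ 0) =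
      if n = 0 then -Ψ τ + fm τ / √(π * τ) + (∫ s in (0)..τ, Ψ s * gradKernel y τ s) -
        (∫ s in (0)..τ, rebateKernel fm y τ s) else 0 := by
    intro n
    by_cases hn : n = 0
    · subst hn
      simp only [regularFlux, if_true, add_zero]
      linarith [hU.integral_flux_zero h hfm hfp hΨ hΦ hτ]
    · simp only [regularFlux, hn, if_false]
      exact hU.integral_flux_of_ne h hfm hfp hΨ hΦ hτ hn
  simp only [hval] at hsum
  have heq := hsum.unique (hasSum_ite_eq (0 : ℤ) _)
  have hsplit := intervalIntegral.integral_add i1 i2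
  simp only [Pi.add_apply, Pi.sub_apply, Pi.mul_apply] at hsplit
  linarith

end volterra

/-! ### Lebesgue–Stieltjes integrals against a differentiable integrator -/

lemma boundedVariationOn_of_abs_sub_le {f K : ℝ → ℝ} {s : Set ℝ} (hK : BoundedVariationOn K s)
    (h : ∀ x ∈ s, ∀ y ∈ s, x ≤ y → |f y - f x| ≤ K y - K x) : BoundedVariationOn f s := by
  refine ne_top_of_le_ne_top hK (iSup_mono fun p => Finset.sum_le_sum fun i _ => ?_)
  rw [edist_dist, edist_dist, Real.dist_eq, Real.dist_eq]
  exact ENNReal.ofReal_le_ofReal ((h _ (p.2.2.2 i) _ (p.2.2.2 (i + 1))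
    (p.2.2.1 i.le_succ)).trans (le_abs_self _))

/-- The increments are dominated by those of a monotone function with unit jumps at a and b, of
values between 0 and 2. -/
lemma boundedVariationOn_indicator_Ioo (a b : ℝ) :
    BoundedVariationOn ((Ioo a b).indicator fun _ => (1 : ℝ)) univ := by
  have hmono : Monotone fun x : ℝ => (if a < x then (1 : ℝ) else 0) + if b ≤ x then 1 else 0 := by
    intro x y hxy
    dsimp only
    split_ifs <;> linarith
  refine boundedVariationOn_of_abs_sub_le
    ((hmono.monotoneOn univ).boundedVariationOn (C := 2) fun x _ => ?_) fun x _ y _ hxy => ?_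
  · split_ifs <;> norm_num
  · simp only [indicator, mem_Ioo]
    split_ifs <;> first | (exfalso; grind) | norm_num

/-- The increments are dominated by those of the bounded monotone primitive of |φ|. -/
lemma boundedVariationOn_primitive {φ : ℝ → ℝ} (hφ : Integrable φ) (a : ℝ) :
    BoundedVariationOn (fun x => ∫ t in a..x, φ t) univ := by
  have hi : ∀ x y, IntervalIntegrable φ volume x y := fun x y => hφ.intervalIntegrable
  have hsub : ∀ {ψ : ℝ → ℝ}, Integrable ψ → ∀ x y,
      (∫ t in a..y, ψ t) - ∫ t in a..x, ψ t = ∫ t in x..y, ψ t := fun hψ x y =>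
    intervalIntegral.integral_interval_sub_left hψ.intervalIntegrable hψ.intervalIntegrable
  have hmono : Monotone fun x => ∫ t in a..x, |φ t| := fun x y hxy => by
    rw [← sub_nonneg, hsub hφ.abs]
    exact intervalIntegral.integral_nonneg hxy fun _ _ => abs_nonneg _
  refine boundedVariationOn_of_abs_sub_le
    ((hmono.monotoneOn univ).boundedVariationOn (C := ∫ t, |φ t|) fun x _ => ?_)
    fun x _ y _ hxy => ?_
  · have h1 := intervalIntegral.norm_integral_le_integral_norm_uIoc
      (a := a) (b := x) (f := fun t => |φ t|) (μ := volume)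
    refine h1.trans ?_
    simp only [norm_eq_abs, abs_abs]
    exact setIntegral_le_integral hφ.abs (ae_of_all _ fun _ => abs_nonneg _)
  · rw [hsub hφ, hsub hφ.abs]
    exact intervalIntegral.abs_integral_le_integral_abs hxy

/-- The signed measure is the difference of the measures with densities φ⁺ and φ⁻. The products of
these with f are integrable because φf is. -/
lemma integral_withDensityᵥ {φ f : ℝ → ℝ} (hφ : Integrable φ) (hf : AEStronglyMeasurable f)
    (hφf : Integrable fun x => φ x * f x) :
    (volume.withDensityᵥ φ).Integrable f ∧
    (volume.withDensityᵥ φ).integral f (ContinuousLinearMap.lsmul ℝ ℝ) = ∫ x, φ x * f x := by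
  have hm := hφ.aestronglyMeasurable.aemeasurable
  have hpart : ∀ p : ℝ → ℝ, AEMeasurable p → (∀ x, |p x| ≤ |φ x|) →
      Integrable fun x => p x * f x := fun p hp hle =>
    hφf.mono (hp.aestronglyMeasurable.mul hf) (ae_of_all _ fun x => by
      rw [norm_mul, norm_mul]
      exact mul_le_mul_of_nonneg_right (hle x) (norm_nonneg _))
  have hpos := hpart (fun x => max (φ x) 0) (hm.max aemeasurable_const) fun x => by
    rcases le_total (φ x) 0 with h | h <;> simp [h]
  have hneg := hpart (fun x => max (-φ x) 0) (hm.neg.max aemeasurable_const) fun x => by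
    rcases le_total (φ x) 0 with h | h <;> simp [h]
  have hlt : ∀ p : ℝ → ℝ, ∀ᵐ x : ℝ, ENNReal.ofReal (p x) < ⊤ := fun p =>
    ae_of_all _ fun _ => ENNReal.ofReal_lt_top
  constructor
  · rw [VectorMeasure.Integrable, Measure.variation_withDensityᵥ hφ,
      integrable_withDensity_iff_integrable_smul₀' hm.enorm (ae_of_all _ fun _ => enorm_lt_top)]
    simpa using hpart (fun x => |φ x|) hm.abs fun x => by simp
  -- Multiplication on ℝ is symmetric; the flipped pairing is the form in which the integral against
  -- a positive measure is the ordinary one.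
  · have hflip : ContinuousLinearMap.lsmul ℝ ℝ (E := ℝ) =
        (ContinuousLinearMap.lsmul ℝ ℝ (E := ℝ)).flip := by
      ext
      simp
    have := isFiniteMeasure_withDensity_ofReal hφ.2
    have := isFiniteMeasure_withDensity_ofReal hφ.neg.2
    simp only [Pi.neg_apply] at this
    have int : ∀ p : ℝ → ℝ, AEMeasurable p → (Integrable fun x => max (p x) 0 * f x) →
        Integrable f (volume.withDensity fun x => ENNReal.ofReal (p x)) := fun p hp hi => by
      rw [integrable_withDensity_iff_integrable_smul₀' hp.ennreal_ofReal (hlt p)]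
      simpa only [ENNReal.toReal_ofReal', smul_eq_mul] using hi
    rw [withDensityᵥ_eq_withDensity_pos_part_sub_withDensity_neg_part hφ, hflip,
      VectorMeasure.integral_sub_vectorMeasure
        (by rw [VectorMeasure.Integrable, Measure.variation_toSignedMeasure]; exact int φ hm hpos)
        (by rw [VectorMeasure.Integrable, Measure.variation_toSignedMeasure]
            exact int (fun x => -φ x) hm.neg hneg),
      VectorMeasure.integral_toSignedMeasure, VectorMeasure.integral_toSignedMeasure,
      integral_withDensity_eq_integral_toReal_smul₀ hm.ennreal_ofReal (hlt φ),
      integral_withDensity_eq_integral_toReal_smul₀ (f := fun x => ENNReal.ofReal (-φ x))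
        hm.neg.ennreal_ofReal (hlt fun x => -φ x)]
    simp only [ENNReal.toReal_ofReal', smul_eq_mul]
    rw [← integral_sub hpos hneg]
    congr 1
    ext x
    rw [← sub_mul]
    rcases le_total (φ x) 0 with h | h <;> simp [h]

/-- On (a, b) the function g is a primitive of g' up to a constant, so the measure dg restricted to
(a, b) has density g'. The jumps of the indicator at a and b are invisible to the open interval. -/
lemma lsIntegral_eq_of_hasDerivAt {f g g' : ℝ → ℝ} {a b : ℝ} (hab : a < b)
    (hf : ContinuousOn f (Ioo a b)) (hg : ∀ x ∈ Ioo a b, HasDerivAt g (g' x) x)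
    (hg' : IntervalIntegrable g' volume a b)
    (hfg : IntervalIntegrable (fun x => f x * g' x) volume a b) :
    LSIntegrable f g a b ∧ lsIntegral f g a b = ∫ x in a..b, f x * g' x := by
  rw [intervalIntegrable_iff_integrableOn_Ioo_of_le hab.le] at hg' hfg
  set φ : ℝ → ℝ := (Ioo a b).indicator g' with hφdef
  have hφ : Integrable φ := (integrable_indicator_iff measurableSet_Ioo).2 hg'
  set G : ℝ → ℝ := fun x => ∫ t in a..x, φ t with hG
  have hGc : Continuous G :=
    intervalIntegral.continuous_primitive (fun _ _ => hφ.intervalIntegrable) a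
  set m := (a + b) / 2
  have hm : m ∈ Ioo a b := ⟨by simp only [m]; linarith, by simp only [m]; linarith⟩
  have hgG : ∀ x ∈ Ioo a b, g x = G x + (g m - G m) := by
    intro x hx
    have hsub : uIcc m x ⊆ Ioo a b := (ordConnected_Ioo.uIcc_subset hm hx)
    have h1 : ∫ t in m..x, φ t = g x - g m := by
      rw [← intervalIntegral.integral_eq_sub_of_hasDerivAt (fun t ht => hg t (hsub ht))]
      · exact intervalIntegral.integral_congr fun t ht => indicator_of_mem (hsub ht) g'
      · exact (hg'.mono_set hsub).intervalIntegrable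
    have h2 : G x - G m = ∫ t in m..x, φ t := intervalIntegral.integral_interval_sub_left
      hφ.intervalIntegrable hφ.intervalIntegrable
    linarith
  set c := g m - G m
  -- As a product of a step function and a primitive shifted by a constant, the cut-off function has
  -- bounded variation.
  have hind : (Ioo a b).indicator g = fun x => (Ioo a b).indicator (fun _ => 1) x * (G x + c) := by
    ext x
    by_cases hx : x ∈ Ioo a b
    · simp [hx, hgG x hx]
    · simp [hx]
  have hBV : BoundedVariationOn ((Ioo a b).indicator g) univ := by
    rw [hind]
    refine (boundedVariationOn_indicator_Ioo a b).fun_mul ?_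
    exact boundedVariationOn_of_abs_sub_le
      (K := fun x => ∫ t in a..x, |φ t|) (boundedVariationOn_primitive hφ.abs a)
      fun x _ y _ hxy => by
        have e1 : G y - G x = ∫ t in x..y, φ t := intervalIntegral.integral_interval_sub_left
          hφ.intervalIntegrable hφ.intervalIntegrable
        rw [add_sub_add_right_eq_sub, e1, intervalIntegral.integral_interval_sub_left
          hφ.abs.intervalIntegrable hφ.abs.intervalIntegrable]
        exact intervalIntegral.abs_integral_le_integral_abs hxy
  have hG0 : G a = 0 := intervalIntegral.integral_same
  have hright : ∀ x ∈ Ico a b, Function.rightLim ((Ioo a b).indicator g) x = G x + c := by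
    intro x hx
    refine rightLim_eq_of_tendsto (((hGc.tendsto x).mono_left nhdsWithin_le_nhds).add_const c
      |>.congr' ?_)
    filter_upwards [Ioo_mem_nhdsGT hx.2] with t ht
    rw [indicator_of_mem (show t ∈ Ioo a b from ⟨hx.1.trans_lt ht.1, ht.2⟩), hgG t
      ⟨hx.1.trans_lt ht.1, ht.2⟩]
  have hleft : Function.leftLim ((Ioo a b).indicator g) b = G b + c := by
    refine leftLim_eq_of_tendsto (((hGc.tendsto b).mono_left nhdsWithin_le_nhds).add_const c
      |>.congr' ?_)
    filter_upwards [Ioo_mem_nhdsLT hab] with t ht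
    rw [indicator_of_mem ht, hgG t ht]
  have hφIic : ∀ x, a ≤ x → ∫ t in Iic x, φ t = G x := by
    intro x hx
    change _ = ∫ t in a..x, φ t
    rw [intervalIntegral.integral_of_le hx, ← Iic_sdiff_Iic]
    refine setIntegral_eq_of_subset_of_forall_sdiff_eq_zero measurableSet_Iic sdiff_subset ?_
    intro t ht
    refine indicator_of_notMem (fun h => ?_) _
    simp only [Set.mem_sdiff, mem_Iic, not_and, not_not] at ht
    exact not_le.2 h.1 (ht.2 ht.1)
  have hφb : ∀ x, b ≤ x → G x = G b := by
    intro x hx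
    have : G x - G b = ∫ t in b..x, φ t := intervalIntegral.integral_interval_sub_left
      hφ.intervalIntegrable hφ.intervalIntegrable
    rw [intervalIntegral.integral_zero_ae] at this
    · linarith
    · refine ae_of_all _ fun t ht => indicator_of_notMem (fun h => ?_) _
      rw [uIoc_of_le hx] at ht
      exact lt_asymm ht.1 h.2
  -- The mass of the open interval is the left limit at b minus the right limit at a, so the
  -- artificial values outside do not enter.
  have hIoo : hBV.vectorMeasure (Ioo a b) = G b := by
    rw [hBV.vectorMeasure_Ioo hab, hleft, hright a ⟨le_rfl, hab⟩, hG0]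
    ring
  -- Both sides are signed measures with the same values on the π-system of half lines and the same
  -- total mass.
  have hmeas : hBV.vectorMeasure.restrict (Ioo a b) = volume.withDensityᵥ φ := by
    refine VectorMeasure.ext_of_generateFrom (range Iic) ?_
      ((BorelSpace.measurable_eq (α := ℝ)).trans (borel_eq_generateFrom_Iic ℝ)) isPiSystem_Iic ?_
    · rintro _ ⟨x, rfl⟩
      rw [VectorMeasure.restrict_apply _ measurableSet_Ioo measurableSet_Iic,
        withDensityᵥ_apply hφ measurableSet_Iic]
      rcases lt_or_ge x a with hx | hx
      · have : Iic x ∩ Ioo a b = ∅ := by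
          ext t
          simp only [mem_inter_iff, mem_Iic, mem_Ioo, mem_empty_iff_false, iff_false]
          intro h
          linarith [h.1, h.2.1]
        rw [this, VectorMeasure.empty]
        refine (setIntegral_eq_zero_of_forall_eq_zero fun t ht => ?_).symm
        exact indicator_of_notMem (fun h => lt_asymm (ht.trans_lt hx) h.1) _
      · rw [hφIic x hx]
        rcases lt_or_ge x b with hxb | hxb
        · have : Iic x ∩ Ioo a b = Ioc a x := by
            ext t
            simp only [mem_inter_iff, mem_Iic, mem_Ioo, mem_Ioc]
            constructor
            · exact fun h => ⟨h.2.1, h.1⟩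
            · exact fun h => ⟨h.2, h.1, h.2.trans_lt hxb⟩
          rw [this, hBV.vectorMeasure_Ioc hx, hright x ⟨hx, hxb⟩, hright a ⟨le_rfl, hab⟩, hG0]
          ring
        · rw [inter_eq_right.2 fun t ht => ht.2.le.trans hxb, hIoo, hφb x hxb]
    · rw [VectorMeasure.restrict_apply _ measurableSet_Ioo MeasurableSet.univ, univ_inter, hIoo,
        withDensityᵥ_apply hφ MeasurableSet.univ, setIntegral_univ, hφdef,
        integral_indicator measurableSet_Ioo, ← integral_Ioc_eq_integral_Ioo,
        ← intervalIntegral.integral_of_le hab.le]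
      refine intervalIntegral.integral_congr_ae ?_
      filter_upwards [Measure.ae_ne volume b] with t hne ht
      rw [uIoc_of_le hab.le] at ht
      exact indicator_of_mem (show t ∈ Ioo a b from ⟨ht.1, lt_of_le_of_ne ht.2 hne⟩) g'
  have hfind : ∀ x, φ x * (Ioo a b).indicator f x = (Ioo a b).indicator (fun x => f x * g' x) x := by
    intro x
    by_cases hx : x ∈ Ioo a b
    · simp [hφdef, hx, mul_comm]
    · simp [hx]
  have hfm : AEStronglyMeasurable ((Ioo a b).indicator f) :=
    (aestronglyMeasurable_indicator_iff measurableSet_Ioo).2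
      (hf.aestronglyMeasurable measurableSet_Ioo)
  have hfint : Integrable fun x => φ x * (Ioo a b).indicator f x := by
    simp only [hfind]
    exact (integrable_indicator_iff measurableSet_Ioo).2 hfg
  obtain ⟨k1, k2⟩ := integral_withDensityᵥ hφ hfm hfint
  rw [← hmeas] at k1 k2
  have hae : (Ioo a b).indicator f =ᵐ[(hBV.vectorMeasure.restrict (Ioo a b)).variation] f := by
    rw [VectorMeasure.variation_restrict measurableSet_Ioo]
    filter_upwards [ae_restrict_mem measurableSet_Ioo] with x hx
    exact indicator_of_mem hx f
  refine ⟨⟨hBV, k1.congr hae⟩, ?_⟩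
  rw [lsIntegral, dif_pos hBV, ← VectorMeasure.integral_congr_ae hae, k2]
  simp only [hfind]
  rw [integral_indicator measurableSet_Ioo, ← integral_Ioc_eq_integral_Ioo,
    ← intervalIntegral.integral_of_le hab.le]

/-! ### The Lebesgue–Stieltjes form at the lower boundary -/

lemma hasDerivAt_gaussian {X : ℝ → ℝ} {X' τ s : ℝ} (hX : HasDerivAt X X' s) (hs : s < τ) :
    HasDerivAt (fun s => exp (-X s ^ 2 / (4 * (τ - s))))
      (exp (-X s ^ 2 / (4 * (τ - s))) *
        (-(X s * X') / (2 * (τ - s)) - X s ^ 2 / (4 * (τ - s) ^ 2))) s := by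
  have ht := sub_pos.2 hs
  have h1 : HasDerivAt (fun s => 4 * (τ - s)) (-4) s := by
    simpa using ((hasDerivAt_id s).const_sub τ).const_mul 4
  refine (((hX.pow 2).neg.div h1 (by positivity)).exp).congr_deriv ?_
  simp only [Pi.pow_apply, Pi.neg_apply, Pi.div_apply]
  field_simp
  ring

lemma hasDerivAt_inv_sqrt_pi_mul_sub {τ s : ℝ} (hs : s < τ) :
    HasDerivAt (fun s => 1 / √(π * (τ - s))) (1 / (2 * √(π * (τ - s) ^ 3))) s :=
  ((hasDerivAt_inv_sqrt_pi_mul (sub_pos.2 hs)).comp s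
    ((hasDerivAt_id s).const_sub τ)).congr_deriv (by ring)

/-- The monopole solves the heat equation, so its time derivative is -`dipoleDeriv`; the sign
changes because the elapsed time τ - s decreases in s. -/
lemma hasDerivAt_monopole_comp {X : ℝ → ℝ} {X' τ s : ℝ} (hX : HasDerivAt X X' s) (hs : s < τ) :
    HasDerivAt (fun s => monopole (X s) (τ - s))
      (X' * dipole (X s) (τ - s) + dipoleDeriv (X s) (τ - s)) s := by
  have ht := sub_pos.2 hs
  have h : √(π * (τ - s)) ≠ 0 := (sqrt_pos.2 (by positivity)).ne'
  refine ((hasDerivAt_inv_sqrt_pi_mul_sub hs).mul (hasDerivAt_gaussian hX hs)).congr_deriv ?_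
  rw [dipole, dipoleDeriv, sqrt_pi_mul_cube ht]
  field_simp
  ring

section stieltjes

variable {T L l₀ τ C : ℝ} {y z fm fp U₀ Ψ Φ : ℝ → ℝ} {U : ℝ → ℝ → ℝ}

/-- The combination λ - b'υ is the one multiplying the boundary data in the flux; this turns the
data terms of the Volterra equation into Stieltjes integrals against η. -/
lemma hasDerivAt_monopole_image {b : ℝ → ℝ} (hb : IsC1With T L b) (hτ : τ ∈ Ioc 0 T) (ν : ℝ)
    {s : ℝ} (hs : s ∈ Ioo 0 τ) :
    HasDerivAt (fun s => monopole (shift y z ν τ (b s)) (τ - s))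
      (lambdaTerm y z ν τ (b s) s - deriv b s * upsilonTerm y z ν τ (b s) s) s := by
  have h1 : HasDerivAt (fun s => shift y z ν τ (b s)) (-deriv b s) s :=
    ((hb.hasDerivAt s ⟨hs.1, hs.2.trans_le hτ.2⟩).const_sub (y τ)).add_const _
  refine (hasDerivAt_monopole_comp h1 hs.2).congr_deriv ?_
  rw [lambdaTerm_eq, upsilonTerm_eq]
  ring

/-- The index type is arbitrary so that the full sum at one boundary and the punctured sum at the
other are covered together. The majorant of the derivatives is (1 + L)w, since |b'| ≤ L. -/
lemma hasDerivAt_tsum_monopole {ι : Type*} {b : ℝ → ℝ} (hb : IsC1With T L b) (hτ : τ ∈ Ioc 0 T)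
    (ν : ι → ℝ) {w : ι → ℝ} (hw : Summable w)
    (H : ∀ s ∈ Ioo 0 τ, ∀ n, |upsilonTerm y z (ν n) τ (b s) s| ≤ w n ∧
      |lambdaTerm y z (ν n) τ (b s) s| ≤ w n ∧ |monopole (shift y z (ν n) τ (b s)) (τ - s)| ≤ w n)
    {s : ℝ} (hs : s ∈ Ioo 0 τ) :
    HasDerivAt (fun s => ∑' n, monopole (shift y z (ν n) τ (b s)) (τ - s))
      ((∑' n, lambdaTerm y z (ν n) τ (b s) s) -
        deriv b s * ∑' n, upsilonTerm y z (ν n) τ (b s) s) s := by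
  have h1 : Summable fun n => lambdaTerm y z (ν n) τ (b s) s :=
    .of_norm_bounded hw fun n => (H s hs n).2.1
  have h2 : Summable fun n => upsilonTerm y z (ν n) τ (b s) s :=
    .of_norm_bounded hw fun n => (H s hs n).1
  rw [← tsum_mul_left, ← h1.tsum_sub (h2.mul_left _)]
  refine hasDerivAt_tsum_of_isPreconnected (u := fun n => (1 + L) * w n)
    (g := fun n s => monopole (shift y z (ν n) τ (b s)) (τ - s))
    (g' := fun n s => lambdaTerm y z (ν n) τ (b s) s - deriv b s * upsilonTerm y z (ν n) τ (b s) s)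
    (hw.mul_left _) isOpen_Ioo isPreconnected_Ioo
    (fun n s hs => hasDerivAt_monopole_image hb hτ (ν n) hs) (fun n s hs => ?_) hs
    (.of_norm_bounded hw fun n => (H s hs n).2.2) hs
  obtain ⟨k1, k2, -⟩ := H s hs n
  have k3 := hb.abs_deriv_le s ⟨hs.1, hs.2.trans_le hτ.2⟩
  refine (abs_sub _ _).trans ?_
  rw [abs_mul]
  have := hb.nonneg
  calc _ ≤ w n + L * w n := by gcongr
    _ = _ := by ring

lemma hasDerivAt_etaMinus_upper (h : IsStrip T L l₀ y z) (hτ : τ ∈ Ioc 0 T) {s : ℝ}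
    (hs : s ∈ Ioo 0 τ) :
    HasDerivAt (fun s => etaMinus y z τ (z s) s)
      (lambdaMinus y z τ (z s) s - deriv z s * upsilonMinus y z τ (z s) s) s := by
  obtain ⟨K, hK, H⟩ := exists_image_bound h
  have hsT : ∀ s ∈ Ioo 0 τ, s ∈ Icc 0 T := fun s hs => ⟨hs.1.le, hs.2.le.trans hτ.2⟩
  refine (hasDerivAt_tsum_monopole (ι := ℤ) h.upper hτ (fun n => n) (w := fun n => K * √τ * weight n)
    (summable_weight.mul_left _) (fun s hs n => ?_) hs).congr_of_eventuallyEq ?_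
  · have h1 := H τ hτ s ⟨hs.1.le, hs.2⟩ n _
      (le_abs_shift_upper h (Ioc_subset_Icc_self hτ) (hsT s hs) hs.2.le n)
    have hw := weight_nonneg n
    have hle : K * √(τ - s) * weight n ≤ K * √τ * weight n := by
      gcongr
      linarith [hs.1]
    exact ⟨h1.1.trans hle, h1.2.1.trans hle, h1.2.2.trans hle⟩
  · filter_upwards [isOpen_Ioo.mem_nhds hs] with s hs using etaMinus_upper_eq (h.lt (hsT s hs))

/-- The regularized zeroth image contributes the weakly singular factor found in `rebateKernel_eq`;
the other images are differentiated termwise. -/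
lemma hasDerivAt_etaMinus_lower (h : IsStrip T L l₀ y z) (hτ : τ ∈ Ioc 0 T) {s : ℝ}
    (hs : s ∈ Ioo 0 τ) :
    HasDerivAt (fun s => etaMinus y z τ (y s) s)
      ((exp (-(y τ - y s) ^ 2 / (4 * (τ - s))) *
        (1 + deriv y s * (y τ - y s) - (y τ - y s) ^ 2 / (2 * (τ - s))) - 1) /
        (2 * √(π * (τ - s) ^ 3)) +
      (lambdaMinus₀ y z τ s - deriv y s * upsilonMinus₀ y z τ s)) s := by
  obtain ⟨K, hK, H⟩ := exists_image_bound h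
  have hτ' := Ioc_subset_Icc_self hτ
  have hsT : ∀ s ∈ Ioo 0 τ, s ∈ Icc 0 T := fun s hs => ⟨hs.1.le, hs.2.le.trans hτ.2⟩
  have h2 : HasDerivAt (fun s => (exp (-(y τ - y s) ^ 2 / (4 * (τ - s))) - 1) / √(π * (τ - s)))
      ((exp (-(y τ - y s) ^ 2 / (4 * (τ - s))) *
        (1 + deriv y s * (y τ - y s) - (y τ - y s) ^ 2 / (2 * (τ - s))) - 1) /
        (2 * √(π * (τ - s) ^ 3))) s := by
    have hd := (h.lower.hasDerivAt s ⟨hs.1, hs.2.trans_le hτ.2⟩).const_sub (y τ)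
    refine ((((hasDerivAt_gaussian hd hs.2).sub_const 1).mul
      (hasDerivAt_inv_sqrt_pi_mul_sub hs.2)).congr_of_eventuallyEq
      (Eventually.of_forall fun s => ?_)).congr_deriv ?_
    · simp only [Pi.mul_apply]
      ring
    · have ht := sub_pos.2 hs.2
      have h : √(π * (τ - s)) ≠ 0 := (sqrt_pos.2 (by positivity)).ne'
      rw [sqrt_pi_mul_cube ht]
      field_simp
      ring
  refine (h2.add (hasDerivAt_tsum_monopole (ι := {n : ℤ // n ≠ 0}) h.lower hτ (fun n => (n : ℤ))
    (w := fun n => K * √τ * weight n) ((summable_weight.mul_left _).subtype _)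
    (fun s hs n => ?_) hs)).congr_of_eventuallyEq ?_
  · have h1 := H τ hτ s ⟨hs.1.le, hs.2⟩ n _ (le_abs_shift_lower h hτ' (hsT s hs) hs.2.le n.2)
    have hw := weight_nonneg n
    have hle : K * √(τ - s) * weight n ≤ K * √τ * weight n := by
      gcongr
      linarith [hs.1]
    exact ⟨h1.1.trans hle, h1.2.1.trans hle, h1.2.2.trans hle⟩
  · filter_upwards [isOpen_Ioo.mem_nhds hs] with s hs using etaMinus_lower_eq (h.lt hτ') hs.2

lemma intervalIntegrable_unitRebate {b : ℝ → ℝ} (hb : IsC1With T L b) (hτ : τ ∈ Ioc 0 T) :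
    IntervalIntegrable (fun s => (exp (-(b τ - b s) ^ 2 / (4 * (τ - s))) *
      (1 + deriv b s * (b τ - b s) - (b τ - b s) ^ 2 / (2 * (τ - s))) - 1) /
      (2 * √(π * (τ - s) ^ 3))) volume 0 τ := by
  obtain ⟨h2, h3⟩ := hb.continuousOn_Ioo hτ
  refine intervalIntegrable_of_le_sqrtWeight hτ.1 ?_ fun s hs => (abs_unitRebate_le hb hτ hs).trans
    (div_sqrt_le_sqrtWeight (by positivity : 0 ≤ 3 * L ^ 2)).2
  refine ContinuousOn.div (ContinuousOn.sub (ContinuousOn.mul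
    (ContinuousOn.rexp (ContinuousOn.div (by fun_prop) (by fun_prop) ?_))
    (ContinuousOn.sub (by fun_prop) (ContinuousOn.div (by fun_prop) (by fun_prop) ?_)))
    (by fun_prop)) (by fun_prop) ?_ <;>
  · intro s hs
    have := sub_pos.2 hs.2
    positivity

lemma IsRegular.intervalIntegrable_mul_of_abs_le {k p : ℝ → ℝ} {P : ℝ} (hk : IsRegular τ k)
    (hτ : 0 < τ) (hp : ContinuousOn p (Ioo 0 τ)) (hP : ∀ s ∈ Ioo 0 τ, |p s| ≤ P) :
    IntervalIntegrable (fun s => p s * k s) volume 0 τ :=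
  hk.intervalIntegrable_mul (P := P * √τ) hτ hp fun s hs => by
    have h0 := (abs_nonneg _).trans (hP s hs)
    rw [mul_assoc]
    exact (hP s hs).trans (le_mul_of_one_le_right h0 (one_le_sqrtWeight hs))

lemma IsRegular.intervalIntegrable {k : ℝ → ℝ} (hk : IsRegular τ k) (hτ : 0 < τ) :
    IntervalIntegrable k volume 0 τ := by
  simpa using hk.intervalIntegrable_mul_of_abs_le (p := fun _ => 1) (P := 1) hτ continuousOn_const
    fun s _ => by simp

/-- The Volterra equation at the lower boundary in Lebesgue–Stieltjes form. -/
lemma IsSolution.stieltjes_lower (hU : IsSolution T y z fm fp U₀ U) (h : IsStrip T L l₀ y z)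
    (hfm : IsC1With T L fm) (hfp : IsC1With T L fp)
    (hΨ : ∀ τ ∈ Ioc 0 T, Ψ τ = -grad y z U τ (y τ)) (hΦ : ∀ τ ∈ Ioc 0 T, Φ τ = grad y z U τ (z τ))
    (hτ : τ ∈ Ioc 0 T) :
    IntervalIntegrable (fun s => incrementKernel fm τ s) volume 0 τ ∧
    LSIntegrable fm (fun s => etaMinus y z τ (y s) s) 0 τ ∧
    LSIntegrable fp (fun s => etaMinus y z τ (z s) s) 0 τ ∧
    IntervalIntegrable (fun s => Φ s * upsilonMinus y z τ (z s) s
      + Ψ s * upsilonMinus₀ y z τ s) volume 0 τ ∧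
    -Ψ τ = (∫ ξ in (y 0)..(z 0), U 0 ξ * upsilonMinus y z τ ξ 0)
      - fm τ / √(π * τ) + (∫ s in 0..τ, incrementKernel fm τ s)
      + (lsIntegral fm (fun s => etaMinus y z τ (y s) s) 0 τ
          - lsIntegral fp (fun s => etaMinus y z τ (z s) s) 0 τ)
      - (∫ s in 0..τ, Ψ s * gradKernel y τ s)
      + (∫ s in 0..τ, (Φ s * upsilonMinus y z τ (z s) s + Ψ s * upsilonMinus₀ y z τ s)) := by
  obtain ⟨j1, j2, j3, j4, j5, heq⟩ := hU.volterra_lower h hfm hfp hΨ hΦ hτ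
  obtain ⟨C, hgΨ, hgΦ⟩ := exists_isGradient hU h hfm hfp hΨ hΦ
  obtain ⟨⟨r1, r2⟩, r3, r4⟩ := isRegular_kernels h hτ
  have cy := h.lower.continuousOn_Ioo hτ
  have cz := h.upper.continuousOn_Ioo hτ
  have cm := (hfm.continuousOn_Ioo hτ).1
  have cp := (hfp.continuousOn_Ioo hτ).1
  have hsT : ∀ s ∈ Ioo 0 τ, s ∈ Icc 0 T := fun s hs => ⟨hs.1.le, hs.2.le.trans hτ.2⟩
  have hdT : ∀ s ∈ Ioo 0 τ, s ∈ Ioo 0 T := fun s hs => ⟨hs.1, hs.2.trans_le hτ.2⟩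
  have hL := hfm.nonneg
  have hmul : ∀ {f b : ℝ → ℝ}, IsC1With T L f → IsC1With T L b → ∀ s ∈ Ioo 0 τ,
      |f s * deriv b s| ≤ L * L := fun hf hb s hs => by
    rw [abs_mul]
    exact mul_le_mul (hf.abs_le s (hsT s hs)) (hb.abs_deriv_le s (hdT s hs)) (abs_nonneg _) hL
  have hgrad : ∀ {g : ℝ → ℝ}, IsGradient T C g → ∀ s ∈ Ioo 0 τ, |g s| ≤ C * sqrtWeight τ s :=
    fun hg s hs => (hg.abs_le s ⟨hs.1, hs.2.le.trans hτ.2⟩).trans (div_sqrt_le_sqrtWeight hg.nonneg).1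
  have iu : IntervalIntegrable (fun s => (exp (-(y τ - y s) ^ 2 / (4 * (τ - s))) *
        (1 + deriv y s * (y τ - y s) - (y τ - y s) ^ 2 / (2 * (τ - s))) - 1) /
        (2 * √(π * (τ - s) ^ 3))) volume 0 τ :=
    intervalIntegrable_unitRebate h.lower hτ
  have ir := intervalIntegrable_incrementKernel hfm hτ
  have i1 := r1.intervalIntegrable_mul hτ.1 (hgΦ.continuousOn_Ioo hτ) (hgrad hgΦ)
  have i2 := r2.intervalIntegrable_mul hτ.1 (hgΨ.continuousOn_Ioo hτ) (hgrad hgΨ)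
  have q1 := ((r3.intervalIntegrable hτ.1).sub (r1.intervalIntegrable_mul_of_abs_le hτ.1 cz.2
    fun s hs => h.upper.abs_deriv_le s (hdT s hs)))
  have q2 := iu.add ((r4.intervalIntegrable hτ.1).sub (r2.intervalIntegrable_mul_of_abs_le hτ.1 cy.2
    fun s hs => h.lower.abs_deriv_le s (hdT s hs)))
  have q3 : IntervalIntegrable (fun s => fp s *
      (lambdaMinus y z τ (z s) s - deriv z s * upsilonMinus y z τ (z s) s)) volume 0 τ := by
    refine ((r3.intervalIntegrable_mul_of_abs_le hτ.1 cp fun s hs => hfp.abs_le s (hsT s hs)).sub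
      (r1.intervalIntegrable_mul_of_abs_le hτ.1 (cp.mul cz.2) (hmul hfp h.upper))).congr
      fun s _ => ?_
    simp only [Pi.mul_apply]
    ring
  have q4 : IntervalIntegrable (fun s => fm s *
      ((exp (-(y τ - y s) ^ 2 / (4 * (τ - s))) *
        (1 + deriv y s * (y τ - y s) - (y τ - y s) ^ 2 / (2 * (τ - s))) - 1) /
        (2 * √(π * (τ - s) ^ 3)) +
        (lambdaMinus₀ y z τ s - deriv y s * upsilonMinus₀ y z τ s))) volume 0 τ := by
    refine ((j1.sub ir).add ((r4.intervalIntegrable_mul_of_abs_le hτ.1 cm fun s hs =>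
      hfm.abs_le s (hsT s hs)).sub
      (r2.intervalIntegrable_mul_of_abs_le hτ.1 (cm.mul cy.2) (hmul hfm h.lower)))).congr
      fun s _ => ?_
    simp only [Pi.mul_apply, rebateKernel_eq]
    ring
  obtain ⟨l1, e1⟩ := lsIntegral_eq_of_hasDerivAt hτ.1 cm
    (fun s hs => hasDerivAt_etaMinus_lower h hτ hs) q2 q4
  obtain ⟨l2, e2⟩ := lsIntegral_eq_of_hasDerivAt hτ.1 cp
    (fun s hs => hasDerivAt_etaMinus_upper h hτ hs) q1 q3
  refine ⟨ir, l1, l2, i1.add i2, ?_⟩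
  -- The integrands of the two forms agree pointwise: after `rebateKernel_eq` the terms in f⁻ and f⁺
  -- regroup into the increment kernel and the densities of dη⁻ along the two boundaries.
  have key : (∫ s in (0)..τ, (rebateKernel fm y τ s +
      ((Φ s + fp s * deriv z s) * upsilonMinus y z τ (z s) s +
        (Ψ s - fm s * deriv y s) * upsilonMinus₀ y z τ s) +
      (fm s * lambdaMinus₀ y z τ s - fp s * lambdaMinus y z τ (z s) s))) =
      ∫ s in (0)..τ, (incrementKernel fm τ s + fm s *
      ((exp (-(y τ - y s) ^ 2 / (4 * (τ - s))) *
        (1 + deriv y s * (y τ - y s) - (y τ - y s) ^ 2 / (2 * (τ - s))) - 1) /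
        (2 * √(π * (τ - s) ^ 3)) +
        (lambdaMinus₀ y z τ s - deriv y s * upsilonMinus₀ y z τ s)) - fp s *
      (lambdaMinus y z τ (z s) s - deriv z s * upsilonMinus y z τ (z s) s) +
      (Φ s * upsilonMinus y z τ (z s) s + Ψ s * upsilonMinus₀ y z τ s)) :=
    intervalIntegral.integral_congr fun s _ => by
      simp only [rebateKernel_eq]
      ring
  rw [intervalIntegral.integral_add (j1.add j4) j5, intervalIntegral.integral_add j1 j4,
    intervalIntegral.integral_add ((ir.add q4).sub q3) (i1.add i2),
    intervalIntegral.integral_sub (ir.add q4) q3, intervalIntegral.integral_add ir q4] at key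
  rw [e1, e2]
  linarith

end stieltjes

/-! ### Reflection of the strip -/

section reflection

variable (y z b f : ℝ → ℝ) (τ s x : ℝ)

/-- The reflected displacement of index n is the negative of the original one of index -n + 1/2.
Hence υ is odd under reflection, while λ and the Gaussian terms are even, and integer images become
half-integer ones. -/
lemma upsilonTerm_reflect (n : ℤ) :
    upsilonTerm (fun s => -z s) (fun s => -y s) n τ (-x) s =
      -upsilonTerm y z ((-n : ℤ) + 1 / 2) τ x s := by
  have : shift (fun s => -z s) (fun s => -y s) n τ (-x) =
      -shift y z ((-n : ℤ) + 1 / 2) τ x := by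
    simp only [shift]
    push_cast
    ring
  rw [upsilonTerm, upsilonTerm, this, neg_sq, neg_div, neg_mul]

lemma lambdaTerm_reflect (n : ℤ) :
    lambdaTerm (fun s => -z s) (fun s => -y s) n τ (-x) s =
      lambdaTerm y z ((-n : ℤ) + 1 / 2) τ x s := by
  have : shift (fun s => -z s) (fun s => -y s) n τ (-x) =
      -shift y z ((-n : ℤ) + 1 / 2) τ x := by
    simp only [shift]
    push_cast
    ring
  rw [lambdaTerm, lambdaTerm, this, neg_sq]

lemma gaussTerm_reflect (n : ℤ) :
    gaussTerm (fun s => -z s) (fun s => -y s) n τ (-x) s =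
      gaussTerm y z ((-n : ℤ) + 1 / 2) τ x s := by
  have : shift (fun s => -z s) (fun s => -y s) n τ (-x) =
      -shift y z ((-n : ℤ) + 1 / 2) τ x := by
    simp only [shift]
    push_cast
    ring
  rw [gaussTerm, gaussTerm, this, neg_sq]

lemma tsum_comp_neg_ne_zero (g : ℤ → ℝ) :
    ∑' n : {n : ℤ // n ≠ 0}, g (-n) = ∑' n : {n : ℤ // n ≠ 0}, g n :=
  ((Equiv.neg ℤ).subtypeEquiv (by simp)).tsum_eq (fun n : {n : ℤ // n ≠ 0} => g n)

lemma upsilonMinus_reflect :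
    upsilonMinus (fun s => -z s) (fun s => -y s) τ (-x) s = -upsilonPlus y z τ x s := by
  simp only [upsilonMinus, upsilonPlus, upsilonTerm_reflect, tsum_neg]
  exact congrArg Neg.neg ((Equiv.neg ℤ).tsum_eq fun n : ℤ => upsilonTerm y z (n + 1 / 2) τ x s)

lemma lambdaMinus_reflect :
    lambdaMinus (fun s => -z s) (fun s => -y s) τ (-x) s = lambdaPlus y z τ x s := by
  simp only [lambdaMinus, lambdaPlus, lambdaTerm_reflect]
  exact (Equiv.neg ℤ).tsum_eq fun n : ℤ => lambdaTerm y z (n + 1 / 2) τ x s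

lemma etaMinus_reflect :
    etaMinus (fun s => -z s) (fun s => -y s) τ (-x) s = etaPlus y z τ x s := by
  simp only [etaMinus, etaPlus, gaussTerm_reflect, kronecker, neg_inj]
  congr 2
  exact (Equiv.neg ℤ).tsum_eq fun n : ℤ => gaussTerm y z (n + 1 / 2) τ x s

lemma upsilonMinus₀_reflect :
    upsilonMinus₀ (fun s => -z s) (fun s => -y s) τ s = -upsilonPlus₀ y z τ s := by
  simp only [upsilonMinus₀, upsilonPlus₀, upsilonTerm_reflect, tsum_neg]
  rw [tsum_comp_neg_ne_zero fun n : ℤ => upsilonTerm y z (n + 1 / 2) τ (z s) s]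

lemma lambdaMinus₀_reflect :
    lambdaMinus₀ (fun s => -z s) (fun s => -y s) τ s = lambdaPlus₀ y z τ s := by
  simp only [lambdaMinus₀, lambdaPlus₀, lambdaTerm_reflect]
  rw [tsum_comp_neg_ne_zero fun n : ℤ => lambdaTerm y z (n + 1 / 2) τ (z s) s]

lemma gradKernel_neg : gradKernel (fun s => -b s) τ s = -gradKernel b τ s := by
  simp only [gradKernel, show -b τ - -b s = -(b τ - b s) by ring, neg_sq]
  ring

lemma rebateKernel_neg : rebateKernel f (fun s => -b s) τ s = rebateKernel f b τ s := by
  simp only [rebateKernel, show -b τ - -b s = -(b τ - b s) by ring, neg_sq, deriv.fun_neg,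
    neg_mul_neg]

end reflection

/-! ### The equations at the upper boundary, by reflection -/

section upper

variable {T L l₀ τ : ℝ} {y z fm fp U₀ Ψ Φ : ℝ → ℝ} {U : ℝ → ℝ → ℝ}

/-- The reflected initial value integral. -/
lemma integral_initial_reflect (u : ℝ → ℝ) :
    ∫ ξ in (-z 0)..(-y 0), u (-ξ) * upsilonMinus (fun s => -z s) (fun s => -y s) τ ξ 0 =
      -∫ ξ in (y 0)..(z 0), u ξ * upsilonPlus y z τ ξ 0 := by
  rw [← intervalIntegral.integral_comp_neg fun ξ =>
    u (-ξ) * upsilonMinus (fun s => -z s) (fun s => -y s) τ ξ 0, ← intervalIntegral.integral_neg]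
  simp only [upsilonMinus_reflect, neg_neg, mul_neg]

/-- The lower equation of the reflected problem, in which Ψ and Φ, and f⁻ and f⁺, exchange roles;
the signs come from the oddness of υ and of the gradient kernel. -/
lemma IsSolution.volterra_upper (hU : IsSolution T y z fm fp U₀ U) (h : IsStrip T L l₀ y z)
    (hfm : IsC1With T L fm) (hfp : IsC1With T L fp)
    (hΨ : ∀ τ ∈ Ioc 0 T, Ψ τ = -grad y z U τ (y τ)) (hΦ : ∀ τ ∈ Ioc 0 T, Φ τ = grad y z U τ (z τ))
    (hτ : τ ∈ Ioc 0 T) :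
    IntervalIntegrable (fun s => rebateKernel fp z τ s) volume 0 τ ∧
    IntervalIntegrable (fun s => Φ s * gradKernel z τ s) volume 0 τ ∧
    IntervalIntegrable (fun ξ => U 0 ξ * upsilonPlus y z τ ξ 0) volume (y 0) (z 0) ∧
    IntervalIntegrable (fun s => (Φ s + fp s * deriv z s) * upsilonPlus₀ y z τ s
      + (Ψ s - fm s * deriv y s) * upsilonPlus y z τ (y s) s) volume 0 τ ∧
    IntervalIntegrable (fun s => fm s * lambdaPlus y z τ (y s) s
      - fp s * lambdaPlus₀ y z τ s) volume 0 τ ∧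
    Φ τ = fp τ / √(π * τ) - (∫ s in 0..τ, rebateKernel fp z τ s)
      - (∫ s in 0..τ, Φ s * gradKernel z τ s)
      + (∫ ξ in (y 0)..(z 0), U 0 ξ * upsilonPlus y z τ ξ 0)
      + (∫ s in 0..τ, ((Φ s + fp s * deriv z s) * upsilonPlus₀ y z τ s
          + (Ψ s - fm s * deriv y s) * upsilonPlus y z τ (y s) s))
      + (∫ s in 0..τ, (fm s * lambdaPlus y z τ (y s) s - fp s * lambdaPlus₀ y z τ s)) := by
  obtain ⟨j1, j2, j3, j4, j5, heq⟩ := hU.reflect.volterra_lower (Ψ := Φ) (Φ := Ψ) h.neg hfp hfm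
    (fun τ hτ => by rw [grad_reflect, neg_neg, neg_neg, hΦ τ hτ])
    (fun τ hτ => by rw [grad_reflect, neg_neg, hΨ τ hτ]) hτ
  rw [integral_initial_reflect] at heq
  simp only [rebateKernel_neg, gradKernel_neg, upsilonMinus_reflect, lambdaMinus_reflect,
    upsilonMinus₀_reflect, lambdaMinus₀_reflect, deriv.fun_neg, mul_neg,
    intervalIntegral.integral_neg] at j1 j2 j4 j5 heq
  -- The substitution ξ ↦ -ξ reverses the end points of the interval, hence the symmetry.
  have k3 := ((IntervalIntegrable.iff_comp_neg enorm_ne_top).1 j3).symm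
  simp only [neg_neg, upsilonMinus_reflect, mul_neg] at k3
  have e4 : ∀ s, (Φ s + fp s * deriv z s) * upsilonPlus₀ y z τ s
      + (Ψ s - fm s * deriv y s) * upsilonPlus y z τ (y s) s =
      -(-((Ψ s + -(fm s * deriv y s)) * upsilonPlus y z τ (y s) s) +
        -((Φ s - -(fp s * deriv z s)) * upsilonPlus₀ y z τ s)) := fun s => by ring
  have e5 : ∀ s, fm s * lambdaPlus y z τ (y s) s - fp s * lambdaPlus₀ y z τ s =
      -(fp s * lambdaPlus₀ y z τ s - fm s * lambdaPlus y z τ (y s) s) := fun s => by ring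
  refine ⟨j1, ?_, ?_, ?_, ?_, ?_⟩
  · simpa only [Pi.neg_def, neg_neg] using j2.neg
  · simpa only [Pi.neg_def, neg_neg] using k3.neg
  · simp only [e4]
    exact j4.neg
  · simp only [e5]
    exact j5.neg
  · simp only [e4, e5, intervalIntegral.integral_neg]
    linarith

lemma IsSolution.stieltjes_upper (hU : IsSolution T y z fm fp U₀ U) (h : IsStrip T L l₀ y z)
    (hfm : IsC1With T L fm) (hfp : IsC1With T L fp)
    (hΨ : ∀ τ ∈ Ioc 0 T, Ψ τ = -grad y z U τ (y τ)) (hΦ : ∀ τ ∈ Ioc 0 T, Φ τ = grad y z U τ (z τ))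
    (hτ : τ ∈ Ioc 0 T) :
    IntervalIntegrable (fun s => incrementKernel fp τ s) volume 0 τ ∧
    LSIntegrable fm (fun s => etaPlus y z τ (y s) s) 0 τ ∧
    LSIntegrable fp (fun s => etaPlus y z τ (z s) s) 0 τ ∧
    IntervalIntegrable (fun s => Φ s * upsilonPlus₀ y z τ s
      + Ψ s * upsilonPlus y z τ (y s) s) volume 0 τ ∧
    Φ τ = (∫ ξ in (y 0)..(z 0), U 0 ξ * upsilonPlus y z τ ξ 0)
      + fp τ / √(π * τ) - (∫ s in 0..τ, incrementKernel fp τ s)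
      + (lsIntegral fm (fun s => etaPlus y z τ (y s) s) 0 τ
          - lsIntegral fp (fun s => etaPlus y z τ (z s) s) 0 τ)
      - (∫ s in 0..τ, Φ s * gradKernel z τ s)
      + (∫ s in 0..τ, (Φ s * upsilonPlus₀ y z τ s + Ψ s * upsilonPlus y z τ (y s) s)) := by
  obtain ⟨j1, j2, j3, j4, heq⟩ := hU.reflect.stieltjes_lower (Ψ := Φ) (Φ := Ψ) h.neg hfp hfm
    (fun τ hτ => by rw [grad_reflect, neg_neg, neg_neg, hΦ τ hτ])
    (fun τ hτ => by rw [grad_reflect, neg_neg, hΨ τ hτ]) hτ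
  rw [integral_initial_reflect] at heq
  simp only [gradKernel_neg, upsilonMinus_reflect, etaMinus_reflect, upsilonMinus₀_reflect,
    mul_neg, intervalIntegral.integral_neg] at j2 j3 j4 heq
  have e4 : ∀ s, Φ s * upsilonPlus₀ y z τ s + Ψ s * upsilonPlus y z τ (y s) s =
      -(-(Ψ s * upsilonPlus y z τ (y s) s) + -(Φ s * upsilonPlus₀ y z τ s)) := fun s => by ring
  refine ⟨j1, j3, j2, ?_, ?_⟩
  · simp only [e4]
    exact j4.neg
  · simp only [e4, intervalIntegral.integral_neg]
    linarith

end upper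

end DoubleBarrier

/-! ### Assembly of the theorem -/

theorem mainTheorem3 (T : ℝ) (y z fm fp U₀ : ℝ → ℝ) (U : ℝ → ℝ → ℝ) (Ψ Φ : ℝ → ℝ)
    (hy : ContDiffOn ℝ 1 y (Icc 0 T)) (hz : ContDiffOn ℝ 1 z (Icc 0 T))
    (hyz : ∀ τ ∈ Icc 0 T, y τ < z τ)
    (hfm : ContDiffOn ℝ 1 fm (Icc 0 T)) (hfp : ContDiffOn ℝ 1 fp (Icc 0 T))
    (hU : IsSolution T y z fm fp U₀ U)
    (hΨ : ∀ τ ∈ Ioc 0 T, Ψ τ = -grad y z U τ (y τ))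
    (hΦ : ∀ τ ∈ Ioc 0 T, Φ τ = grad y z U τ (z τ)) :
    -- the system of Volterra equations, all of whose integrals converge absolutely
    (∀ τ ∈ Ioc 0 T,
      IntervalIntegrable (fun s => rebateKernel fm y τ s) volume 0 τ ∧
      IntervalIntegrable (fun s => Ψ s * gradKernel y τ s) volume 0 τ ∧
      IntervalIntegrable (fun ξ => U 0 ξ * upsilonMinus y z τ ξ 0) volume (y 0) (z 0) ∧
      IntervalIntegrable (fun s => (Φ s + fp s * deriv z s) * upsilonMinus y z τ (z s) s
        + (Ψ s - fm s * deriv y s) * upsilonMinus₀ y z τ s) volume 0 τ ∧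
      IntervalIntegrable (fun s => fm s * lambdaMinus₀ y z τ s
        - fp s * lambdaMinus y z τ (z s) s) volume 0 τ ∧
      -Ψ τ = -(fm τ / √(π * τ)) + (∫ s in 0..τ, rebateKernel fm y τ s)
        - (∫ s in 0..τ, Ψ s * gradKernel y τ s)
        + (∫ ξ in (y 0)..(z 0), U 0 ξ * upsilonMinus y z τ ξ 0)
        + (∫ s in 0..τ, ((Φ s + fp s * deriv z s) * upsilonMinus y z τ (z s) s
            + (Ψ s - fm s * deriv y s) * upsilonMinus₀ y z τ s))
        + (∫ s in 0..τ, (fm s * lambdaMinus₀ y z τ s - fp s * lambdaMinus y z τ (z s) s))) ∧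
    (∀ τ ∈ Ioc 0 T,
      IntervalIntegrable (fun s => rebateKernel fp z τ s) volume 0 τ ∧
      IntervalIntegrable (fun s => Φ s * gradKernel z τ s) volume 0 τ ∧
      IntervalIntegrable (fun ξ => U 0 ξ * upsilonPlus y z τ ξ 0) volume (y 0) (z 0) ∧
      IntervalIntegrable (fun s => (Φ s + fp s * deriv z s) * upsilonPlus₀ y z τ s
        + (Ψ s - fm s * deriv y s) * upsilonPlus y z τ (y s) s) volume 0 τ ∧
      IntervalIntegrable (fun s => fm s * lambdaPlus y z τ (y s) s
        - fp s * lambdaPlus₀ y z τ s) volume 0 τ ∧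
      Φ τ = fp τ / √(π * τ) - (∫ s in 0..τ, rebateKernel fp z τ s)
        - (∫ s in 0..τ, Φ s * gradKernel z τ s)
        + (∫ ξ in (y 0)..(z 0), U 0 ξ * upsilonPlus y z τ ξ 0)
        + (∫ s in 0..τ, ((Φ s + fp s * deriv z s) * upsilonPlus₀ y z τ s
            + (Ψ s - fm s * deriv y s) * upsilonPlus y z τ (y s) s))
        + (∫ s in 0..τ, (fm s * lambdaPlus y z τ (y s) s - fp s * lambdaPlus₀ y z τ s))) ∧
    -- the Lebesgue–Stieltjes form of the system
    (∀ τ ∈ Ioc 0 T,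
      IntervalIntegrable (fun s => incrementKernel fm τ s) volume 0 τ ∧
      LSIntegrable fm (fun s => etaMinus y z τ (y s) s) 0 τ ∧
      LSIntegrable fp (fun s => etaMinus y z τ (z s) s) 0 τ ∧
      IntervalIntegrable (fun s => Φ s * upsilonMinus y z τ (z s) s
        + Ψ s * upsilonMinus₀ y z τ s) volume 0 τ ∧
      -Ψ τ = (∫ ξ in (y 0)..(z 0), U 0 ξ * upsilonMinus y z τ ξ 0)
        - fm τ / √(π * τ) + (∫ s in 0..τ, incrementKernel fm τ s)
        + (lsIntegral fm (fun s => etaMinus y z τ (y s) s) 0 τ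
            - lsIntegral fp (fun s => etaMinus y z τ (z s) s) 0 τ)
        - (∫ s in 0..τ, Ψ s * gradKernel y τ s)
        + (∫ s in 0..τ, (Φ s * upsilonMinus y z τ (z s) s + Ψ s * upsilonMinus₀ y z τ s))) ∧
    (∀ τ ∈ Ioc 0 T,
      IntervalIntegrable (fun s => incrementKernel fp τ s) volume 0 τ ∧
      LSIntegrable fm (fun s => etaPlus y z τ (y s) s) 0 τ ∧
      LSIntegrable fp (fun s => etaPlus y z τ (z s) s) 0 τ ∧
      IntervalIntegrable (fun s => Φ s * upsilonPlus₀ y z τ s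
        + Ψ s * upsilonPlus y z τ (y s) s) volume 0 τ ∧
      Φ τ = (∫ ξ in (y 0)..(z 0), U 0 ξ * upsilonPlus y z τ ξ 0)
        + fp τ / √(π * τ) - (∫ s in 0..τ, incrementKernel fp τ s)
        + (lsIntegral fm (fun s => etaPlus y z τ (y s) s) 0 τ
            - lsIntegral fp (fun s => etaPlus y z τ (z s) s) 0 τ)
        - (∫ s in 0..τ, Φ s * gradKernel z τ s)
        + (∫ s in 0..τ, (Φ s * upsilonPlus₀ y z τ s + Ψ s * upsilonPlus y z τ (y s) s))) ∧
    -- the kernels are weakly singular or bounded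
    (∃ C : ℝ, ∀ τ ∈ Ioc 0 T, ∀ s ∈ Ioo 0 τ,
      |rebateKernel fm y τ s| ≤ C / √(τ - s) ∧ |rebateKernel fp z τ s| ≤ C / √(τ - s) ∧
      |gradKernel y τ s| ≤ C / √(τ - s) ∧ |gradKernel z τ s| ≤ C / √(τ - s) ∧
      |upsilonMinus y z τ (z s) s| ≤ C ∧ |upsilonMinus₀ y z τ s| ≤ C ∧
      |upsilonPlus y z τ (y s) s| ≤ C ∧ |upsilonPlus₀ y z τ s| ≤ C ∧
      |lambdaMinus y z τ (z s) s| ≤ C ∧ |lambdaMinus₀ y z τ s| ≤ C ∧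
      |lambdaPlus y z τ (y s) s| ≤ C ∧ |lambdaPlus₀ y z τ s| ≤ C) ∧
    -- limits as `s → τ`
    (∀ τ ∈ Ioc 0 T,
      Tendsto (fun s => upsilonMinus₀ y z τ s) (𝓝[<] τ) (𝓝 0) ∧
      Tendsto (fun s => upsilonMinus y z τ (z s) s) (𝓝[<] τ) (𝓝 0) ∧
      Tendsto (fun s => upsilonPlus y z τ (y s) s) (𝓝[<] τ) (𝓝 0) ∧
      Tendsto (fun s => upsilonPlus₀ y z τ s) (𝓝[<] τ) (𝓝 0) ∧
      Tendsto (fun s => etaMinus y z τ (y s) s) (𝓝[<] τ) (𝓝 0) ∧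
      Tendsto (fun s => etaMinus y z τ (z s) s) (𝓝[<] τ) (𝓝 0) ∧
      Tendsto (fun s => etaPlus y z τ (y s) s) (𝓝[<] τ) (𝓝 0) ∧
      Tendsto (fun s => etaPlus y z τ (z s) s) (𝓝[<] τ) (𝓝 0)) ∧
    -- convergence of the image sums, Fourier series and theta function representations
    (∀ τ ∈ Ioc 0 T, ∀ s ∈ Ico 0 τ, ∀ ξ : ℝ,
      Summable (fun n : ℤ => upsilonTerm y z n τ ξ s) ∧
      Summable (fun n : ℤ => upsilonTerm y z (n + 1 / 2) τ ξ s) ∧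
      Summable (fun n : ℤ => lambdaTerm y z n τ ξ s) ∧
      Summable (fun n : ℤ => lambdaTerm y z (n + 1 / 2) τ ξ s) ∧
      Summable (fun n : ℤ => gaussTerm y z n τ ξ s) ∧
      Summable (fun n : ℤ => gaussTerm y z (n + 1 / 2) τ ξ s) ∧
      (∃ S : ℝ, HasSum (fun n : ℕ => exp (-π ^ 2 * (n + 1) ^ 2 / (z τ - y τ) ^ 2 * (τ - s)) *
          cos (π * (n + 1) * (ξ - y τ) / (z τ - y τ))) S ∧
        etaMinus y z τ ξ s =
          -kronecker ξ (y s) / √(π * (τ - s)) + 1 / (z τ - y τ) * (1 + 2 * S)) ∧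
      (∃ S : ℝ, HasSum (fun n : ℕ => exp (-π ^ 2 * (n + 1) ^ 2 / (z τ - y τ) ^ 2 * (τ - s)) *
          (-1) ^ (n + 1) * cos (π * (n + 1) * (ξ - y τ) / (z τ - y τ))) S ∧
        etaPlus y z τ ξ s =
          -kronecker ξ (z s) / √(π * (τ - s)) + 1 / (z τ - y τ) * (1 + 2 * S)) ∧
      (∃ S : ℝ, HasSum (fun n : ℕ => (n + 1) *
          exp (-π ^ 2 * (n + 1) ^ 2 / (z τ - y τ) ^ 2 * (τ - s)) *
          sin (π * (n + 1) * (ξ - y τ) / (z τ - y τ))) S ∧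
        upsilonMinus y z τ ξ s = 2 * π / (z τ - y τ) ^ 2 * S) ∧
      (∃ S : ℝ, HasSum (fun n : ℕ => (n + 1) *
          exp (-π ^ 2 * (n + 1) ^ 2 / (z τ - y τ) ^ 2 * (τ - s)) *
          (-1) ^ (n + 1) * sin (π * (n + 1) * (ξ - y τ) / (z τ - y τ))) S ∧
        upsilonPlus y z τ ξ s = 2 * π / (z τ - y τ) ^ 2 * S) ∧
      etaMinus y z τ ξ s = -kronecker ξ (y s) / √(π * (τ - s))
        + 1 / (z τ - y τ) * theta₃ (phiMinus y z τ ξ (y τ)) (omega₂ y z τ s) ∧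
      etaPlus y z τ ξ s = -kronecker ξ (z s) / √(π * (τ - s))
        + 1 / (z τ - y τ) * theta₃ (phiMinus y z τ (ξ + (z τ - y τ)) (y τ)) (omega₂ y z τ s) ∧
      Differentiable ℝ (fun v => theta₃ v (omega₂ y z τ s)) ∧
      upsilonMinus y z τ ξ s = -(π / (2 * (z τ - y τ) ^ 2)) *
        deriv (fun v => theta₃ v (omega₂ y z τ s)) (phiMinus y z τ ξ (y τ)) ∧
      upsilonPlus y z τ ξ s = -(π / (2 * (z τ - y τ) ^ 2)) *
        deriv (fun v => theta₃ v (omega₂ y z τ s))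
          (phiMinus y z τ (ξ + (z τ - y τ)) (y τ))) := by
  obtain ⟨L₁, l₀, h₁⟩ := exists_isStrip hy hz hyz
  obtain ⟨L₂, h₂⟩ := exists_isC1With hfm
  obtain ⟨L₃, h₃⟩ := exists_isC1With hfp
  obtain ⟨L, hL₁, hL₂, hL₃⟩ : ∃ L, L₁ ≤ L ∧ L₂ ≤ L ∧ L₃ ≤ L :=
    ⟨max L₁ (max L₂ L₃), by simp, by simp, by simp⟩
  have h := h₁ L hL₁
  have cm := h₂ L hL₂
  have cp := h₃ L hL₃
  obtain ⟨K, hK, H⟩ := exists_regular_bound h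
  refine ⟨fun τ hτ => hU.volterra_lower h cm cp hΨ hΦ hτ,
    fun τ hτ => hU.volterra_upper h cm cp hΨ hΦ hτ,
    fun τ hτ => hU.stieltjes_lower h cm cp hΨ hΦ hτ,
    fun τ hτ => hU.stieltjes_upper h cm cp hΨ hΦ hτ,
    -- L + 3L³ bounds the weakly singular kernels after multiplication by √(τ - s); the regular ones
    -- are at most K√(τ - s) ≤ K√T.
    ⟨L + 3 * L ^ 3 + K * √T, fun τ hτ s hs => ?_⟩, fun τ hτ => ?_, fun τ hτ s hs ξ => ?_⟩
  · have hL := cm.nonneg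
    have hs' : s ∈ Ico 0 τ := ⟨hs.1.le, hs.2⟩
    have weak : ∀ {a D : ℝ}, |a| ≤ D / √(τ - s) → D ≤ L + 3 * L ^ 3 →
        |a| ≤ (L + 3 * L ^ 3 + K * √T) / √(τ - s) := fun ha hD => by
      refine ha.trans ?_
      gcongr
      linarith [mul_nonneg hK (sqrt_nonneg T)]
    have regular : ∀ {a : ℝ}, |a| ≤ K * √(τ - s) → |a| ≤ L + 3 * L ^ 3 + K * √T := fun ha => by
      have h1 : K * √(τ - s) ≤ K * √T := by
        gcongr
        linarith [hs.1, hτ.2]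
      have h2 : 0 ≤ L + 3 * L ^ 3 := by positivity
      linarith
    have hle : L ≤ L + 3 * L ^ 3 := le_add_of_nonneg_right (by positivity)
    obtain ⟨⟨u1, u2, u3, u4⟩, ⟨v1, v2, v3, v4⟩, -⟩ := H τ hτ s hs
    exact ⟨weak (abs_rebateKernel_le cm h.lower hτ hs) le_rfl,
      weak (abs_rebateKernel_le cp h.upper hτ hs) le_rfl,
      weak (abs_gradKernel_le h.lower hτ hs') hle, weak (abs_gradKernel_le h.upper hτ hs') hle,
      regular u1, regular u2, regular u3, regular u4,
      regular v1, regular v2, regular v3, regular v4⟩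
  · have lim : ∀ {g : ℝ → ℝ}, (∀ s ∈ Ioo 0 τ, |g s| ≤ K * √(τ - s)) → Tendsto g (𝓝[<] τ) (𝓝 0) :=
      tendsto_zero_of_abs_le_sqrt hτ.1
    exact ⟨lim fun s hs => (H τ hτ s hs).1.2.1, lim fun s hs => (H τ hτ s hs).1.1,
      lim fun s hs => (H τ hτ s hs).1.2.2.1, lim fun s hs => (H τ hτ s hs).1.2.2.2,
      lim fun s hs => (H τ hτ s hs).2.2.1, lim fun s hs => (H τ hτ s hs).2.2.2.1,
      lim fun s hs => (H τ hτ s hs).2.2.2.2.1, lim fun s hs => (H τ hτ s hs).2.2.2.2.2⟩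
  · have hlt := h.lt (Ioc_subset_Icc_self hτ)
    obtain ⟨a1, a2, a3⟩ := summable_image hlt hs.2 ξ 0
    obtain ⟨b1, b2, b3⟩ := summable_image hlt hs.2 ξ (1 / 2)
    simp only [add_zero] at a1 a2 a3
    exact ⟨a1, b1, a2, b2, a3, b3, hasSum_etaMinus hlt hs.2 ξ, hasSum_etaPlus hlt hs.2 ξ,
      hasSum_upsilonMinus hlt hs.2 ξ, hasSum_upsilonPlus hlt hs.2 ξ,
      etaMinus_eq_theta₃ hlt hs.2 ξ, etaPlus_eq_theta₃ hlt hs.2 ξ,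
      fun v => (hasDerivAt_theta₃ (omega₂_nonneg y z τ s)
        (omega₂_lt_one hlt hs.2) v).differentiableAt,
      upsilonMinus_eq_deriv_theta₃ hlt hs.2 ξ, upsilonPlus_eq_deriv_theta₃ hlt hs.2 ξ⟩
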